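/- **Notation.** Let $q>1$, $k>0$, $\beta>0$, $\mu>1$, and let $H_b=\{z\in\mathbb{C}:|\mathrm{Im}\,z|<b\}$. Let $\mathcal{O}_b(H_b)$ be the Banach space of bounded holomorphic functions on $H_b$ with the sup norm. For continuous $h:\mathbb{R}\to\mathbb{C}$ with $|h(m)|\le C(1+|m|)^{-\mu}e^{-\beta|m|}$ put $\mathcal{F}^{-1}(h)(z)=(2\pi)^{-1/2}\int_{\mathbb{R}}h(m)e^{izm}\,dm$, $z\in H_\beta$. Let $\sigma_{q;t}^{\gamma}u(t,z)=u(q^{\gamma}t,z)$, let $[j]_q=1+q+\dots+q^{j-1}$, $[n]_q^!=[1]_q\cdots[n]_q$ (with $[0]_q^!=1$), $\exp_q(x)=\sum_{n\ge0}x^n/[n]_q^!$, and for $x>0$ let $$\mu_q(x)=\frac{\log^2 x}{2\log q}+\Big(-\frac12+\frac{\log(q-1)}{\log q}\Big)\log x .$$ An unbounded sector with vertex $0$ and bisecting direction $d$ is a set $\{re^{i\varphi}:r>0,\ |\varphi-d|<\delta\}$ with $\delta>0$. **$G_q$-summability.** Let $\mathbb{E}$ be a complex Banach space. A formal power series $\sum_{n\ge1}a_nT^n\in\mathbb{E}[[T]]$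 is $G_q$-summable of order $k$ in direction $d$ if $\sum_{n\ge1}a_nq^{-n(n-1)/(2k)}\xi^n$ converges on a disc around $0$ and its sum extends analytically to a function $W$ on an unbounded sector with vertex $0$ and bisecting direction $d$ on which, for some $K,\alpha>0$ and $\Delta>1$, $$\|W(\xi)\|_{\mathbb{E}}\le K|\xi|\exp\Big(\frac{k}{2\log q}\log^2(|\xi|+\Delta)+\alpha\log(|\xi|+\Delta)\Big).$$ **The equation.** Let $\alpha_D>0$, let $d_D\ge1$ be an integer, and let $\mathcal{A}$ be a finite set of triples $\underline{\ell}=(\ell_0,\ell_1,\ell_2)$ of nonnegative integers with $\ell_2\ge1$ and $\ell_1\le\ell_0/k-1$, such that $d_D>\big(k/(\ell_2^2-1)\big)^{1/2}$ for all $\underline{\ell}\in\mathcal{A}$ with $\ell_2\ge2$. Let $J$ be a finite set of positive integers. Let $Q,R_D,R_{\underline{\ell}}\in\mathbb{C}[X]$ with $Q(im)\ne0$ and $R_D(im)\neq0$ for all $m\in\mathbb{R}$, with $\deg R_{\underline{\ell}}\le\deg R_D$ for all $\underline{\ell}\in\mathcal{A}$, and with $$r_1\le|Q(im)/R_D(im)|\le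 r_2\qquad(m\in\mathbb{R})$$ for some $0<r_1<r_2$. Let $A_{\underline{\ell}}$ ($\underline{\ell}\in\mathcal{A}$) and $\mathcal{F}_j$ ($j\in J$) be continuous functions $\mathbb{R}\to\mathbb{C}$ with, for constants $C_{\underline{\ell}},C_j>0$, $$|A_{\underline{\ell}}(m)|\le C_{\underline{\ell}}(1+|m|)^{-\mu}e^{-\beta|m|},\qquad |\mathcal{F}_j(m)|\le C_j(1+|m|)^{-\mu}e^{-\beta|m|}\qquad(m\in\mathbb{R}).$$ Put $a_{\underline{\ell}}=\mathcal{F}^{-1}(A_{\underline{\ell}})$ and, for some $d_1\in\mathbb{R}$ and with $L_{d_1}=[0,\infty)e^{id_1}$, $$f(t,z)=\frac{\pi_{q,k}}{(2\pi)^{1/2}}\int_{L_{d_1}}\int_{-\infty}^{\infty}\Big(\sum_{j\in J}\mathcal{F}_j(m)\tau^j\Big)\Theta_k\Big(\frac t\tau\Big)e^{izm}\,dm\,\frac{d\tau}{\tau},$$ where $$\pi_{q,k}=\frac{q^{-1/(8k)}\sqrt{k}}{\sqrt{2\pi\log q}},\qquad \Theta_k(x)=q^{-\frac k2\frac{\log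 x}{\log q}\left(\frac{\log x}{\log q}-\frac1k\right)},$$ and $t$ lies on the universal covering of $\mathbb{C}\setminus\{0\}$. Consider the problem $$Q(\partial_z)u(t,z)=\exp_q\!\big(\alpha_Dt^{d_D}\sigma_{q;t}^{d_D/k}\big)R_D(\partial_z)u(t,z)+\sum_{\underline{\ell}\in\mathcal{A}}a_{\underline{\ell}}(z)\big(t^{\ell_0}\sigma_{q;t}^{\ell_1}R_{\underline{\ell}}(\partial_z)u\big)(t^{\ell_2},z)+f(t,z),\qquad u(0,z)\equiv0,\tag{1}$$ where $\exp_q(\alpha_Dt^{d_D}\sigma_{q;t}^{d_D/k})=\sum_{n\ge0}\frac{\alpha_D^n}{[n]_q^!}(t^{d_D}\sigma_{q;t}^{d_D/k})^{(n)}$, the exponent $(n)$ denoting the $n$-th iterate. **The geometric configuration.** Put $\tilde\alpha_D=\alpha_Dq^{-d_D(d_D-1)/(2k)}$. Let $\theta\in(0,\pi/2)$, $\rho>0$, and let $S_d$ be an unbounded sector with vertex $0$ and bisecting direction $d\in\mathbb{R}$ such that $\tilde\alpha_D\tau^{d_D}\in U$ for all $\tau\in S_d$, for some unbounded sector $U$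 with vertex $0$ contained in $\{|\arg z|<\pi-\theta\}$, and such that $|\tilde\alpha_D\tau^{d_D}|<q^{1/2}/(q-1)$ for all $|\tau|<\rho$. Let $K_0,C_0>0$ be constants with $$|\exp_q(\tilde\alpha_D\tau^{d_D})|\ge\frac{\sin\theta}{K_0}e^{\mu_q(\tilde\alpha_D|\tau|^{d_D})}\quad(\tau\in S_d,\ |\tau|\ge\rho),\qquad|\exp_q(\tilde\alpha_D\tau^{d_D})|\ge C_0\quad(|\tau|\le\rho),$$ and assume $$r_2<\min\Big\{C_0,\ \frac{\sin\theta}{K_0}\min_{x\ge q^{1/2}/(q-1)}e^{\mu_q(x)}\Big\}.$$ **Theorem.** In this situation there exist $\varpi_c>0$ and $\varpi_f>0$, which do not depend on the functions $A_{\underline{\ell}},\mathcal{F}_j$, on their constants $C_{\underline{\ell}},C_j$ or on $d_1$, such that if $C_{\underline{\ell}}\le\varpi_c$ for all $\underline{\ell}\in\mathcal{A}$ and $C_j\le\varpi_f$ for all $j\in J$, then the following holds. The forcing term is the polynomial $f(t,z)=\sum_{j\in J}\mathcal{F}^{-1}(\mathcal{F}_j)(z)\,q^{j(j-1)/(2k)}t^j$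 in $t$, for $z\in H_\beta$, and problem (1) has a formal solution $\hat u(t,z)=\sum_{p\ge1}u_p(z)t^p$, with coefficients $u_p$ holomorphic on $H_\beta$, such that for every $0<\beta'<\beta$ one has $\hat u\in\mathcal{O}_b(H_{\beta'})[[t]]$, and $\hat u$, as a formal power series with coefficients in $\mathcal{O}_b(H_{\beta'})$, is $G_q$-summable of order $k$ with respect to $t$ in direction $d$. -/

import Mathlib

open scoped BoundedContinuousFunction

noncomputable section

namespace QMahler

/-! ### Regions -/

/-- The horizontal strip `H_b = {z : |Im z| < b}`. -/
def strip (b : ℝ) : Set ℂ := {z | |z.im| < b}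

/-- The unbounded open sector with vertex `0`, bisecting direction `d` and half-opening `δ`. -/
def sector (d δ : ℝ) : Set ℂ :=
  {z | ∃ r φ : ℝ, 0 < r ∧ |φ - d| < δ ∧ z = (r : ℂ) * Complex.exp ((φ : ℂ) * Complex.I)}

/-! ### The `q`-exponential -/

/-- `[j]_q = 1 + q + ⋯ + q^(j-1)`. -/
def qNumber (q : ℝ) (j : ℕ) : ℝ := ∑ i ∈ Finset.range j, q ^ i

/-- `[n]_q! = [1]_q [2]_q ⋯ [n]_q`. -/
def qFactorial (q : ℝ) (n : ℕ) : ℝ := ∏ j ∈ Finset.range n, qNumber q (j + 1)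

/-- `exp_q(z) = ∑ z^n / [n]_q!`, an entire function for `q > 1`. -/
def qExp (q : ℝ) (z : ℂ) : ℂ := ∑' n : ℕ, z ^ n / (qFactorial q n : ℂ)

/-- `log² x / (2 log q) + (-1/2 + log (q-1) / log q) log x`, the exponent that governs the growth
of `exp_q`. -/
def qExpGrowth (q x : ℝ) : ℝ :=
  Real.log x ^ 2 / (2 * Real.log q) +
    (-(1 / 2) + Real.log (q - 1) / Real.log q) * Real.log x

/-! ### Inverse Fourier transform -/

/-- `(2π)^(-1/2) ∫ h(m) exp(i z m) dm`, at a complex argument `z`. -/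
def invFourier (h : ℝ → ℂ) (z : ℂ) : ℂ :=
  ((1 / Real.sqrt (2 * Real.pi) : ℝ) : ℂ) *
    ∫ m : ℝ, h m * Complex.exp (Complex.I * z * (m : ℂ))

/-! ### Bounded holomorphic functions on a strip -/

/-- `O_b(H_b)`: the bounded holomorphic functions on the strip `H_b`, with the sup norm. -/
def Ob (b : ℝ) : Submodule ℂ (strip b →ᵇ ℂ) where
  carrier := {g | ∃ G : ℂ → ℂ, DifferentiableOn ℂ G (strip b) ∧ ∀ z : strip b, g z = G z}
  add_mem' := by
    rintro g h ⟨G, hG, hg⟩ ⟨H, hH, hh⟩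
    exact ⟨fun z => G z + H z, hG.add hH, fun z => by simp [hg, hh]⟩
  zero_mem' := ⟨fun _ => 0, differentiableOn_const 0, fun z => by simp⟩
  smul_mem' := by
    rintro c g ⟨G, hG, hg⟩
    exact ⟨fun z => c * G z, hG.const_mul c, fun z => by simp [hg]⟩

theorem isOpen_strip (b : ℝ) : IsOpen (strip b) :=
  isOpen_lt (Complex.continuous_im.abs) continuous_const

theorem isClosed_Ob (b : ℝ) : IsClosed (Ob b : Set (strip b →ᵇ ℂ)) := by
  classical
  refine isClosed_of_closure_subset fun g hg => ?_
  obtain ⟨x, hx, hlim⟩ := mem_closure_iff_seq_limit.1 hg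
  choose G hG hgG using hx
  refine ⟨fun z => if h : z ∈ strip b then g ⟨z, h⟩ else 0, ?_, fun z => by simp⟩
  have key : TendstoUniformlyOn G (fun z => if h : z ∈ strip b then g ⟨z, h⟩ else 0)
      Filter.atTop (strip b) := by
    have h1 := BoundedContinuousFunction.tendsto_iff_tendstoUniformly.1 hlim
    rw [Metric.tendstoUniformlyOn_iff]
    rw [Metric.tendstoUniformly_iff] at h1
    intro ε hε
    filter_upwards [h1 ε hε] with n hn z hz
    have := hn ⟨z, hz⟩
    rw [hgG n ⟨z, hz⟩] at this
    simpa [hz] using this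
  exact key.tendstoLocallyUniformlyOn.differentiableOn
    (Filter.Eventually.of_forall hG) (isOpen_strip b)

instance (b : ℝ) : CompleteSpace (Ob b) := (isClosed_Ob b).completeSpace_coe

/-! ### `G_q`-summability -/

/-- The weight `q^(n(n-1)/(2k))` of the formal `q`-Borel transform of order `k`. -/
def qBorelWeight (q k : ℝ) (n : ℕ) : ℝ := q ^ ((n : ℝ) * ((n : ℝ) - 1) / (2 * k))

/-- The formal power series `∑_{n ≥ 1} a n T^n` (so `a 0 = 0`) with coefficients in the complex
Banach space `E` is `G_q`-summable of order `k` in the direction `d`: its formal `q`-Borel transform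
`∑ a n / q^(n(n-1)/(2k)) ξ^n` converges on a disc around `0`, and its sum extends analytically to an
unbounded sector with bisecting direction `d`, with `q`-exponential growth of order `k` there. -/
def GqSummable {E : Type*} [NormedAddCommGroup E] [NormedSpace ℂ E] [CompleteSpace E]
    (q k d : ℝ) (a : ℕ → E) : Prop :=
  a 0 = 0 ∧
  ∃ ρ > (0 : ℝ), ∃ δ > (0 : ℝ), ∃ W : ℂ → E,
    (∀ ξ ∈ Metric.ball (0 : ℂ) ρ,
      HasSum (fun n : ℕ => (ξ ^ n / (qBorelWeight q k n : ℂ)) • a n) (W ξ)) ∧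
    DifferentiableOn ℂ W (Metric.ball (0 : ℂ) ρ ∪ sector d δ) ∧
    ∃ K > (0 : ℝ), ∃ α > (0 : ℝ), ∃ Δ > (1 : ℝ), ∀ ξ ∈ sector d δ,
      ‖W ξ‖ ≤ K * ‖ξ‖ *
        Real.exp (k / (2 * Real.log q) * Real.log (‖ξ‖ + Δ) ^ 2 + α * Real.log (‖ξ‖ + Δ))

/-! ### Formal operators

A formal power series in `t` whose coefficients are functions of `z` is an element of
`PowerSeries (ℂ → ℂ)`; the ring operations on the coefficients are pointwise in `z`. -/

/-- `P(∂_z)` applied to a function of `z`. -/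
def diffPoly (P : Polynomial ℂ) (g : ℂ → ℂ) : ℂ → ℂ :=
  fun z => ∑ j ∈ Finset.range (P.natDegree + 1), P.coeff j * iteratedDeriv j g z

/-- `P(∂_z)` applied to a formal power series in `t`, coefficient by coefficient. -/
def diffPolyT (P : Polynomial ℂ) (u : PowerSeries (ℂ → ℂ)) : PowerSeries (ℂ → ℂ) :=
  PowerSeries.mk fun p => diffPoly P (PowerSeries.coeff p u)

/-- The dilation `σ_{q;t}^γ : u(t,z) ↦ u(q^γ t, z)`. -/
def dilation (q γ : ℝ) (u : PowerSeries (ℂ → ℂ)) : PowerSeries (ℂ → ℂ) :=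
  PowerSeries.rescale (fun _ : ℂ => ((q ^ γ : ℝ) : ℂ)) u

/-- The Mahler operator `u(t,z) ↦ u(t^l, z)`, for `l ≥ 1`. -/
def mahler (l : ℕ) (u : PowerSeries (ℂ → ℂ)) : PowerSeries (ℂ → ℂ) :=
  PowerSeries.mk fun N => if l ∣ N then PowerSeries.coeff (N / l) u else 0

/-- The operator `t^D σ_{q;t}^{D/k}`. -/
def leadOp (q k : ℝ) (D : ℕ) (u : PowerSeries (ℂ → ℂ)) : PowerSeries (ℂ → ℂ) :=
  PowerSeries.X ^ D * dilation q ((D : ℝ) / k) u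

/-- For `D ≥ 1` the `n`-th iterate of `t^D σ_{q;t}^{D/k}` contributes nothing to the coefficient of
`t^N` as soon as `n > N`. -/
theorem coeff_iterate_leadOp (q k : ℝ) {D : ℕ} (hD : 1 ≤ D) (u : PowerSeries (ℂ → ℂ)) (n : ℕ) :
    ∀ N < n, PowerSeries.coeff N ((leadOp q k D)^[n] u) = 0 := by
  induction n with
  | zero => intro N hN; omega
  | succ n ih =>
    intro N hN
    rw [Function.iterate_succ_apply', leadOp, PowerSeries.coeff_X_pow_mul']
    split_ifs with h
    · rw [dilation, PowerSeries.coeff_rescale, ih _ (by omega), mul_zero]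
    · rfl

/-- The formal operator of infinite order
`exp_q(α t^D σ_{q;t}^{D/k}) = ∑_{n ≥ 0} α^n / [n]_q! (t^D σ_{q;t}^{D/k})^(n)`, for `D ≥ 1`.
By `coeff_iterate_leadOp` only the terms with `n ≤ N` contribute to the coefficient of `t^N`. -/
def qExpOp (q k α : ℝ) (D : ℕ) (u : PowerSeries (ℂ → ℂ)) : PowerSeries (ℂ → ℂ) :=
  PowerSeries.mk fun N => ∑ n ∈ Finset.range (N + 1),
    (fun _ : ℂ => ((α ^ n / qFactorial q n : ℝ) : ℂ)) *
      PowerSeries.coeff N ((leadOp q k D)^[n] u)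

/-! ### The forcing term -/

/-- The kernel `Θ_k(t/τ)` as a function of `x = log (t/τ)`: it is `q^(-(k/2) (x/log q) (x/log q - 1/k))`. -/
def thetaKernel (q k : ℝ) (x : ℂ) : ℂ :=
  Complex.exp (-((k : ℂ) / 2) * (x / (Real.log q : ℂ)) *
    (x / (Real.log q : ℂ) - 1 / (k : ℂ)) * (Real.log q : ℂ))

/-- `π_{q,k} = q^(-1/(8k)) √k / √(2π log q)`. -/
def piConst (q k : ℝ) : ℝ :=
  q ^ (-(1 / (8 * k))) * Real.sqrt k / Real.sqrt (2 * Real.pi * Real.log q)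

/-- The forcing term `f(t,z)`: inverse Fourier transform and `q`-Laplace transform of order `k`
along the half line `[0,∞)e^{i d₁}` of `∑_{j ∈ J} F_j(m) τ^j`. It is a function on the universal
covering of `ℂ \ {0}`: the argument `s` is a logarithm of `t`, and on the path `τ = r e^{i d₁}`
one has `log (t/τ) = s - log r - i d₁` and `dτ/τ = dr/r`. -/
def forcing (q k d₁ : ℝ) (J : Finset ℕ) (F : ℕ → ℝ → ℂ) (s z : ℂ) : ℂ :=
  ((piConst q k / Real.sqrt (2 * Real.pi) : ℝ) : ℂ) *
    ∫ r in Set.Ioi (0 : ℝ), ∫ m : ℝ,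
      (∑ j ∈ J, F j m * ((r : ℂ) * Complex.exp (Complex.I * (d₁ : ℂ))) ^ j) *
        thetaKernel q k (s - (Real.log r : ℂ) - Complex.I * (d₁ : ℂ)) *
        Complex.exp (Complex.I * z * (m : ℂ)) / (r : ℂ)

/-- The polynomial `∑_{j ∈ J} F_j(z) q^(j(j-1)/(2k)) t^j`, with `F_j(z)` the inverse Fourier
transform of `F_j(m)`. -/
def forcingSeries (q k : ℝ) (J : Finset ℕ) (F : ℕ → ℝ → ℂ) : PowerSeries (ℂ → ℂ) :=
  ∑ j ∈ J, PowerSeries.monomial j fun z => invFourier (F j) z * (qBorelWeight q k j : ℂ)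

/-! ### The equation -/

/-- The term `a(z) (t^l₀ σ_{q;t}^l₁ R(∂_z) u)(t^l₂, z)`, with `a` the inverse Fourier transform
of `A`, and `l = (l₀, l₁, l₂)`. -/
def mahlerTerm (q : ℝ) (l : ℕ × ℕ × ℕ) (R : Polynomial ℂ) (A : ℝ → ℂ)
    (u : PowerSeries (ℂ → ℂ)) : PowerSeries (ℂ → ℂ) :=
  PowerSeries.C (invFourier A) *
    mahler l.2.2 (PowerSeries.X ^ l.1 * dilation q (l.2.1 : ℝ) (diffPolyT R u))

/-- `u` is a formal solution, with coefficients holomorphic on the strip `H_β`, of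
`Q(∂_z)u = exp_q(α t^D σ^{D/k}) R_D(∂_z)u + ∑ a_l(z) (t^l₀ σ^l₁ R_l(∂_z)u)(t^l₂,z) + f(t,z)` with
`u(0,z) = 0`: the two sides have the same coefficients as power series in `t`. -/
def IsFormalSolution (q k β αD : ℝ) (dD : ℕ) (𝒜 : Finset (ℕ × ℕ × ℕ)) (J : Finset ℕ)
    (Q RD : Polynomial ℂ) (R : ℕ × ℕ × ℕ → Polynomial ℂ)
    (A : ℕ × ℕ × ℕ → ℝ → ℂ) (F : ℕ → ℝ → ℂ) (u : PowerSeries (ℂ → ℂ)) : Prop :=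
  (∀ p : ℕ, DifferentiableOn ℂ (PowerSeries.coeff p u) (strip β)) ∧
  (∀ z ∈ strip β, PowerSeries.coeff 0 u z = 0) ∧
  ∀ p : ℕ, ∀ z ∈ strip β,
    PowerSeries.coeff p (diffPolyT Q u) z =
      PowerSeries.coeff p
        (qExpOp q k αD dD (diffPolyT RD u) + ∑ l ∈ 𝒜, mahlerTerm q l (R l) (A l) u +
          forcingSeries q k J F) z

/-! ### The geometric configuration -/

/-- `α_D / q^(d_D (d_D - 1)/(2k))`. -/
def alphaTilde (q k αD : ℝ) (dD : ℕ) : ℝ := αD / qBorelWeight q k dD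

/-- The sector `S_d` (of half-opening `δ`) and the radius `ρ` are admissible: `τ ↦ α̃_D τ^{d_D}` maps
`S_d` into an unbounded sector `U` contained in `{|arg z| < π - θ}`, and maps the disc `D(0,ρ)` into
the disc `D(0, q^{1/2}/(q-1))`. -/
def GeometricConfiguration (q k αD : ℝ) (dD : ℕ) (d δ ρ θ : ℝ) : Prop :=
  (∃ η ω : ℝ, 0 < ω ∧ sector η ω ⊆ sector 0 (Real.pi - θ) ∧
    ∀ τ ∈ sector d δ, (alphaTilde q k αD dD : ℂ) * τ ^ dD ∈ sector η ω) ∧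
  ∀ τ ∈ Metric.ball (0 : ℂ) ρ,
    (alphaTilde q k αD dD : ℂ) * τ ^ dD ∈ Metric.ball (0 : ℂ) (Real.sqrt q / (q - 1))

end QMahler

end

open QMahler

/-! The solution is sought as `∑ q^(n(n-1)/(2k)) F⁻¹(ω w_n)(z) t^n`, with `ω(m) = (1+|m|)^(-μ)
e^(-β|m|)` and `w_n` in the Banach space `E` of bounded continuous functions on the line. On the
`q`-Borel transform `W(τ) = ∑ w_n τ^n` the operator `t^D σ^(D/k)` acts as multiplication by `τ^D /
q^(D(D-1)/(2k))`, so the operator of infinite order becomes multiplication by `e(τ) = exp_q(α̃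
τ^D)`. Division by `R_D(im)` turns the problem into `Φ W = e W + ∑ M_l W + f` in `E`, where `Φ` is
multiplication by `Q/R_D`, of norm at most `r₂`, and `M_l` combines a bounded convolution operator
`T_l` with the scalars `mahlerWeight`.

Near `0`: the condition on `l₁` forces `l₀ ≥ 1`, so `M_l` only uses earlier coefficients. As `e(0) =
1` and `‖Φ‖ < 1`, each `w_p` results from inverting `Φ - 1`, and `mahlerWeight ≤ 1` gives geometric
bounds (`exists_solution_geometric`).

Along the sector the terms are of two kinds. For `l₂ ≥ 2` the factors `mahlerWeight` decay like a
Gaussian in `n`; `M_l W` is then an entire function, already determined by the `w_n`, and joins the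
inhomogeneity. For `l₂ = 1` the term is a multiple of `T_l W(λτ)` with `λ ≤ 1/q`. Hence `W(τ)` is
determined by values at smaller moduli once `Φ - e(τ)` is inverted, which is possible because `|e| >
‖Φ‖`; this continues `W` step by step (`exists_continuation`).

For the growth, an entire term is of size `exp(k l₂²/(2(l₂²-1) log q) · log²|τ|)` up to powers of
`|τ|`, and the condition on `d_D` says exactly that this exponent is below `(d_D² + k)/(2 log q)`.
Division by `|e|`, which is at least of size `exp(d_D²/(2 log q) · log²|τ|)` up to powers, leaves
order `k`. In the dilated terms `e` absorbs the powers of `τ`, and a large power of `|τ| + 2` in the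
majorant makes them a small perturbation (`growth_of_functional_equation`). Finally `F⁻¹` is bounded
from `E` into `O_b(H_β')` and carries every property of `W` over. -/

namespace QMahler

/-! ### Weights -/

theorem qBorelWeight_pos {q : ℝ} (hq : 1 < q) (k : ℝ) (n : ℕ) : 0 < qBorelWeight q k n :=
  Real.rpow_pos_of_pos (by linarith) _

theorem natCast_mul_sub_one_nonneg (n : ℕ) : 0 ≤ (n : ℝ) * ((n : ℝ) - 1) := by
  rcases Nat.eq_zero_or_pos n with rfl | h
  · simp
  · have : (1 : ℝ) ≤ n := by exact_mod_cast h
    nlinarith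

theorem one_le_qBorelWeight {q k : ℝ} (hq : 1 < q) (hk : 0 < k) (n : ℕ) :
    1 ≤ qBorelWeight q k n :=
  Real.one_le_rpow hq.le (div_nonneg (natCast_mul_sub_one_nonneg n) (by linarith))

/-- The cross term `q^(ab/k)` is what a dilation by `q^(a/k)` does to `t^b`; for this reason the
Borel transform conjugates `t^a σ^(a/k)` to a multiple of `τ^a`. -/
theorem qBorelWeight_add {q : ℝ} (hq : 1 < q) (k : ℝ) (a b : ℕ) :
    qBorelWeight q k (a + b) =
      qBorelWeight q k a * qBorelWeight q k b * q ^ ((a : ℝ) * b / k) := by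
  have hq0 : 0 < q := by linarith
  rw [qBorelWeight, qBorelWeight, qBorelWeight, ← Real.rpow_add hq0, ← Real.rpow_add hq0]
  congr 1
  push_cast
  -- For `k = 0` every exponent is `0` by the convention for division by zero.
  rcases eq_or_ne k 0 with rfl | hk
  · simp
  · field_simp
    ring

/-- The factor by which the Mahler term attached to `l` multiplies the `n`-th coefficient of the
`q`-Borel transform. -/
noncomputable def mahlerWeight (q k : ℝ) (l : ℕ × ℕ × ℕ) (n : ℕ) : ℝ :=
  q ^ ((l.2.1 : ℝ) * n) * qBorelWeight q k n / qBorelWeight q k ((n + l.1) * l.2.2)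

theorem mahlerWeight_nonneg {q : ℝ} (hq : 1 < q) (k : ℝ) (l : ℕ × ℕ × ℕ) (n : ℕ) :
    0 ≤ mahlerWeight q k l n :=
  div_nonneg (mul_nonneg (Real.rpow_nonneg (by linarith) _) (qBorelWeight_pos hq k n).le)
    (qBorelWeight_pos hq k _).le

theorem mahlerWeight_eq_rpow {q : ℝ} (hq : 1 < q) (k : ℝ) (l : ℕ × ℕ × ℕ) (n : ℕ) :
    mahlerWeight q k l n = q ^ ((l.2.1 : ℝ) * n + (n : ℝ) * ((n : ℝ) - 1) / (2 * k) -
      (((n + l.1) * l.2.2 : ℕ) : ℝ) * ((((n + l.1) * l.2.2 : ℕ) : ℝ) - 1) / (2 * k)) := by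
  have hq0 : 0 < q := by linarith
  rw [mahlerWeight, qBorelWeight, qBorelWeight, Real.rpow_sub hq0, Real.rpow_add hq0]

/-- With `N = (n + l₀) l₂`, the difference `N(N-1) - n(n-1)` is at least `(l₂² - 1) n²`, the
remaining terms being nonnegative because `l₀ ≥ 1`. The bound is Gaussian in `n` exactly when `l₂ ≥
2`. -/
theorem mahlerWeight_le_exp {q k : ℝ} (hq : 1 < q) (hk : 0 < k) {l : ℕ × ℕ × ℕ}
    (hl₀ : 1 ≤ l.1) (hl₂ : 1 ≤ l.2.2) (n : ℕ) :
    mahlerWeight q k l n ≤ Real.exp (Real.log q *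
      ((l.2.1 : ℝ) * n - ((l.2.2 : ℝ) ^ 2 - 1) / (2 * k) * (n : ℝ) ^ 2)) := by
  have hq0 : 0 < q := by linarith
  rw [mahlerWeight_eq_rpow hq, Real.rpow_def_of_pos hq0]
  refine Real.exp_le_exp.2 (mul_le_mul_of_nonneg_left ?_ (Real.log_pos hq).le)
  have h₀ : (1 : ℝ) ≤ l.1 := by exact_mod_cast hl₀
  have h₂ : (1 : ℝ) ≤ l.2.2 := by exact_mod_cast hl₂
  have hn : (0 : ℝ) ≤ n := n.cast_nonneg
  push_cast
  have key : ((n : ℝ) * (n - 1) - ((n + l.1) * l.2.2) * ((n + l.1) * l.2.2 - 1)) / (2 * k) ≤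
      (-(((l.2.2 : ℝ) ^ 2 - 1) * (n : ℝ) ^ 2)) / (2 * k) := by
    refine div_le_div_of_nonneg_right ?_ (by linarith)
    set a := (l.1 : ℝ)
    set b := (l.2.2 : ℝ)
    have h1 : 0 ≤ b * (b * (2 * n * a + a ^ 2) - (n + a)) := by
      refine mul_nonneg (by linarith) ?_
      have : (n + a) ≤ 1 * (2 * n * a + a ^ 2) := by nlinarith
      have h2 : 1 * (2 * n * a + a ^ 2) ≤ b * (2 * n * a + a ^ 2) :=
        mul_le_mul_of_nonneg_right h₂ (by positivity)
      linarith
    nlinarith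
  have e : ((l.2.2 : ℝ) ^ 2 - 1) / (2 * k) * (n : ℝ) ^ 2 =
    ((((l.2.2 : ℝ) ^ 2 - 1) * (n : ℝ) ^ 2)) / (2 * k) := by ring
  rw [e]
  rw [sub_div, neg_div] at key
  linarith

/-- Since `l₁ ≤ l₀/k`, the dilation costs at most `2 l₀ n/(2k)` in the exponent, and `n(n-1) + 2 l₀
n ≤ (n+l₀)(n+l₀-1) ≤ N(N-1)` with `N = (n + l₀) l₂`. -/
theorem mahlerWeight_le_one {q k : ℝ} (hq : 1 < q) (hk : 0 < k) {l : ℕ × ℕ × ℕ}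
    (hl₂ : 1 ≤ l.2.2) (hl : (l.2.1 : ℝ) ≤ (l.1 : ℝ) / k - 1) (n : ℕ) :
    mahlerWeight q k l n ≤ 1 := by
  rw [mahlerWeight_eq_rpow hq]
  refine Real.rpow_le_one_of_one_le_of_nonpos hq.le ?_
  have hn : (0 : ℝ) ≤ n := n.cast_nonneg
  have ha : (0 : ℝ) ≤ l.1 := l.1.cast_nonneg
  have h₂ : (1 : ℝ) ≤ l.2.2 := by exact_mod_cast hl₂
  have h1 : (l.2.1 : ℝ) * n ≤ (2 * l.1 * n) / (2 * k) := by
    have : (2 * l.1 * n) / (2 * k) = (l.1 : ℝ) / k * n := by field_simp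
    rw [this]
    exact mul_le_mul_of_nonneg_right (by linarith) hn
  have h2 : (2 * l.1 * n) / (2 * k) + (n : ℝ) * (n - 1) / (2 * k) -
      (((n + l.1) * l.2.2 : ℕ) : ℝ) * ((((n + l.1) * l.2.2 : ℕ) : ℝ) - 1) / (2 * k) ≤ 0 := by
    rw [← add_div, ← sub_div]
    refine div_nonpos_of_nonpos_of_nonneg ?_ (by linarith)
    have h3 := natCast_mul_sub_one_nonneg l.1
    have h5 : ((n + l.1 : ℕ) : ℝ) ≤ (((n + l.1) * l.2.2 : ℕ) : ℝ) := by
      exact_mod_cast Nat.le_mul_of_pos_right _ hl₂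
    have h4 : ((n + l.1 : ℕ) : ℝ) * (((n + l.1 : ℕ) : ℝ) - 1) ≤
        (((n + l.1) * l.2.2 : ℕ) : ℝ) * ((((n + l.1) * l.2.2 : ℕ) : ℝ) - 1) := by
      rcases Nat.eq_zero_or_pos (n + l.1) with h | h
      · simp [h]
      · have h6 : (1 : ℝ) ≤ ((n + l.1 : ℕ) : ℝ) := by exact_mod_cast h
        exact mul_le_mul h5 (by linarith) (by linarith) (by linarith)
    push_cast at h4 h5 ⊢
    nlinarith
  linarith

/-- Without a Mahler substitution the quadratic exponents cancel. What remains is geometric in `n`,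
that is, a dilation of `τ`. -/
theorem mahlerWeight_of_one {q : ℝ} (hq : 1 < q) (k : ℝ) {l : ℕ × ℕ × ℕ} (hl₂ : l.2.2 = 1)
    (n : ℕ) :
    mahlerWeight q k l n = (q ^ ((l.2.1 : ℝ) - (l.1 : ℝ) / k)) ^ n / qBorelWeight q k l.1 := by
  have hq0 : 0 < q := by linarith
  have h1 := (qBorelWeight_pos hq k n).ne'
  have h2 := (qBorelWeight_pos hq k l.1).ne'
  have h3 : q ^ ((n : ℝ) * l.1 / k) ≠ 0 := (Real.rpow_pos_of_pos hq0 _).ne'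
  rw [mahlerWeight, hl₂, mul_one, qBorelWeight_add hq, ← Real.rpow_natCast, ← Real.rpow_mul hq0.le,
    sub_mul, Real.rpow_sub hq0]
  have : (l.1 : ℝ) / k * n = (n : ℝ) * l.1 / k := by ring
  rw [this]
  field_simp

/-! ### The `q`-exponential -/

theorem natCast_le_qNumber {q : ℝ} (hq : 1 < q) (j : ℕ) : (j : ℝ) ≤ qNumber q j := by
  rw [qNumber]
  calc (j : ℝ) = ∑ _i ∈ Finset.range j, (1 : ℝ) := by simp
    _ ≤ _ := Finset.sum_le_sum fun i _ => one_le_pow₀ hq.le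

theorem factorial_le_qFactorial {q : ℝ} (hq : 1 < q) (n : ℕ) :
    (n.factorial : ℝ) ≤ qFactorial q n := by
  rw [qFactorial, ← Finset.prod_range_add_one_eq_factorial]
  push_cast
  refine Finset.prod_le_prod (fun i _ => by positivity) fun i _ => ?_
  exact_mod_cast natCast_le_qNumber hq (i + 1)

theorem one_le_qFactorial {q : ℝ} (hq : 1 < q) (n : ℕ) : 1 ≤ qFactorial q n :=
  le_trans (by exact_mod_cast n.factorial_pos) (factorial_le_qFactorial hq n)

theorem qFactorial_zero (q : ℝ) : qFactorial q 0 = 1 := by simp [qFactorial]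

theorem norm_pow_div_qFactorial_le {q : ℝ} (hq : 1 < q) (z : ℂ) (n : ℕ) :
    ‖z ^ n / (qFactorial q n : ℂ)‖ ≤ ‖z‖ ^ n / n.factorial := by
  have h := one_le_qFactorial hq n
  rw [norm_div, norm_pow, Complex.norm_real, Real.norm_of_nonneg (by linarith)]
  exact div_le_div_of_nonneg_left (by positivity) (by exact_mod_cast n.factorial_pos)
    (factorial_le_qFactorial hq n)

theorem hasSum_qExp {q : ℝ} (hq : 1 < q) (z : ℂ) :
    HasSum (fun n : ℕ => z ^ n / (qFactorial q n : ℂ)) (qExp q z) :=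
  (Summable.of_norm_bounded (Real.summable_pow_div_factorial ‖z‖)
    (norm_pow_div_qFactorial_le hq z)).hasSum

theorem differentiable_qExp {q : ℝ} (hq : 1 < q) : Differentiable ℂ (qExp q) := by
  intro z
  have : DifferentiableOn ℂ (qExp q) (Metric.ball 0 (‖z‖ + 1)) := by
    refine Complex.differentiableOn_tsum_of_summable_norm
      (Real.summable_pow_div_factorial (‖z‖ + 1))
      (fun n => by fun_prop) Metric.isOpen_ball fun n w hw => ?_
    refine (norm_pow_div_qFactorial_le hq w n).trans ?_
    have : ‖w‖ ≤ ‖z‖ + 1 := (mem_ball_zero_iff.1 hw).le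
    gcongr
  exact this.differentiableAt (Metric.isOpen_ball.mem_nhds (by simp))

/-! ### Causal recursions -/

theorem exists_causal_recursion {E : Type*} [Zero E] (G : ℕ → (ℕ → E) → E)
    (hG : ∀ N v w, (∀ j < N, v j = w j) → G N v = G N w) : ∃ w : ℕ → E, ∀ N, w N = G N w := by
  classical
  let w : ℕ → E := WellFounded.fix (C := fun _ => E) Nat.lt_wfRel.wf
    -- The filler `0` at indices `j ≥ N` is harmless, since `G N` only depends on the values below
    -- `N`.
    fun N f => G N fun j => if h : j < N then f j h else 0
  refine ⟨w, fun N => ?_⟩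
  change WellFounded.fix _ _ N = _
  rw [WellFounded.fix_eq]
  refine hG N _ _ fun j hj => ?_
  rw [dif_pos hj]

/-! ### The recursion for the Borel coefficients. -/

section Recursion

variable {E : Type*} [NormedAddCommGroup E] [NormedSpace ℂ E]

/-- The coefficient of order `p` of the `q`-Borel transform of the Mahler term attached to `l`,
with `T` acting on the coefficients. -/
noncomputable def mahlerCoeff (q k : ℝ) (l : ℕ × ℕ × ℕ) (T : E →L[ℂ] E) (w : ℕ → E) (p : ℕ) : E :=
  if l.2.2 ∣ p ∧ l.1 ≤ p / l.2.2 then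
    (mahlerWeight q k l (p / l.2.2 - l.1) : ℂ) • T (w (p / l.2.2 - l.1)) else 0

/-- Causality: `l₀ ≥ 1` places the index `p / l₂ - l₀` strictly below `p`. -/
theorem mahlerCoeff_congr (q k : ℝ) {l : ℕ × ℕ × ℕ} (hl₀ : 1 ≤ l.1) (T : E →L[ℂ] E)
    {v w : ℕ → E} {p : ℕ} (h : ∀ j < p, v j = w j) :
    mahlerCoeff q k l T v p = mahlerCoeff q k l T w p := by
  rw [mahlerCoeff, mahlerCoeff]
  split_ifs with hp
  · rw [h]
    have := Nat.div_le_self p l.2.2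
    omega
  · rfl

theorem norm_mahlerCoeff_le {q k : ℝ} (hq : 1 < q) (hk : 0 < k) {l : ℕ × ℕ × ℕ}
    (hl₀ : 1 ≤ l.1) (hl₂ : 1 ≤ l.2.2) (hl : (l.2.1 : ℝ) ≤ (l.1 : ℝ) / k - 1) (T : E →L[ℂ] E)
    {w : ℕ → E} {p : ℕ} {M : ℝ} (hM : 0 ≤ M) (h : ∀ j < p, ‖w j‖ ≤ M) :
    ‖mahlerCoeff q k l T w p‖ ≤ ‖T‖ * M := by
  rw [mahlerCoeff]
  split_ifs with hp
  · rw [norm_smul, Complex.norm_real, Real.norm_of_nonneg (mahlerWeight_nonneg hq k l _)]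
    have h1 : ‖T (w (p / l.2.2 - l.1))‖ ≤ ‖T‖ * M := by
      refine (T.le_opNorm _).trans (mul_le_mul_of_nonneg_left (h _ ?_) (norm_nonneg _))
      have := Nat.div_le_self p l.2.2
      omega
    calc _ ≤ 1 * (‖T‖ * M) :=
          mul_le_mul (mahlerWeight_le_one hq hk hl₂ hl _) h1 (norm_nonneg _) zero_le_one
      _ = _ := one_mul _
  · rw [norm_zero]; positivity

/-- The left side telescopes to `B (R^p - B^p)`. Keeping the factor `R - B` on the left avoids a
division. -/
theorem sum_geom_convolution_le {B R : ℝ} (hB : 0 ≤ B) (p : ℕ) :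
    (∑ j ∈ Finset.range p, B ^ (p - j) * R ^ j) * (R - B) ≤ B * R ^ p := by
  induction p with
  | zero => simpa using hB
  | succ p ih =>
    have : ∑ j ∈ Finset.range (p + 1), B ^ (p + 1 - j) * R ^ j =
        B * (∑ j ∈ Finset.range p, B ^ (p - j) * R ^ j + R ^ p) := by
      rw [Finset.sum_range_succ, mul_add, Finset.mul_sum]
      congr 1
      · refine Finset.sum_congr rfl fun j hj => ?_
        rw [Nat.sub_add_comm (Finset.mem_range.1 hj).le, pow_succ]
        ring
      · simp
    rw [this, pow_succ]
    nlinarith [mul_le_mul_of_nonneg_left ih hB]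

/-- The convolution equation has a solution, whose coefficients grow at most geometrically. -/
theorem exists_solution_geometric {q k : ℝ} (hq : 1 < q) (hk : 0 < k)
    (𝒜 : Finset (ℕ × ℕ × ℕ))
    (h𝒜 : ∀ l ∈ 𝒜, 1 ≤ l.1 ∧ 1 ≤ l.2.2 ∧ (l.2.1 : ℝ) ≤ (l.1 : ℝ) / k - 1)
    (Φ : E →L[ℂ] E) (hΦ : IsUnit (Φ - 1)) (T : ℕ × ℕ × ℕ → E →L[ℂ] E)
    (ec : ℕ → ℂ) (hec0 : ec 0 = 1) {B : ℝ} (hB : 0 ≤ B) (hec : ∀ i, ‖ec i‖ ≤ B ^ i)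
    (f : ℕ → E) {M : ℝ} (hf : ∀ p, ‖f p‖ ≤ M) :
    ∃ w : ℕ → E, (∀ p, Φ (w p) = ∑ j ∈ Finset.range (p + 1), ec (p - j) • w j +
        ∑ l ∈ 𝒜, mahlerCoeff q k l (T l) w p + f p) ∧
      ∃ C R : ℝ, 0 < C ∧ 1 ≤ R ∧ B < R ∧ ∀ p, ‖w p‖ ≤ C * R ^ p := by
  obtain ⟨U, hU⟩ := hΦ
  let H : E →L[ℂ] E := ↑U⁻¹
  have hUH : ∀ x, Φ (H x) - H x = x := fun x => by
    have h1 : (U : E →L[ℂ] E) * ↑U⁻¹ = 1 := U.mul_inv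
    have h2 := congrArg (fun A : E →L[ℂ] E => A x) h1
    rw [hU] at h2
    simpa using h2
  -- Because `ec 0 = 1`, the summand `j = p` is `w p` itself; moved to the left it leaves `(Φ - 1)
  -- (w p)`, which `H` inverts.
  obtain ⟨w, hw⟩ := exists_causal_recursion
    (fun p (w : ℕ → E) => H (∑ j ∈ Finset.range p, ec (p - j) • w j +
      ∑ l ∈ 𝒜, mahlerCoeff q k l (T l) w p + f p)) (by
    intro N v w h
    have h1 : ∑ j ∈ Finset.range N, ec (N - j) • v j = ∑ j ∈ Finset.range N, ec (N - j) • w j :=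
      Finset.sum_congr rfl fun j hj => by rw [h j (Finset.mem_range.1 hj)]
    have h2 : ∑ l ∈ 𝒜, mahlerCoeff q k l (T l) v N = ∑ l ∈ 𝒜, mahlerCoeff q k l (T l) w N :=
      Finset.sum_congr rfl fun l hl => mahlerCoeff_congr q k (h𝒜 l hl).1 _ h
    simp only [h1, h2])
  refine ⟨w, fun p => ?_, ?_⟩
  · have h := hUH (∑ j ∈ Finset.range p, ec (p - j) • w j +
      ∑ l ∈ 𝒜, mahlerCoeff q k l (T l) w p + f p)
    rw [← hw p] at h
    rw [Finset.sum_range_succ, Nat.sub_self, hec0, one_smul, eq_add_of_sub_eq h]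
    abel
  · set h := ‖H‖
    set K := ∑ l ∈ 𝒜, ‖T l‖
    have hK : 0 ≤ K := Finset.sum_nonneg fun l _ => norm_nonneg _
    have hh : 0 ≤ h := norm_nonneg _
    have hM : 0 ≤ M := (norm_nonneg _).trans (hf 0)
    -- `R` satisfies `4hB ≤ R - B` and `4hK ≤ R`, and `C` below satisfies `hM ≤ C/2`. The
    -- convolution, the Mahler terms and `f` then contribute at most the shares `1/4`, `1/4` and
    -- `1/2` of `C R^p`.
    set R := B + 4 * h * B + 4 * h * K + 1
    have hhB : 0 ≤ h * B := mul_nonneg hh hB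
    have hhK : 0 ≤ h * K := mul_nonneg hh hK
    have hR1 : 1 ≤ R := by simp only [R]; nlinarith
    have hBR : 0 < R - B := by simp only [R]; nlinarith
    set C := 2 * h * M + 1
    have hC : 0 < C := by simp only [C]; positivity
    refine ⟨C, R, hC, hR1, by linarith, fun p => ?_⟩
    induction p using Nat.strong_induction_on with
    | _ p ih =>
      have hRp : 1 ≤ R ^ p := one_le_pow₀ hR1
      have b1 : h * ‖∑ j ∈ Finset.range p, ec (p - j) • w j‖ ≤ C * R ^ p / 4 := by
        have s1 : ‖∑ j ∈ Finset.range p, ec (p - j) • w j‖ ≤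
            C * ∑ j ∈ Finset.range p, B ^ (p - j) * R ^ j := by
          rw [Finset.mul_sum]
          refine norm_sum_le_of_le _ fun j hj => ?_
          rw [norm_smul]
          calc _ ≤ B ^ (p - j) * (C * R ^ j) :=
                mul_le_mul (hec _) (ih j (Finset.mem_range.1 hj)) (norm_nonneg _) (by positivity)
            _ = _ := by ring
        have s2 := sum_geom_convolution_le (R := R) hB p
        set S := ∑ j ∈ Finset.range p, B ^ (p - j) * R ^ j
        have s3 : h * S ≤ R ^ p / 4 := by
          rw [← mul_le_mul_iff_of_pos_right hBR]
          have : 4 * (h * B) * R ^ p ≤ (R - B) * R ^ p := by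
            refine mul_le_mul_of_nonneg_right ?_ (by linarith)
            simp only [R]; nlinarith
          nlinarith [mul_le_mul_of_nonneg_left s2 hh]
        calc _ ≤ h * (C * S) := mul_le_mul_of_nonneg_left s1 hh
          _ = C * (h * S) := by ring
          _ ≤ C * (R ^ p / 4) := mul_le_mul_of_nonneg_left s3 hC.le
          _ = _ := by ring
      have b2 : h * ‖∑ l ∈ 𝒜, mahlerCoeff q k l (T l) w p‖ ≤ C * R ^ p / 4 := by
        have s1 : ‖∑ l ∈ 𝒜, mahlerCoeff q k l (T l) w p‖ ≤ K * (C * (R ^ p / R)) := by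
          rw [Finset.sum_mul]
          refine norm_sum_le_of_le _ fun l hl => ?_
          refine norm_mahlerCoeff_le hq hk (h𝒜 l hl).1 (h𝒜 l hl).2.1 (h𝒜 l hl).2.2 _
            (by positivity) fun j hj => (ih j hj).trans ?_
          refine mul_le_mul_of_nonneg_left ?_ hC.le
          rw [le_div_iff₀ (by linarith), ← pow_succ]
          exact pow_le_pow_right₀ hR1 hj
        have s2 : 4 * (h * K) ≤ R := by simp only [R]; nlinarith
        calc _ ≤ h * (K * (C * (R ^ p / R))) := mul_le_mul_of_nonneg_left s1 hh
          _ = C * R ^ p / 4 * (4 * (h * K)) / R := by ring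
          _ ≤ _ := by
            rw [div_le_iff₀ (by linarith)]
            exact mul_le_mul_of_nonneg_left s2 (by positivity)
      have b3 : h * ‖f p‖ ≤ C * R ^ p / 2 := by
        calc h * ‖f p‖ ≤ h * M := mul_le_mul_of_nonneg_left (hf p) hh
          _ ≤ C / 2 := by simp only [C]; linarith
          _ ≤ _ := by nlinarith
      calc ‖w p‖ ≤ h * ‖∑ j ∈ Finset.range p, ec (p - j) • w j +
              ∑ l ∈ 𝒜, mahlerCoeff q k l (T l) w p + f p‖ := by
            conv_lhs => rw [hw p]
            exact H.le_opNorm _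
        _ ≤ h * (‖∑ j ∈ Finset.range p, ec (p - j) • w j‖ +
              ‖∑ l ∈ 𝒜, mahlerCoeff q k l (T l) w p‖ + ‖f p‖) :=
            mul_le_mul_of_nonneg_left (norm_add₃_le) hh
        _ ≤ C * R ^ p := by rw [mul_add, mul_add]; linarith

end Recursion

/-! ### Analytic continuation along the sector. -/

section Continuation

variable {E : Type*} [NormedAddCommGroup E] [NormedSpace ℂ E] [CompleteSpace E]

theorem isUnit_sub_smul_one {Φ : E →L[ℂ] E} {c : ℂ} (h : ‖Φ‖ < ‖c‖) : IsUnit (Φ - c • 1) := by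
  have h1 : c ∈ resolventSet ℂ Φ := by
    refine spectrum.mem_resolventSet_of_norm_lt_mul (lt_of_le_of_lt ?_ h)
    -- Only `‖1‖ ≤ 1` is available, as `E` may be trivial.
    calc ‖Φ‖ * ‖(1 : E →L[ℂ] E)‖ ≤ ‖Φ‖ * 1 :=
          mul_le_mul_of_nonneg_left ContinuousLinearMap.norm_id_le (norm_nonneg _)
      _ = ‖Φ‖ := mul_one _
  have h2 : IsUnit (algebraMap ℂ (E →L[ℂ] E) c - Φ) := h1
  rw [Algebra.algebraMap_eq_smul_one] at h2
  simpa using h2.neg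

/-- Step by step continuation along a sector of the solution of a linear functional equation that
relates the value at `τ` to the values at the points `lam i * τ`, `lam i < 1`. -/
theorem exists_continuation {ι : Type*} (s : Finset ι) (Φ : E →L[ℂ] E) {e : ℂ → ℂ}
    (he : Differentiable ℂ e) (T : ι → E →L[ℂ] E) {c : ι → ℂ → ℂ}
    (hc : ∀ i ∈ s, Differentiable ℂ (c i)) {κ : ℝ} (hκ : 1 < κ) {lam : ι → ℝ}
    (hlam : ∀ i ∈ s, 0 < lam i ∧ κ * lam i ≤ 1) {g : ℂ → E} (hg : Differentiable ℂ g)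
    {S : Set ℂ} (hS : ∀ τ ∈ S, ∀ r : ℝ, 0 < r → (r : ℂ) * τ ∈ S) {ρ : ℝ} (hρ : 0 < ρ)
    (hΩ : ∀ τ ∈ Metric.ball (0 : ℂ) ρ ∪ S, ‖Φ‖ < ‖e τ‖) {W₀ : ℂ → E}
    (hW₀ : DifferentiableOn ℂ W₀ (Metric.ball 0 ρ))
    (heq : ∀ τ ∈ Metric.ball (0 : ℂ) ρ,
      Φ (W₀ τ) = e τ • W₀ τ + ∑ i ∈ s, c i τ • T i (W₀ (lam i * τ)) + g τ) :
    ∃ W : ℂ → E, (∀ τ ∈ Metric.ball (0 : ℂ) ρ, W τ = W₀ τ) ∧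
      DifferentiableOn ℂ W (Metric.ball 0 ρ ∪ S) ∧
      ∀ τ ∈ Metric.ball (0 : ℂ) ρ ∪ S,
        Φ (W τ) = e τ • W τ + ∑ i ∈ s, c i τ • T i (W (lam i * τ)) + g τ := by
  classical
  set Ω := Metric.ball (0 : ℂ) ρ ∪ S with hΩdef
  let H : ℂ → E →L[ℂ] E := fun τ => Ring.inverse (Φ - e τ • 1)
  have hunit : ∀ τ ∈ Ω, IsUnit (Φ - e τ • 1) := fun τ hτ => isUnit_sub_smul_one (hΩ τ hτ)
  have hH1 : ∀ τ ∈ Ω, ∀ x, Φ (H τ x) = e τ • H τ x + x := fun τ hτ x => by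
    have h1 := Ring.mul_inverse_cancel _ (hunit τ hτ)
    have h2 := congrArg (fun A : E →L[ℂ] E => A x) h1
    have h3 : Φ (H τ x) - e τ • H τ x = x := by simpa using h2
    exact sub_eq_iff_eq_add'.1 h3
  have hH2 : ∀ τ ∈ Ω, ∀ x, H τ (Φ x - e τ • x) = x := fun τ hτ x => by
    have h1 := Ring.inverse_mul_cancel _ (hunit τ hτ)
    have h2 := congrArg (fun A : E →L[ℂ] E => A x) h1
    simpa using h2
  have hHd : DifferentiableOn ℂ H Ω := fun τ hτ => by
    have h1 : DifferentiableAt ℂ (Ring.inverse : (E →L[ℂ] E) → _) (Φ - e τ • 1) :=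
      differentiableAt_inverse (hunit τ hτ)
    have h2 : DifferentiableAt ℂ (fun τ => Φ - e τ • (1 : E →L[ℂ] E)) τ := by
      have := he τ
      fun_prop
    exact (h1.comp τ h2).differentiableWithinAt
  -- `N` solves the equation for the value at `τ`. Since `lam i ≤ 1/κ`, each application enlarges
  -- the disc on which the solution is known by the factor `κ`: the `n`-th iterate is correct on `D
  -- n`. No contraction is involved.
  let N : (ℂ → E) → ℂ → E := fun V τ => H τ (∑ i ∈ s, c i τ • T i (V (lam i * τ)) + g τ)
  let V : ℕ → ℂ → E := fun n => N^[n] W₀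
  have hVs : ∀ n, V (n + 1) = N (V n) := fun n => Function.iterate_succ_apply' N n W₀
  let D : ℕ → Set ℂ := fun n => Ω ∩ Metric.ball 0 (κ ^ n * ρ)
  have hD0 : D 0 = Metric.ball 0 ρ := by
    simp only [D, pow_zero, one_mul, hΩdef]
    exact Set.inter_eq_right.2 Set.subset_union_left
  have hDs : ∀ n, ∀ τ ∈ D (n + 1), ∀ i ∈ s, (lam i : ℂ) * τ ∈ D n := by
    rintro n τ ⟨h1, h2⟩ i hi
    obtain ⟨hl0, hl1⟩ := hlam i hi
    have hn : ‖(lam i : ℂ) * τ‖ = lam i * ‖τ‖ := by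
      rw [norm_mul, Complex.norm_real, Real.norm_of_nonneg hl0.le]
    rw [mem_ball_zero_iff] at h2
    have hκ0 : 0 < κ := by linarith
    constructor
    · rcases h1 with h1 | h1
      · left
        rw [mem_ball_zero_iff] at h1 ⊢
        rw [hn]
        have : lam i ≤ 1 := by nlinarith
        nlinarith [norm_nonneg τ]
      · exact Or.inr (hS τ h1 _ hl0)
    · rw [mem_ball_zero_iff, hn]
      have : lam i * ‖τ‖ < lam i * (κ ^ (n + 1) * ρ) := mul_lt_mul_of_pos_left h2 hl0
      have h3 : 0 < κ ^ n * ρ := by positivity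
      calc _ < lam i * (κ ^ (n + 1) * ρ) := this
        _ = (κ * lam i) * (κ ^ n * ρ) := by ring
        _ ≤ 1 * (κ ^ n * ρ) := mul_le_mul_of_nonneg_right hl1 h3.le
        _ = _ := one_mul _
  have hDmono : ∀ n, D n ⊆ D (n + 1) := fun n => Set.inter_subset_inter_right _
    (Metric.ball_subset_ball (mul_le_mul_of_nonneg_right
      (pow_le_pow_right₀ hκ.le n.le_succ) hρ.le))
  have hDmono' : Monotone D := monotone_nat_of_le_succ hDmono
  have hVd : ∀ n, DifferentiableOn ℂ (V n) (D n) := by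
    intro n
    induction n with
    | zero => rw [hD0]; exact hW₀
    | succ n ih =>
      rw [hVs]
      refine (hHd.mono Set.inter_subset_left).clm_apply (DifferentiableOn.add ?_ hg.differentiableOn)
      refine DifferentiableOn.fun_sum fun i hi => ?_
      refine (hc i hi).differentiableOn.smul ?_
      refine (T i).differentiable.comp_differentiableOn ?_
      exact ih.comp (by fun_prop) fun τ hτ => hDs n τ hτ i hi
  -- On the initial disc `W₀` already solves the equation, so inverting returns `W₀`; later iterates
  -- inherit the agreement through the points `lam i * τ`.
  have hVstep : ∀ n, ∀ τ ∈ D n, V (n + 1) τ = V n τ := by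
    intro n
    induction n with
    | zero =>
      intro τ hτ
      have hτ' : τ ∈ Ω := hτ.1
      rw [hD0] at hτ
      rw [hVs]
      change H τ (∑ i ∈ s, c i τ • T i (W₀ (lam i * τ)) + g τ) = W₀ τ
      have h1 : ∑ i ∈ s, c i τ • T i (W₀ (lam i * τ)) + g τ = Φ (W₀ τ) - e τ • W₀ τ := by
        rw [heq τ hτ]; abel
      rw [h1, hH2 τ hτ']
    | succ n ih =>
      intro τ hτ
      rw [hVs, hVs]
      change H τ _ = H τ _
      congr 2
      refine Finset.sum_congr rfl fun i hi => ?_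
      rw [← ih _ (hDs n τ hτ i hi), hVs]
  have hVmono : ∀ n m, n ≤ m → ∀ τ ∈ D n, V m τ = V n τ := by
    intro n m hnm τ hτ
    induction m, hnm using Nat.le_induction with
    | base => rfl
    | succ m hm ih => rw [hVstep m τ (hDmono' hm hτ), ih]
  have hex : ∀ τ : ℂ, ∃ n : ℕ, ‖τ‖ < κ ^ n * ρ := fun τ => by
    obtain ⟨n, hn⟩ := pow_unbounded_of_one_lt (‖τ‖ / ρ) hκ
    exact ⟨n, (div_lt_iff₀ hρ).1 hn⟩
  -- Any index whose disc contains `τ` gives the same value; the least one is taken.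
  let W : ℂ → E := fun τ => V (Nat.find (hex τ)) τ
  have hWV : ∀ n, ∀ τ ∈ D n, W τ = V n τ := fun n τ hτ => by
    have h1 : ‖τ‖ < κ ^ n * ρ := mem_ball_zero_iff.1 hτ.2
    exact (hVmono _ n (Nat.find_min' (hex τ) h1) τ
      ⟨hτ.1, mem_ball_zero_iff.2 (Nat.find_spec (hex τ))⟩).symm
  refine ⟨W, fun τ hτ => hWV 0 τ (hD0 ▸ hτ), fun τ hτ => ?_, fun τ hτ => ?_⟩
  · obtain ⟨n, hn⟩ := hex τ
    have hτD : τ ∈ D n := ⟨hτ, mem_ball_zero_iff.2 hn⟩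
    -- `D n` is the trace on `Ω` of an open disc, hence a neighbourhood of `τ` within `Ω`; openness
    -- of `S` is not needed.
    have h1 : DifferentiableWithinAt ℂ (V n) Ω τ :=
      (hVd n τ hτD).mono_of_mem_nhdsWithin
        (inter_mem_nhdsWithin _ (Metric.isOpen_ball.mem_nhds hτD.2))
    refine h1.congr_of_eventuallyEq ?_ (hWV n τ hτD)
    filter_upwards [inter_mem_nhdsWithin Ω (Metric.isOpen_ball.mem_nhds hτD.2)] with x hx
    exact hWV n x hx
  · obtain ⟨n, hn⟩ := hex τ
    have hτD : τ ∈ D (n + 1) := hDmono n ⟨hτ, mem_ball_zero_iff.2 hn⟩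
    have h1 : W τ = H τ (∑ i ∈ s, c i τ • T i (W (lam i * τ)) + g τ) := by
      rw [hWV _ τ hτD, hVs]
      change H τ _ = H τ _
      congr 2
      refine Finset.sum_congr rfl fun i hi => ?_
      rw [hWV n _ (hDs n τ hτD i hi)]
    have h2 := hH1 τ hτ (∑ i ∈ s, c i τ • T i (W (lam i * τ)) + g τ)
    rw [← h1] at h2
    rw [h2]; abel

end Continuation

/-! ### Power series with vector coefficients. -/

section Series

variable {E : Type*} [NormedAddCommGroup E] [NormedSpace ℂ E]

/-- Absolute convergence of both factors makes the double family summable, and it is then summed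
along antidiagonals. -/
theorem hasSum_smul_cauchy [CompleteSpace E] {a : ℕ → ℂ} {w : ℕ → E} {τ s : ℂ} {W : E}
    (ha : HasSum (fun i => a i * τ ^ i) s) (ha' : Summable fun i => ‖a i * τ ^ i‖)
    (hw : HasSum (fun j => τ ^ j • w j) W) (hw' : Summable fun j => ‖τ ^ j • w j‖) :
    HasSum (fun p => τ ^ p • ∑ j ∈ Finset.range (p + 1), a (p - j) • w j) (s • W) := by
  have hs : Summable fun x : ℕ × ℕ => (a x.2 * τ ^ x.2) • (τ ^ x.1 • w x.1) := by
    refine Summable.of_norm ?_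
    have := Summable.mul_of_nonneg hw' ha' (fun _ => norm_nonneg _) (fun _ => norm_nonneg _)
    refine this.congr fun x => ?_
    rw [norm_smul (a x.2 * τ ^ x.2), mul_comm]
  have hs' : Summable fun x : ℕ × ℕ => (a x.1 * τ ^ x.1) • (τ ^ x.2 • w x.2) :=
    ((Equiv.prodComm ℕ ℕ).summable_iff
      (f := fun x : ℕ × ℕ => (a x.1 * τ ^ x.1) • (τ ^ x.2 • w x.2))).1 hs
  have h0 := HasSum.smul ha hw hs'
  have h1 : HasSum (fun x : ℕ × ℕ => (a x.2 * τ ^ x.2) • (τ ^ x.1 • w x.1)) (s • W) :=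
    ((Equiv.prodComm ℕ ℕ).hasSum_iff
      (f := fun x : ℕ × ℕ => (a x.1 * τ ^ x.1) • (τ ^ x.2 • w x.2))).2 h0
  have h2 := ((Finset.HasAntidiagonal.sigmaAntidiagonalEquivProd (A := ℕ)).hasSum_iff
    (f := fun x : ℕ × ℕ => (a x.2 * τ ^ x.2) • (τ ^ x.1 • w x.1))).2 h1
  have h3 := h2.sigma (g := fun p => ∑ j ∈ Finset.range (p + 1),
      (a (p - j) * τ ^ (p - j)) • (τ ^ j • w j)) fun p => by
    have h4 := Finset.Nat.sum_antidiagonal_eq_sum_range_succ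
      (fun j i => (a i * τ ^ i) • (τ ^ j • w j)) p
    rw [Nat.succ_eq_add_one] at h4
    rw [← h4, ← Finset.sum_coe_sort]
    exact hasSum_fintype _
  convert h3 using 1
  funext p
  rw [Finset.smul_sum]
  refine Finset.sum_congr rfl fun j hj => ?_
  have hj' : j ≤ p := Nat.lt_succ_iff.1 (Finset.mem_range.1 hj)
  rw [smul_smul, smul_smul]
  congr 1
  conv_lhs => rw [← Nat.sub_add_cancel hj', pow_add]
  simp only [Nat.sub_add_cancel hj']
  ring

/-- The map `n ↦ (n + l₀) l₂` is injective and `mahlerCoeff` vanishes off its range, so the two sums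
differ by a reindexing. -/
theorem hasSum_mahlerCoeff (q k : ℝ) {l : ℕ × ℕ × ℕ} (hl₂ : 1 ≤ l.2.2) (T : E →L[ℂ] E)
    (w : ℕ → E) (τ : ℂ) {X : E}
    (h : HasSum (fun n => ((mahlerWeight q k l n : ℂ) * τ ^ ((n + l.1) * l.2.2)) • T (w n)) X) :
    HasSum (fun p => τ ^ p • mahlerCoeff q k l T w p) X := by
  have hinj : Function.Injective fun n : ℕ => (n + l.1) * l.2.2 := fun a b hab => by
    have := Nat.eq_of_mul_eq_mul_right hl₂ hab
    omega
  refine (hinj.hasSum_iff ?_).1 ?_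
  · intro p hp
    rw [mahlerCoeff, if_neg, smul_zero]
    rintro ⟨⟨m, rfl⟩, h2⟩
    rw [Nat.mul_div_cancel_left _ hl₂] at h2
    exact hp ⟨m - l.1, by simp [Nat.sub_add_cancel h2, mul_comm]⟩
  · convert h using 1
    funext n
    simp only [Function.comp_apply, mahlerCoeff]
    rw [if_pos ⟨Nat.dvd_mul_left _ _, by rw [Nat.mul_div_cancel _ hl₂]; omega⟩,
      Nat.mul_div_cancel _ hl₂, Nat.add_sub_cancel, smul_smul, mul_comm]

end Series

/-! ### Mahler terms as functions of `τ`: convergence and growth. -/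

section MahlerSeries

variable {E : Type*} [NormedAddCommGroup E] [NormedSpace ℂ E]

/-- The action of the Mahler term attached to `l` on the `q`-Borel transform `∑ w n τ^n`. -/
noncomputable def mahlerSeries (q k : ℝ) (l : ℕ × ℕ × ℕ) (T : E →L[ℂ] E) (w : ℕ → E) (τ : ℂ) : E :=
  ∑' n, ((mahlerWeight q k l n : ℂ) * τ ^ ((n + l.1) * l.2.2)) • T (w n)

theorem norm_mahlerSeries_term {q : ℝ} (hq : 1 < q) (k : ℝ) (l : ℕ × ℕ × ℕ) (T : E →L[ℂ] E)
    {w : ℕ → E} {C R : ℝ} (hw : ∀ n, ‖w n‖ ≤ C * R ^ n) (τ : ℂ) (n : ℕ) :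
    ‖((mahlerWeight q k l n : ℂ) * τ ^ ((n + l.1) * l.2.2)) • T (w n)‖ ≤
      mahlerWeight q k l n * ‖τ‖ ^ ((n + l.1) * l.2.2) * (‖T‖ * (C * R ^ n)) := by
  rw [norm_smul, norm_mul, Complex.norm_real, Real.norm_of_nonneg (mahlerWeight_nonneg hq k l n),
    norm_pow]
  refine mul_le_mul_of_nonneg_left ?_
    (mul_nonneg (mahlerWeight_nonneg hq k l n) (pow_nonneg (norm_nonneg _) _))
  exact (T.le_opNorm _).trans (mul_le_mul_of_nonneg_left (hw n) (norm_nonneg _))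

/-- Near `0` one has `‖τ‖ ≤ 1`, so `‖τ‖^((n+l₀)l₂) ≤ ‖τ‖^n` and the series is dominated by that of
`w`. This covers `l₂ = 1` as well. -/
theorem summable_mahlerSeries_of_norm_lt {q k : ℝ} (hq : 1 < q) (hk : 0 < k) {l : ℕ × ℕ × ℕ}
    (hl₂ : 1 ≤ l.2.2) (hl : (l.2.1 : ℝ) ≤ (l.1 : ℝ) / k - 1) (T : E →L[ℂ] E)
    [CompleteSpace E] {w : ℕ → E} {C R : ℝ} (hC : 0 ≤ C) (hR : 1 ≤ R)
    (hw : ∀ n, ‖w n‖ ≤ C * R ^ n) {τ : ℂ} (hτ : R * ‖τ‖ < 1) :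
    Summable fun n => ((mahlerWeight q k l n : ℂ) * τ ^ ((n + l.1) * l.2.2)) • T (w n) := by
  have hτ0 := norm_nonneg τ
  have hτ1 : ‖τ‖ ≤ 1 := by nlinarith
  refine Summable.of_norm_bounded (g := fun n => ‖T‖ * C * (R * ‖τ‖) ^ n)
    ((summable_geometric_of_lt_one (by positivity) hτ).mul_left _) fun n => ?_
  refine (norm_mahlerSeries_term hq k l T hw τ n).trans ?_
  have h1 : mahlerWeight q k l n * ‖τ‖ ^ ((n + l.1) * l.2.2) ≤ 1 * ‖τ‖ ^ n := by
    refine mul_le_mul (mahlerWeight_le_one hq hk hl₂ hl n) ?_ (by positivity) zero_le_one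
    refine pow_le_pow_of_le_one hτ0 hτ1 ?_
    exact (Nat.le_add_right n l.1).trans (Nat.le_mul_of_pos_right _ hl₂)
  calc _ ≤ 1 * ‖τ‖ ^ n * (‖T‖ * (C * R ^ n)) :=
        mul_le_mul_of_nonneg_right h1 (by positivity)
    _ = _ := by rw [mul_pow]; ring

/-- The Gaussian rate `A = (l₂² - 1)/(2k)` is split as `a + (A - a)`. By completing the square, `a`
absorbs the part of the exponent linear in `n` at the price `y²/(4 a log q)`, and `A - a` yields the
geometric factor. The parameter `a` stays free because its size fixes the growth rate in `r`. -/
theorem norm_mahlerSeries_term_le_geometric {q k : ℝ} (hq : 1 < q) (hk : 0 < k) {l : ℕ × ℕ × ℕ}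
    (hl₀ : 1 ≤ l.1) (hl₂ : 1 ≤ l.2.2) (T : E →L[ℂ] E) {w : ℕ → E} {C R : ℝ} (hC : 0 ≤ C)
    (hR : 0 < R) (hw : ∀ n, ‖w n‖ ≤ C * R ^ n) {a : ℝ} (ha : 0 < a)
    (ha' : a ≤ ((l.2.2 : ℝ) ^ 2 - 1) / (2 * k)) {r : ℝ} (hr : 0 < r) {τ : ℂ} (hτ : ‖τ‖ ≤ r)
    (n : ℕ) :
    ‖((mahlerWeight q k l n : ℂ) * τ ^ ((n + l.1) * l.2.2)) • T (w n)‖ ≤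
      ‖T‖ * C * Real.exp ((l.1 : ℝ) * l.2.2 * Real.log r +
        (l.2.2 * Real.log r + l.2.1 * Real.log q + Real.log R) ^ 2 / (4 * (a * Real.log q))) *
      Real.exp (-((((l.2.2 : ℝ) ^ 2 - 1) / (2 * k) - a) * Real.log q)) ^ n := by
  refine (norm_mahlerSeries_term hq k l T hw τ n).trans ?_
  have hL : 0 < Real.log q := Real.log_pos hq
  set L := Real.log q
  set x := Real.log r
  set A := ((l.2.2 : ℝ) ^ 2 - 1) / (2 * k)
  set y := l.2.2 * x + l.2.1 * L + Real.log R
  have e1 : r ^ ((n + l.1) * l.2.2) = Real.exp (((n + l.1) * l.2.2 : ℕ) * x) := by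
    rw [Real.exp_nat_mul, Real.exp_log hr]
  have e2 : R ^ n = Real.exp (n * Real.log R) := by rw [Real.exp_nat_mul, Real.exp_log hR]
  have h1 : mahlerWeight q k l n * ‖τ‖ ^ ((n + l.1) * l.2.2) ≤
      Real.exp (L * ((l.2.1 : ℝ) * n - A * (n : ℝ) ^ 2)) *
        Real.exp (((n + l.1) * l.2.2 : ℕ) * x) := by
    rw [← e1]
    exact mul_le_mul (mahlerWeight_le_exp hq hk hl₀ hl₂ n)
      (pow_le_pow_left₀ (norm_nonneg _) hτ _) (by positivity) (Real.exp_pos _).le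
  have haL : 0 < a * L := mul_pos ha hL
  have h2 : n * y ≤ a * L * (n : ℝ) ^ 2 + y ^ 2 / (4 * (a * L)) := by
    have : 0 ≤ (2 * (a * L) * n - y) ^ 2 / (4 * (a * L)) := by positivity
    have e : (2 * (a * L) * n - y) ^ 2 / (4 * (a * L)) =
        a * L * (n : ℝ) ^ 2 + y ^ 2 / (4 * (a * L)) - n * y := by
      field_simp; ring
    linarith
  have h3 : (A - a) * L * n ≤ (A - a) * L * (n : ℝ) ^ 2 := by
    refine mul_le_mul_of_nonneg_left ?_ (mul_nonneg (by linarith) hL.le)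
    exact_mod_cast Nat.le_self_pow two_ne_zero n
  calc _ ≤ Real.exp (L * ((l.2.1 : ℝ) * n - A * (n : ℝ) ^ 2)) *
        Real.exp (((n + l.1) * l.2.2 : ℕ) * x) * (‖T‖ * (C * R ^ n)) :=
        mul_le_mul_of_nonneg_right h1 (by positivity)
    _ = ‖T‖ * C * Real.exp (L * ((l.2.1 : ℝ) * n - A * (n : ℝ) ^ 2) +
          ((n + l.1) * l.2.2 : ℕ) * x + n * Real.log R) := by
        rw [e2, Real.exp_add, Real.exp_add]; ring
    _ ≤ ‖T‖ * C * Real.exp (((l.1 : ℝ) * l.2.2 * x + y ^ 2 / (4 * (a * L))) +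
          n * (-((A - a) * L))) := by
        refine mul_le_mul_of_nonneg_left (Real.exp_le_exp.2 ?_) (by positivity)
        push_cast
        have : n * y = n * (l.2.2 * x) + n * (l.2.1 * L) + n * Real.log R := by
          simp only [y]; ring
        nlinarith
    _ = _ := by rw [Real.exp_add, Real.exp_nat_mul]; ring

variable [CompleteSpace E]

/-- Gaussian decay beats the geometric growth of `w`, so the series converges locally uniformly on
the whole plane. Any `a` strictly between `0` and the full rate would do; half of it is used. -/
theorem differentiable_mahlerSeries {q k : ℝ} (hq : 1 < q) (hk : 0 < k) {l : ℕ × ℕ × ℕ}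
    (hl₀ : 1 ≤ l.1) (hl₂ : 2 ≤ l.2.2) (T : E →L[ℂ] E) {w : ℕ → E} {C R : ℝ} (hC : 0 ≤ C)
    (hR : 0 < R) (hw : ∀ n, ‖w n‖ ≤ C * R ^ n) : Differentiable ℂ (mahlerSeries q k l T w) := by
  intro z
  have hl₂' : (2 : ℝ) ≤ l.2.2 := by exact_mod_cast hl₂
  have hA : 0 < ((l.2.2 : ℝ) ^ 2 - 1) / (2 * k) := div_pos (by nlinarith) (by linarith)
  set A := ((l.2.2 : ℝ) ^ 2 - 1) / (2 * k)
  have hη : Real.exp (-((A - A / 2) * Real.log q)) < 1 := by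
    rw [Real.exp_lt_one_iff]
    have := mul_pos (half_pos hA) (Real.log_pos hq)
    nlinarith
  have : DifferentiableOn ℂ (mahlerSeries q k l T w) (Metric.ball 0 (‖z‖ + 1)) :=
    Complex.differentiableOn_tsum_of_summable_norm
      ((summable_geometric_of_lt_one (Real.exp_pos _).le hη).mul_left _)
      (fun n => by fun_prop) Metric.isOpen_ball fun n τ hτ =>
        norm_mahlerSeries_term_le_geometric hq hk hl₀ (by omega) T hC hR hw (half_pos hA)
          (by linarith) (by positivity) (mem_ball_zero_iff.1 hτ).le n
  exact this.differentiableAt (Metric.isOpen_ball.mem_nhds (by simp))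

/-- Growth of the form `exp(P log² |τ| + O(log |τ|))`. -/
def LogSqGrowth (P : ℝ) (g : ℂ → E) : Prop :=
  ∃ C b : ℝ, 0 ≤ C ∧ 0 ≤ b ∧ ∀ τ : ℂ, τ ≠ 0 →
    ‖g τ‖ ≤ C * Real.exp (P * Real.log ‖τ‖ ^ 2 + b * |Real.log ‖τ‖|)

omit [NormedSpace ℂ E] [CompleteSpace E] in
theorem LogSqGrowth.add {P : ℝ} {g h : ℂ → E} (hg : LogSqGrowth P g) (hh : LogSqGrowth P h) :
    LogSqGrowth P fun τ => g τ + h τ := by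
  obtain ⟨C, b, hC, hb, H⟩ := hg
  obtain ⟨C', b', hC', hb', H'⟩ := hh
  refine ⟨C + C', b + b', by positivity, by positivity, fun τ hτ => ?_⟩
  refine (norm_add_le _ _).trans ?_
  rw [add_mul]
  have h0 := abs_nonneg (Real.log ‖τ‖)
  refine add_le_add ((H τ hτ).trans ?_) ((H' τ hτ).trans ?_)
  · exact mul_le_mul_of_nonneg_left (Real.exp_le_exp.2 (by nlinarith)) hC
  · exact mul_le_mul_of_nonneg_left (Real.exp_le_exp.2 (by nlinarith)) hC'

omit [NormedSpace ℂ E] [CompleteSpace E] in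
theorem LogSqGrowth.sum {ι : Type*} (s : Finset ι) {P : ℝ} {g : ι → ℂ → E}
    (hg : ∀ i ∈ s, LogSqGrowth P (g i)) : LogSqGrowth P fun τ => ∑ i ∈ s, g i τ := by
  classical
  induction s using Finset.induction_on with
  | empty => exact ⟨0, 0, le_rfl, le_rfl, fun τ _ => by simp⟩
  | insert i s hi ih =>
    simp only [Finset.sum_insert hi]
    exact (hg i (Finset.mem_insert_self i s)).add
      (ih fun j hj => hg j (Finset.mem_insert_of_mem hj))

omit [CompleteSpace E] in
theorem logSqGrowth_pow_smul {P : ℝ} (hP : 0 ≤ P) (j : ℕ) (v : E) :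
    LogSqGrowth P fun τ => τ ^ j • v := by
  refine ⟨‖v‖, j, norm_nonneg _, j.cast_nonneg, fun τ hτ => ?_⟩
  rw [norm_smul, norm_pow, mul_comm]
  refine mul_le_mul_of_nonneg_left ?_ (norm_nonneg _)
  have h1 : ‖τ‖ ^ j = Real.exp (j * Real.log ‖τ‖) := by
    rw [Real.exp_nat_mul, Real.exp_log (norm_pos_iff.2 hτ)]
  rw [h1]
  refine Real.exp_le_exp.2 ?_
  have h2 : (j : ℝ) * Real.log ‖τ‖ ≤ j * |Real.log ‖τ‖| :=
    mul_le_mul_of_nonneg_left (le_abs_self _) j.cast_nonneg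
  nlinarith [sq_nonneg (Real.log ‖τ‖), mul_nonneg hP (sq_nonneg (Real.log ‖τ‖))]

omit [CompleteSpace E] in
-- The exponent is the one that becomes `k/(2 log q)` after division by the growth `D²/(2 log q)` of
-- `e`.
theorem logSqGrowth_mahlerSeries {q k : ℝ} (hq : 1 < q) (hk : 0 < k) {l : ℕ × ℕ × ℕ}
    (hl₀ : 1 ≤ l.1) (hl₂ : 2 ≤ l.2.2) (T : E →L[ℂ] E) {w : ℕ → E} {C R : ℝ} (hC : 0 ≤ C)
    (hR : 0 < R) (hw : ∀ n, ‖w n‖ ≤ C * R ^ n) {D : ℝ} (hD : k / ((l.2.2 : ℝ) ^ 2 - 1) < D ^ 2) :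
    LogSqGrowth (D ^ 2 / (2 * Real.log q) + k / (2 * Real.log q)) (mahlerSeries q k l T w) := by
  have hl₂' : (2 : ℝ) ≤ l.2.2 := by exact_mod_cast hl₂
  have hl2 : 0 < (l.2.2 : ℝ) ^ 2 - 1 := by nlinarith
  have hL : 0 < Real.log q := Real.log_pos hq
  set L := Real.log q
  set A := ((l.2.2 : ℝ) ^ 2 - 1) / (2 * k)
  set b := (l.2.2 : ℝ)
  have hDk : 0 < D ^ 2 + k := by positivity
  -- This `a` makes `b² x²/(4 a L)` equal to `(D² + k) x²/(2L)`, and `a < A` is equivalent to the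
  -- hypothesis `k/(b² - 1) < D²`.
  set a := b ^ 2 / (2 * (D ^ 2 + k))
  have ha : 0 < a := by positivity
  have haA : a < A := by
    rw [div_lt_div_iff₀ (by positivity) (by positivity)]
    rw [div_lt_iff₀ hl2] at hD
    nlinarith
  have hη : Real.exp (-((A - a) * L)) < 1 := by
    rw [Real.exp_lt_one_iff]
    have := mul_pos (sub_pos.2 haA) hL
    linarith
  set y₀ := l.2.1 * L + Real.log R
  refine ⟨‖T‖ * C * Real.exp (y₀ ^ 2 / (4 * (a * L))) * (1 - Real.exp (-((A - a) * L)))⁻¹,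
    l.1 * b + |(D ^ 2 + k) / (L * b) * y₀|,
    mul_nonneg (by positivity) (inv_nonneg.2 (by linarith)), by positivity, fun τ hτ => ?_⟩
  have h1 := tsum_of_norm_bounded
    ((hasSum_geometric_of_lt_one (Real.exp_pos _).le hη).mul_left _)
    fun n => norm_mahlerSeries_term_le_geometric hq hk hl₀ (by omega) T hC hR hw ha haA.le
      (norm_pos_iff.2 hτ) le_rfl n
  refine h1.trans ?_
  have h0 : 0 ≤ (1 - Real.exp (-((A - a) * L)))⁻¹ := inv_nonneg.2 (by linarith)
  set x := Real.log ‖τ‖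
  have h2 : (l.1 : ℝ) * b * x + (b * x + l.2.1 * L + Real.log R) ^ 2 / (4 * (a * L)) ≤
      y₀ ^ 2 / (4 * (a * L)) + ((D ^ 2 / (2 * L) + k / (2 * L)) * x ^ 2 +
        (l.1 * b + |(D ^ 2 + k) / (L * b) * y₀|) * |x|) := by
    have e : (b * x + l.2.1 * L + Real.log R) ^ 2 / (4 * (a * L)) =
        y₀ ^ 2 / (4 * (a * L)) + (D ^ 2 / (2 * L) + k / (2 * L)) * x ^ 2 +
          (D ^ 2 + k) / (L * b) * y₀ * x := by
      have : b * x + l.2.1 * L + Real.log R = b * x + y₀ := by simp only [y₀]; ring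
      rw [this]
      have hb : b ≠ 0 := by positivity
      simp only [a]
      field_simp
      ring
    rw [e]
    have i1 : (l.1 : ℝ) * b * x ≤ l.1 * b * |x| :=
      mul_le_mul_of_nonneg_left (le_abs_self _) (by positivity)
    have i2 : (D ^ 2 + k) / (L * b) * y₀ * x ≤ |(D ^ 2 + k) / (L * b) * y₀| * |x| := by
      rw [← abs_mul]; exact le_abs_self _
    linarith
  calc _ ≤ ‖T‖ * C * (Real.exp (y₀ ^ 2 / (4 * (a * L))) *
        Real.exp ((D ^ 2 / (2 * L) + k / (2 * L)) * x ^ 2 +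
          (l.1 * b + |(D ^ 2 + k) / (L * b) * y₀|) * |x|)) *
        (1 - Real.exp (-((A - a) * L)))⁻¹ := by
        rw [← Real.exp_add]
        refine mul_le_mul_of_nonneg_right ?_ h0
        exact mul_le_mul_of_nonneg_left (Real.exp_le_exp.2 h2) (by positivity)
    _ = _ := by ring

end MahlerSeries

/-! ### Growth of the continued solution. -/

section Growth

variable {E : Type*} [NormedAddCommGroup E] [NormedSpace ℂ E]

set_option maxHeartbeats 1000000 in
/-- `q`-exponential growth of a solution of the functional equation along a sector. -/
theorem growth_of_functional_equation {ι : Type*} (s : Finset ι) (Φ : E →L[ℂ] E) {e : ℂ → ℂ}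
    (T : ι → E →L[ℂ] E) {c : ι → ℂ → ℂ} {N : ι → ℕ} (hc : ∀ i ∈ s, ∀ τ, ‖c i τ‖ ≤ ‖τ‖ ^ N i)
    {κ : ℝ} (hκ : 1 < κ) {lam : ι → ℝ} (hlam : ∀ i ∈ s, 0 < lam i ∧ κ * lam i ≤ 1)
    {S : Set ℂ} (hS : ∀ τ ∈ S, ∀ r : ℝ, 0 < r → (r : ℂ) * τ ∈ S) {ρ : ℝ} (hρ : 0 < ρ)
    {P A c₀ b₁ : ℝ} (hP : 0 < P) (hA : 0 ≤ A) (hc₀ : 0 < c₀)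
    (hlow : ∀ τ ∈ S, ρ ≤ ‖τ‖ →
      c₀ * Real.exp (P * Real.log ‖τ‖ ^ 2 + b₁ * Real.log ‖τ‖) ≤ ‖e τ‖ - ‖Φ‖)
    {g : ℂ → E} (hg : LogSqGrowth (P + A) g) {W : ℂ → E} {C₁ : ℝ} (hC₁ : 0 ≤ C₁)
    (hball : ∀ τ ∈ Metric.ball (0 : ℂ) ρ, ‖W τ‖ ≤ C₁ * ‖τ‖)
    (heq : ∀ τ ∈ Metric.ball (0 : ℂ) ρ ∪ S,
      Φ (W τ) = e τ • W τ + ∑ i ∈ s, c i τ • T i (W (lam i * τ)) + g τ) :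
    ∃ K > (0 : ℝ), ∃ α > (0 : ℝ), ∀ τ ∈ S, ‖W τ‖ ≤ K * ‖τ‖ *
      Real.exp (A * Real.log (‖τ‖ + 2) ^ 2 + α * Real.log (‖τ‖ + 2)) := by
  obtain ⟨Cg, bg, hCg, hbg, hg⟩ := hg
  set b := bg + |b₁|
  have hb : 0 ≤ b := by positivity
  -- `G` bounds `g` relative to the lower bound for `e`. The terms in `log ρ` are needed because
  -- `log ‖τ‖` may be negative, so that it is compared with both `log (‖τ‖ + 2)` and `log ρ`.
  set G := Cg / c₀ * Real.exp (A * Real.log ρ ^ 2 + b * |Real.log ρ|)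
  have hG : 0 ≤ G := by positivity
  set Z := ∑ i ∈ s, ‖T i‖ * Real.exp ((N i - b₁) ^ 2 / (4 * P))
  have hZ : 0 ≤ Z := Finset.sum_nonneg fun i _ => by positivity
  -- `(r/κ + 2)/(r + 2)` decreases in `r`, so `η` is its maximum over `r ≥ ρ`. A dilation by `lam i`
  -- thus lowers `log (r + 2)` by at least `m = -log η > 0`.
  set η := (ρ / κ + 2) / (ρ + 2)
  have hη0 : 0 < η := by positivity
  have hη1 : η < 1 := by
    rw [div_lt_one (by positivity)]
    have : ρ / κ < ρ := div_lt_self hρ hκ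
    linarith
  set m := -Real.log η
  have hm : 0 < m := by simpa [m] using Real.log_neg hη0 hη1
  -- The summand `b` absorbs the linear logarithms of `g`; the last one gives `exp(-α m) Z ≤ c₀/2`
  -- through `exp x ≥ x`; the `1` ensures positivity.
  set α := b + 1 + 2 * Z / (c₀ * m)
  have hα : 0 < α := by positivity
  have hαm : Real.exp (-(α * m)) * Z ≤ c₀ / 2 := by
    rw [Real.exp_neg, inv_mul_le_iff₀ (Real.exp_pos _)]
    have h1 : 2 * Z / (c₀ * m) * m ≤ α * m :=
      mul_le_mul_of_nonneg_right (by simp only [α]; linarith) hm.le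
    have h2 : 2 * Z / (c₀ * m) * m = 2 * Z / c₀ := by field_simp
    have h3 : α * m ≤ Real.exp (α * m) := by linarith [Real.add_one_le_exp (α * m)]
    have h4 : 2 * Z / c₀ ≤ Real.exp (α * m) := by linarith
    rw [div_le_iff₀ hc₀] at h4
    linarith
  -- `C₁` handles the initial disc, and `2G/ρ` yields `G ≤ K ρ/2`, so that `g` uses only half of the
  -- majorant.
  set K := C₁ + 2 * G / ρ + 1
  have hK : 0 < K := by positivity
  have hKG : G ≤ K * ρ / 2 := by
    have : 2 * G / ρ * ρ = 2 * G := by field_simp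
    have h2 : 2 * G / ρ * ρ ≤ K * ρ :=
      mul_le_mul_of_nonneg_right (by simp only [K]; linarith) hρ.le
    linarith
  let M : ℝ → ℝ := fun r => r * Real.exp (A * Real.log (r + 2) ^ 2 + α * Real.log (r + 2))
  have hlog : ∀ r : ℝ, 0 ≤ r → 0 < Real.log (r + 2) := fun r hr => Real.log_pos (by linarith)
  have hMr : ∀ r, 0 ≤ r → r ≤ M r := fun r hr => by
    have h1 : 1 ≤ Real.exp (A * Real.log (r + 2) ^ 2 + α * Real.log (r + 2)) := by
      rw [Real.one_le_exp_iff]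
      have := hlog r hr
      positivity
    exact le_mul_of_one_le_right hr h1
  have hMlam : ∀ i ∈ s, ∀ r, ρ ≤ r → M (lam i * r) ≤ Real.exp (-(α * m)) * M r := by
    intro i hi r hr
    obtain ⟨hl0, hl1⟩ := hlam i hi
    have hr0 : 0 < r := by linarith
    have hκ0 : 0 < κ := by linarith
    have hlr : lam i * r ≤ r / κ := by
      rw [le_div_iff₀ hκ0]; nlinarith
    have hlr' : r / κ < r := div_lt_self hr0 hκ
    have hlr0 : 0 < lam i * r := by positivity
    have h1 : lam i * r + 2 ≤ (r + 2) * η := by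
      have h3 : r / κ + 2 ≤ (r + 2) * η := by
        simp only [η]
        rw [mul_div_assoc', le_div_iff₀ (by positivity)]
        have h5 : ρ / κ ≤ r / κ := div_le_div_of_nonneg_right hr hκ0.le
        have h6 : r / κ * ρ = r * (ρ / κ) := by ring
        have h7 : r / κ - ρ / κ ≤ r - ρ := by
          have : (r - ρ) / κ ≤ r - ρ := div_le_self (by linarith) hκ.le
          rwa [sub_div] at this
        nlinarith
      linarith
    have h2 : Real.log (lam i * r + 2) ≤ Real.log (r + 2) - m := by
      have := Real.log_le_log (by positivity) h1
      rw [Real.log_mul (by positivity) hη0.ne'] at this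
      simpa [m] using this
    have h3 : Real.log (lam i * r + 2) ^ 2 ≤ Real.log (r + 2) ^ 2 :=
      pow_le_pow_left₀ (hlog _ hlr0.le).le (Real.log_le_log (by positivity) (by linarith)) 2
    calc M (lam i * r) ≤ r * Real.exp (A * Real.log (r + 2) ^ 2 + α * (Real.log (r + 2) - m)) := by
          refine mul_le_mul (by linarith) (Real.exp_le_exp.2 ?_) (Real.exp_pos _).le hr0.le
          exact add_le_add (mul_le_mul_of_nonneg_left h3 hA) (mul_le_mul_of_nonneg_left h2 hα.le)
      _ = _ := by
          simp only [M]
          rw [mul_left_comm, ← Real.exp_add]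
          congr 2; ring
  -- Induction over the discs of radius `κ^n ρ`: for `‖τ‖ ≥ ρ` the points `lam i * τ` lie in the
  -- preceding disc, and `g` and the dilated terms each take half of `K M ‖τ‖`.
  have key : ∀ n : ℕ, ∀ τ ∈ Metric.ball (0 : ℂ) ρ ∪ S, ‖τ‖ < κ ^ n * ρ → ‖W τ‖ ≤ K * M ‖τ‖ := by
    intro n
    have small : ∀ τ ∈ Metric.ball (0 : ℂ) ρ, ‖W τ‖ ≤ K * M ‖τ‖ := fun τ hτ => by
      refine (hball τ hτ).trans (mul_le_mul ?_ (hMr _ (norm_nonneg _)) (norm_nonneg _) hK.le)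
      have : 0 ≤ 2 * G / ρ := by positivity
      simp only [K]; linarith
    induction n with
    | zero =>
      intro τ _ hn
      exact small τ (by simpa using hn)
    | succ n ih =>
      intro τ hτ hn
      by_cases hτρ : ‖τ‖ < ρ
      · exact small τ (by simpa using hτρ)
      · have hρτ : ρ ≤ ‖τ‖ := not_lt.1 hτρ
        have hτS : τ ∈ S := hτ.resolve_left fun h => hτρ (by simpa using h)
        have hr0 : 0 < ‖τ‖ := by linarith
        have hlowτ := hlow τ hτS hρτ
        have hgτ := hg τ (norm_pos_iff.1 hr0)
        have hMl := fun i hi => hMlam i hi ‖τ‖ hρτ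
        have hih : ∀ i ∈ s, ‖W (lam i * τ)‖ ≤ K * M (lam i * ‖τ‖) := fun i hi => by
          obtain ⟨hl0, hl1⟩ := hlam i hi
          have hnm : ‖(lam i : ℂ) * τ‖ = lam i * ‖τ‖ := by
            rw [norm_mul, Complex.norm_real, Real.norm_of_nonneg hl0.le]
          rw [← hnm]
          refine ih _ (Or.inr (hS τ hτS _ hl0)) ?_
          rw [hnm]
          have h3 : 0 < κ ^ n * ρ := by positivity
          calc _ < lam i * (κ ^ (n + 1) * ρ) := mul_lt_mul_of_pos_left hn hl0
            _ = (κ * lam i) * (κ ^ n * ρ) := by ring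
            _ ≤ 1 * (κ ^ n * ρ) := mul_le_mul_of_nonneg_right hl1 h3.le
            _ = _ := one_mul _
        have hpow : ∀ j : ℕ, ‖τ‖ ^ j = Real.exp (j * Real.log ‖τ‖) := fun j => by
          rw [Real.exp_nat_mul, Real.exp_log hr0]
        have hX := hlog ‖τ‖ hr0.le
        have hxX : Real.log ‖τ‖ ≤ Real.log (‖τ‖ + 2) := Real.log_le_log hr0 (by linarith)
        have hρx : Real.log ρ ≤ Real.log ‖τ‖ := Real.log_le_log hρ hρτ
        have hMeq : M ‖τ‖ =
          ‖τ‖ * Real.exp (A * Real.log (‖τ‖ + 2) ^ 2 + α * Real.log (‖τ‖ + 2)) := rfl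
        set X := Real.log (‖τ‖ + 2)
        set x := Real.log ‖τ‖
        set Ex := Real.exp (P * x ^ 2 + b₁ * x)
        have hEx : 0 < Ex := Real.exp_pos _
        have hM0 : 0 < M ‖τ‖ := lt_of_lt_of_le hr0 (hMr _ hr0.le)
        have hxabs : |x| ≤ X + |Real.log ρ| := by
          refine abs_le.2 ⟨?_, ?_⟩
          · linarith [neg_abs_le (Real.log ρ)]
          · linarith [abs_nonneg (Real.log ρ)]
        have hxsq : x ^ 2 ≤ X ^ 2 + Real.log ρ ^ 2 := by
          rcases le_total 0 x with h | h
          · nlinarith [sq_nonneg (Real.log ρ)]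
          · nlinarith [sq_nonneg X]
        have g1 : ‖g τ‖ ≤ c₀ * Ex * (K * M ‖τ‖) / 2 := by
          have i1 : (P + A) * x ^ 2 + bg * |x| ≤ (P * x ^ 2 + b₁ * x) +
              ((A * Real.log ρ ^ 2 + b * |Real.log ρ|) + (A * X ^ 2 + α * X)) := by
            have j1 : A * x ^ 2 ≤ A * (X ^ 2 + Real.log ρ ^ 2) := mul_le_mul_of_nonneg_left hxsq hA
            have j2 : b * |x| ≤ b * (X + |Real.log ρ|) := mul_le_mul_of_nonneg_left hxabs hb
            have j3 : -(b₁ * x) ≤ |b₁| * |x| := by rw [← abs_mul]; exact neg_le_abs _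
            have j4 : b * X ≤ α * X := by
              refine mul_le_mul_of_nonneg_right ?_ hX.le
              have : 0 ≤ 2 * Z / (c₀ * m) := by positivity
              simp only [α]; linarith
            have j5 : b * |x| = bg * |x| + |b₁| * |x| := by simp only [b]; ring
            nlinarith
          calc ‖g τ‖ ≤ Cg * Real.exp ((P + A) * x ^ 2 + bg * |x|) := hgτ
            _ ≤ Cg * (Ex * (Real.exp (A * Real.log ρ ^ 2 + b * |Real.log ρ|) *
                  Real.exp (A * X ^ 2 + α * X))) := by
                rw [← Real.exp_add, ← Real.exp_add]
                exact mul_le_mul_of_nonneg_left (Real.exp_le_exp.2 i1) hCg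
            _ = c₀ * Ex * (G * Real.exp (A * X ^ 2 + α * X)) := by
                simp only [G]; field_simp
            _ ≤ c₀ * Ex * (K * ‖τ‖ / 2 * Real.exp (A * X ^ 2 + α * X)) := by
                refine mul_le_mul_of_nonneg_left ?_ (by positivity)
                refine mul_le_mul_of_nonneg_right (hKG.trans ?_) (Real.exp_pos _).le
                have := mul_le_mul_of_nonneg_left hρτ hK.le
                linarith
            _ = _ := by rw [hMeq]; ring
        have g2 : ‖∑ i ∈ s, c i τ • T i (W (lam i * τ))‖ ≤ c₀ * Ex * (K * M ‖τ‖) / 2 := by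
          have i1 : ∀ i ∈ s, ‖c i τ • T i (W (lam i * τ))‖ ≤
              ‖T i‖ * Real.exp ((N i - b₁) ^ 2 / (4 * P)) *
                (Ex * (K * (Real.exp (-(α * m)) * M ‖τ‖))) := fun i hi => by
            rw [norm_smul]
            -- Completing the square: a power of `‖τ‖` costs only the constant `exp((N i -
            -- b₁)²/(4P))` against the log-square growth of `e`.
            have j1 : ‖c i τ‖ ≤ Real.exp ((N i - b₁) ^ 2 / (4 * P)) * Ex := by
              refine (hc i hi τ).trans ?_
              rw [hpow, ← Real.exp_add]
              refine Real.exp_le_exp.2 ?_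
              have : 0 ≤ (2 * P * x - (N i - b₁)) ^ 2 / (4 * P) := by positivity
              have e : (2 * P * x - (N i - b₁)) ^ 2 / (4 * P) =
                  (N i - b₁) ^ 2 / (4 * P) + P * x ^ 2 - (N i - b₁) * x := by
                field_simp; ring
              linarith
            have j2 : ‖T i (W (lam i * τ))‖ ≤ ‖T i‖ * (K * (Real.exp (-(α * m)) * M ‖τ‖)) :=
              ((T i).le_opNorm _).trans (mul_le_mul_of_nonneg_left
                ((hih i hi).trans (mul_le_mul_of_nonneg_left (hMl i hi) hK.le)) (norm_nonneg _))
            calc _ ≤ _ := mul_le_mul j1 j2 (norm_nonneg _) (by positivity)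
              _ = _ := by ring
          refine (norm_sum_le_of_le _ i1).trans ?_
          rw [← Finset.sum_mul]
          change Z * _ ≤ _
          have i2 : (Real.exp (-(α * m)) * Z) * (Ex * (K * M ‖τ‖)) ≤
            c₀ / 2 * (Ex * (K * M ‖τ‖)) := mul_le_mul_of_nonneg_right hαm (by positivity)
          nlinarith
        -- The term `‖Φ‖ ‖W τ‖` is moved to the left afterwards, which is why the lower bound is
        -- assumed for `‖e τ‖ - ‖Φ‖`.
        have g3 : ‖e τ‖ * ‖W τ‖ ≤ ‖Φ‖ * ‖W τ‖ + (c₀ * Ex * (K * M ‖τ‖) / 2 +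
            c₀ * Ex * (K * M ‖τ‖) / 2) := by
          have h1 : e τ • W τ = Φ (W τ) - (∑ i ∈ s, c i τ • T i (W (lam i * τ)) + g τ) := by
            rw [heq τ hτ]; abel
          calc ‖e τ‖ * ‖W τ‖ = ‖e τ • W τ‖ := (norm_smul _ _).symm
            _ ≤ ‖Φ (W τ)‖ + (‖∑ i ∈ s, c i τ • T i (W (lam i * τ))‖ + ‖g τ‖) := by
              rw [h1]
              exact (norm_sub_le _ _).trans (add_le_add_right (norm_add_le _ _) _)
            _ ≤ _ := add_le_add (Φ.le_opNorm _) (add_le_add g2 g1)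
        have g4 : c₀ * Ex * ‖W τ‖ ≤ c₀ * Ex * (K * M ‖τ‖) := by
          have := mul_le_mul_of_nonneg_right hlowτ (norm_nonneg (W τ))
          linarith
        exact le_of_mul_le_mul_left g4 (by positivity)
  refine ⟨K, hK, α, hα, fun τ hτ => ?_⟩
  obtain ⟨n, hn⟩ := pow_unbounded_of_one_lt (‖τ‖ / ρ) hκ
  have := key n τ (Or.inr hτ) ((div_lt_iff₀ hρ).1 hn)
  simpa only [M, mul_assoc] using this

end Growth

/-! ### The solution in the Borel plane. -/

section BorelSolution

variable {E : Type*} [NormedAddCommGroup E] [NormedSpace ℂ E] [CompleteSpace E]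

omit [CompleteSpace E] in
theorem mahlerSeries_of_one {q : ℝ} (hq : 1 < q) (k : ℝ) {l : ℕ × ℕ × ℕ} (hl₂ : l.2.2 = 1)
    (T : E →L[ℂ] E) {w : ℕ → E} {τ : ℂ} {V : E}
    (h : HasSum (fun n => (((q ^ ((l.2.1 : ℝ) - (l.1 : ℝ) / k) : ℝ) : ℂ) * τ) ^ n • w n) V) :
    mahlerSeries q k l T w τ = (τ ^ l.1 / (qBorelWeight q k l.1 : ℂ)) • T V := by
  refine HasSum.tsum_eq ?_
  have h1 := (h.mapL T).const_smul (τ ^ l.1 / (qBorelWeight q k l.1 : ℂ))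
  convert h1 using 1
  funext n
  rw [mahlerWeight_of_one hq k hl₂, hl₂, mul_one, map_smul, smul_smul]
  congr 1
  push_cast
  rw [mul_pow, pow_add]
  ring

/-- Existence of the Borel transform of the formal solution, and its continuation along the sector
with `q`-exponential growth. -/
theorem exists_borel_solution {q k : ℝ} (hq : 1 < q) (hk : 0 < k) (𝒜 : Finset (ℕ × ℕ × ℕ))
    (h𝒜 : ∀ l ∈ 𝒜, 1 ≤ l.1 ∧ 1 ≤ l.2.2 ∧ (l.2.1 : ℝ) ≤ (l.1 : ℝ) / k - 1) {D : ℝ} (hD : 0 < D)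
    (hD𝒜 : ∀ l ∈ 𝒜, 2 ≤ l.2.2 → k / ((l.2.2 : ℝ) ^ 2 - 1) < D ^ 2)
    (J : Finset ℕ) (hJ : ∀ j ∈ J, 1 ≤ j) (f : ℕ → E) (hf : ∀ p ∉ J, f p = 0)
    (Φ : E →L[ℂ] E) (T : ℕ × ℕ × ℕ → E →L[ℂ] E) {ec : ℕ → ℂ} {e : ℂ → ℂ}
    (hesum : ∀ τ, HasSum (fun i => ec i * τ ^ i) (e τ)) (he : Differentiable ℂ e)
    (hec0 : ec 0 = 1) {B : ℝ} (hB : 0 ≤ B) (hec : ∀ i, ‖ec i‖ ≤ B ^ i)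
    {S : Set ℂ} (hS : ∀ τ ∈ S, ∀ r : ℝ, 0 < r → (r : ℂ) * τ ∈ S) {ρ : ℝ} (hρ : 0 < ρ)
    {C₀ : ℝ} (hC₀ : ‖Φ‖ < C₀) (hlow₀ : ∀ τ, ‖τ‖ ≤ ρ → C₀ ≤ ‖e τ‖) {c b : ℝ} (hc : 0 < c)
    (hlow : ∀ τ ∈ S, ρ ≤ ‖τ‖ →
      c * Real.exp (D ^ 2 / (2 * Real.log q) * Real.log ‖τ‖ ^ 2 + b * Real.log ‖τ‖) ≤
        ‖e τ‖ - ‖Φ‖) :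
    ∃ w : ℕ → E, w 0 = 0 ∧
      (∀ p, Φ (w p) = ∑ j ∈ Finset.range (p + 1), ec (p - j) • w j +
        ∑ l ∈ 𝒜, mahlerCoeff q k l (T l) w p + f p) ∧
      ∃ ρ₀ > (0 : ℝ), ∃ W : ℂ → E,
        (∀ τ ∈ Metric.ball (0 : ℂ) ρ₀, HasSum (fun n => τ ^ n • w n) (W τ)) ∧
        DifferentiableOn ℂ W (Metric.ball 0 ρ₀ ∪ S) ∧
        ∃ K > (0 : ℝ), ∃ α > (0 : ℝ), ∀ τ ∈ S, ‖W τ‖ ≤ K * ‖τ‖ *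
          Real.exp (k / (2 * Real.log q) * Real.log (‖τ‖ + 2) ^ 2 +
            α * Real.log (‖τ‖ + 2)) := by
  have hL : 0 < Real.log q := Real.log_pos hq
  have he0 : e 0 = 1 := by
    have h1 := hesum 0
    have h2 := hasSum_single (f := fun i => ec i * (0 : ℂ) ^ i) 0 fun i hi => by simp [hi]
    rw [h1.unique h2, hec0]; simp
  -- At `τ = 0` the lower bound on the disc reads `C₀ ≤ 1`, since `e 0 = 1`.
  have hΦ1 : ‖Φ‖ < 1 := by
    have := hlow₀ 0 (by simpa using hρ.le)
    rw [he0, norm_one] at this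
    linarith
  obtain ⟨M, hM⟩ : ∃ M, ∀ p, ‖f p‖ ≤ M := by
    refine ⟨∑ j ∈ J, ‖f j‖, fun p => ?_⟩
    by_cases hp : p ∈ J
    · exact Finset.single_le_sum (f := fun j => ‖f j‖) (fun j _ => norm_nonneg _) hp
    · rw [hf p hp, norm_zero]; positivity
  have hU : IsUnit (Φ - 1) := by
    simpa using isUnit_sub_smul_one (Φ := Φ) (c := 1) (by simpa using hΦ1)
  obtain ⟨w, hrec, C, R, hC, hR1, hBR, hw⟩ :=
    exists_solution_geometric hq hk 𝒜 h𝒜 Φ hU T ec hec0 hB hec f hM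
  have hR0 : 0 < R := by linarith
  have hw0 : w 0 = 0 := by
    have h1 := hrec 0
    have h2 : ∑ l ∈ 𝒜, mahlerCoeff q k l (T l) w 0 = 0 :=
      Finset.sum_eq_zero fun l hl => by
        have := (h𝒜 l hl).1
        rw [mahlerCoeff, if_neg]
        rintro ⟨-, h⟩
        simp at h
        omega
    have h3 : f 0 = 0 := hf 0 fun h => by simpa using hJ 0 h
    rw [h2, h3] at h1
    simp only [zero_add, Finset.range_one, Finset.sum_singleton, Nat.sub_zero, hec0, one_smul,
      add_zero] at h1
    -- At order `0` the recursion reduces to `Φ (w 0) = w 0`, which `‖Φ‖ < 1` excludes unless `w 0 =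
    -- 0`.
    by_contra hne
    have h4 : ‖w 0‖ ≤ ‖Φ‖ * ‖w 0‖ := by
      conv_lhs => rw [← h1]
      exact Φ.le_opNorm _
    nlinarith [norm_pos_iff.2 hne]
  refine ⟨w, hw0, hrec, ?_⟩
  -- On this disc the series is dominated by ratio `1/2` and the lower bound `C₀` for `e` is
  -- available.
  set ρ₀ := min ρ (1 / (2 * R))
  have hρ₀ : 0 < ρ₀ := by positivity
  have hρ₀ρ : ρ₀ ≤ ρ := min_le_left _ _
  have hRτ : ∀ τ ∈ Metric.ball (0 : ℂ) ρ₀, R * ‖τ‖ < 1 / 2 := fun τ hτ => by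
    have h1 : ‖τ‖ < 1 / (2 * R) := (mem_ball_zero_iff.1 hτ).trans_le (min_le_right _ _)
    rw [lt_div_iff₀ (by positivity)] at h1
    linarith
  have hterm : ∀ τ ∈ Metric.ball (0 : ℂ) ρ₀, ∀ n, ‖τ ^ n • w n‖ ≤ C * (R * ‖τ‖) ^ n := by
    intro τ _ n
    rw [norm_smul, norm_pow, mul_pow]
    calc _ ≤ ‖τ‖ ^ n * (C * R ^ n) := mul_le_mul_of_nonneg_left (hw n) (by positivity)
      _ = _ := by ring
  have hgeo : ∀ τ ∈ Metric.ball (0 : ℂ) ρ₀, Summable fun n => C * (R * ‖τ‖) ^ n := fun τ hτ =>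
    (summable_geometric_of_lt_one (by positivity) (by linarith [hRτ τ hτ])).mul_left _
  have hsumn : ∀ τ ∈ Metric.ball (0 : ℂ) ρ₀, Summable fun n => ‖τ ^ n • w n‖ := fun τ hτ =>
    Summable.of_nonneg_of_le (fun _ => norm_nonneg _) (hterm τ hτ) (hgeo τ hτ)
  let W₀ : ℂ → E := fun τ => ∑' n, τ ^ n • w n
  have hW₀ : ∀ τ ∈ Metric.ball (0 : ℂ) ρ₀, HasSum (fun n => τ ^ n • w n) (W₀ τ) :=
    fun τ hτ => (hsumn τ hτ).of_norm.hasSum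
  have hW₀d : DifferentiableOn ℂ W₀ (Metric.ball 0 ρ₀) := by
    refine Complex.differentiableOn_tsum_of_summable_norm (u := fun n => C * (1 / 2 : ℝ) ^ n)
      ((summable_geometric_of_lt_one (by norm_num) (by norm_num)).mul_left _)
      (fun n => by fun_prop) Metric.isOpen_ball fun n τ hτ => ?_
    refine (hterm τ hτ n).trans (mul_le_mul_of_nonneg_left ?_ hC.le)
    exact pow_le_pow_left₀ (by positivity) (hRτ τ hτ).le n
  set s := 𝒜.filter fun l => l.2.2 = 1
  let cf : ℕ × ℕ × ℕ → ℂ → ℂ := fun l τ => τ ^ l.1 / (qBorelWeight q k l.1 : ℂ)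
  let lam : ℕ × ℕ × ℕ → ℝ := fun l => q ^ ((l.2.1 : ℝ) - (l.1 : ℝ) / k)
  have hs : ∀ l ∈ s, l ∈ 𝒜 ∧ l.2.2 = 1 := fun l hl => Finset.mem_filter.1 hl
  -- The condition `l₁ ≤ l₀/k - 1` is used here in full: every dilation factor is at most `1/q`, so
  -- the continuation runs with `κ = q`.
  have hlam : ∀ l ∈ s, 0 < lam l ∧ q * lam l ≤ 1 := fun l hl => by
    have hq0 : 0 < q := by linarith
    refine ⟨Real.rpow_pos_of_pos hq0 _, ?_⟩
    have h1 : q * lam l = q ^ (1 + ((l.2.1 : ℝ) - (l.1 : ℝ) / k)) := by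
      rw [Real.rpow_add hq0, Real.rpow_one]
    rw [h1]
    exact Real.rpow_le_one_of_one_le_of_nonpos hq.le
      (by linarith [(h𝒜 l (hs l hl).1).2.2])
  -- The terms with `l₂ ≥ 2` are evaluated from the coefficients `w` rather than from the continued
  -- function, and so are known on the whole plane.
  let g : ℂ → E := fun τ => ∑ l ∈ 𝒜.filter (fun l => ¬ l.2.2 = 1), mahlerSeries q k l (T l) w τ +
    ∑ j ∈ J, τ ^ j • f j
  have hns : ∀ l ∈ 𝒜.filter (fun l => ¬ l.2.2 = 1), l ∈ 𝒜 ∧ 2 ≤ l.2.2 := fun l hl => by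
    obtain ⟨h1, h2⟩ := Finset.mem_filter.1 hl
    have := (h𝒜 l h1).2.1
    exact ⟨h1, by omega⟩
  have hgd : Differentiable ℂ g := by
    refine Differentiable.add (Differentiable.fun_sum fun l hl => ?_)
      (Differentiable.fun_sum fun j _ => by fun_prop)
    exact differentiable_mahlerSeries hq hk (h𝒜 l (hns l hl).1).1 (hns l hl).2 _ hC.le hR0 hw
  have hgg : LogSqGrowth (D ^ 2 / (2 * Real.log q) + k / (2 * Real.log q)) g := by
    refine LogSqGrowth.add (LogSqGrowth.sum _ fun l hl => ?_) (LogSqGrowth.sum _ fun j _ => ?_)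
    · exact logSqGrowth_mahlerSeries hq hk (h𝒜 l (hns l hl).1).1 (hns l hl).2 _ hC.le hR0 hw
        (hD𝒜 l (hns l hl).1 (hns l hl).2)
    · exact logSqGrowth_pow_smul (by positivity) j (f j)
  have hlamball : ∀ l ∈ s, ∀ τ ∈ Metric.ball (0 : ℂ) ρ₀,
      (lam l : ℂ) * τ ∈ Metric.ball (0 : ℂ) ρ₀ := fun l hl τ hτ => by
    obtain ⟨h0, h1⟩ := hlam l hl
    rw [mem_ball_zero_iff] at hτ ⊢
    rw [norm_mul, Complex.norm_real, Real.norm_of_nonneg h0.le]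
    have : lam l ≤ 1 := by nlinarith
    nlinarith [norm_nonneg τ]
  have heq : ∀ τ ∈ Metric.ball (0 : ℂ) ρ₀,
      Φ (W₀ τ) = e τ • W₀ τ + ∑ l ∈ s, cf l τ • T l (W₀ (lam l * τ)) + g τ := by
    intro τ hτ
    have h1 : HasSum (fun p => τ ^ p • Φ (w p)) (Φ (W₀ τ)) := by
      have := (hW₀ τ hτ).mapL Φ
      simpa only [map_smul] using this
    have hecs : Summable fun i => ‖ec i * τ ^ i‖ := by
      refine Summable.of_nonneg_of_le (fun _ => norm_nonneg _)
        (g := fun i => ‖ec i * τ ^ i‖) (f := fun i => (B * ‖τ‖) ^ i) (fun i => ?_) ?_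
      · rw [norm_mul, norm_pow, mul_pow]
        exact mul_le_mul_of_nonneg_right (hec i) (by positivity)
      · refine summable_geometric_of_lt_one (by positivity) ?_
        have := mul_le_mul_of_nonneg_right hBR.le (norm_nonneg τ)
        linarith [hRτ τ hτ]
    have h2 := hasSum_smul_cauchy (hesum τ) hecs (hW₀ τ hτ) (hsumn τ hτ)
    have h3 : HasSum (fun p => ∑ l ∈ 𝒜, τ ^ p • mahlerCoeff q k l (T l) w p)
        (∑ l ∈ 𝒜, mahlerSeries q k l (T l) w τ) := by
      refine hasSum_sum fun l hl => ?_
      refine hasSum_mahlerCoeff q k (h𝒜 l hl).2.1 (T l) w τ ?_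
      exact (summable_mahlerSeries_of_norm_lt hq hk (h𝒜 l hl).2.1 (h𝒜 l hl).2.2 (T l) hC.le hR1 hw
        (by linarith [hRτ τ hτ])).hasSum
    have h4 : HasSum (fun p => τ ^ p • f p) (∑ j ∈ J, τ ^ j • f j) :=
      hasSum_sum_of_ne_finset_zero fun p hp => by rw [hf p hp, smul_zero]
    have h5 := (h2.add h3).add h4
    have h6 : (fun p => τ ^ p • Φ (w p)) = fun p =>
        τ ^ p • ∑ j ∈ Finset.range (p + 1), ec (p - j) • w j +
          ∑ l ∈ 𝒜, τ ^ p • mahlerCoeff q k l (T l) w p + τ ^ p • f p := by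
      funext p
      rw [hrec p, smul_add, smul_add, Finset.smul_sum (s := 𝒜)]
    rw [h6] at h1
    rw [h1.unique h5]
    rw [← Finset.sum_filter_add_sum_filter_not 𝒜 (fun l => l.2.2 = 1)]
    have h7 : ∑ l ∈ 𝒜.filter (fun l => l.2.2 = 1), mahlerSeries q k l (T l) w τ =
        ∑ l ∈ s, cf l τ • T l (W₀ (lam l * τ)) :=
      Finset.sum_congr rfl fun l hl =>
        mahlerSeries_of_one hq k (hs l hl).2 (T l) (hW₀ _ (hlamball l hl τ hτ))
    rw [h7]
    simp only [g]
    abel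
  have hΩ : ∀ τ ∈ Metric.ball (0 : ℂ) ρ₀ ∪ S, ‖Φ‖ < ‖e τ‖ := by
    intro τ hτ
    by_cases h : ‖τ‖ ≤ ρ
    · exact hC₀.trans_le (hlow₀ τ h)
    · rcases hτ with hτ | hτ
      · exact absurd ((mem_ball_zero_iff.1 hτ).le.trans hρ₀ρ) h
      · have h1 := hlow τ hτ (not_le.1 h).le
        have h2 : 0 < c * Real.exp (D ^ 2 / (2 * Real.log q) * Real.log ‖τ‖ ^ 2 +
          b * Real.log ‖τ‖) := by positivity
        linarith
  have hcf : ∀ l ∈ s, Differentiable ℂ (cf l) := fun l _ => by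
    simp only [cf]; fun_prop
  obtain ⟨W, hWW₀, hWd, hWeq⟩ := exists_continuation s Φ he T hcf hq hlam hgd hS hρ₀ hΩ hW₀d heq
  refine ⟨ρ₀, hρ₀, W, fun τ hτ => hWW₀ τ hτ ▸ hW₀ τ hτ, hWd, ?_⟩
  set P := D ^ 2 / (2 * Real.log q)
  have hP : 0 < P := by positivity
  set X := |Real.log ρ₀| + |Real.log ρ|
  -- The growth estimate starts at `ρ₀`, but the bound `hlow` only at `ρ`. In between `‖e τ‖ - ‖Φ‖ ≥
  -- C₀ - ‖Φ‖`, and the exponential is at most its value at `X`, which bounds `|log ‖τ‖|` there.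
  set c' := min c ((C₀ - ‖Φ‖) / Real.exp (P * X ^ 2 + |b| * X))
  have hc' : 0 < c' := lt_min hc (div_pos (by linarith) (Real.exp_pos _))
  refine growth_of_functional_equation s Φ (e := e) T (N := fun l => l.1) (c := cf) ?_ hq hlam hS
    hρ₀ (P := P) (c₀ := c') (b₁ := b) hP (by positivity) hc' ?_ hgg (C₁ := 4 * C * R)
    (by positivity) ?_ hWeq
  · intro l _ τ
    have h1 := one_le_qBorelWeight hq hk l.1
    simp only [cf]
    rw [norm_div, norm_pow, Complex.norm_real, Real.norm_of_nonneg (by linarith)]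
    exact div_le_self (by positivity) h1
  · intro τ hτ hρτ
    by_cases h : ρ ≤ ‖τ‖
    · exact (mul_le_mul_of_nonneg_right (min_le_left _ _) (Real.exp_pos _).le).trans (hlow τ hτ h)
    · have h1 := hlow₀ τ (not_le.1 h).le
      have h0 : 0 < ‖τ‖ := by linarith
      have hx : |Real.log ‖τ‖| ≤ X := by
        refine abs_le.2 ⟨?_, ?_⟩
        · have := Real.log_le_log hρ₀ hρτ
          linarith [neg_abs_le (Real.log ρ₀), abs_nonneg (Real.log ρ)]
        · have := Real.log_le_log h0 (not_le.1 h).le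
          linarith [le_abs_self (Real.log ρ), abs_nonneg (Real.log ρ₀)]
      have h2 : P * Real.log ‖τ‖ ^ 2 + b * Real.log ‖τ‖ ≤ P * X ^ 2 + |b| * X := by
        refine add_le_add (mul_le_mul_of_nonneg_left ?_ hP.le) ?_
        · rw [← sq_abs]; exact pow_le_pow_left₀ (abs_nonneg _) hx 2
        · calc _ ≤ |b * Real.log ‖τ‖| := le_abs_self _
            _ = |b| * |Real.log ‖τ‖| := abs_mul _ _
            _ ≤ _ := mul_le_mul_of_nonneg_left hx (abs_nonneg _)
      calc _ ≤ (C₀ - ‖Φ‖) / Real.exp (P * X ^ 2 + |b| * X) * Real.exp (P * X ^ 2 + |b| * X) :=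
            mul_le_mul (min_le_right _ _) (Real.exp_le_exp.2 h2) (Real.exp_pos _).le
              (div_nonneg (by linarith) (Real.exp_pos _).le)
        _ = C₀ - ‖Φ‖ := div_mul_cancel₀ _ (Real.exp_pos _).ne'
        _ ≤ _ := by linarith
  · intro τ hτ
    have hr := hRτ τ hτ
    have h1 := hW₀ τ hτ
    -- Since `w 0 = 0`, a factor `‖τ‖` can be extracted. Summing the powers of `1/2` doubles the
    -- constant, whence `C₁ = 4CR`.
    have h2 : ∀ n, ‖τ ^ n • w n‖ ≤ 2 * C * R * ‖τ‖ * (1 / 2) ^ n := by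
      intro n
      rcases n with _ | n
      · rw [hw0, smul_zero, norm_zero]; positivity
      · refine (hterm τ hτ _).trans ?_
        have : (R * ‖τ‖) ^ n ≤ (1 / 2) ^ n := pow_le_pow_left₀ (by positivity) hr.le n
        calc C * (R * ‖τ‖) ^ (n + 1) = C * R * ‖τ‖ * (R * ‖τ‖) ^ n := by ring
          _ ≤ C * R * ‖τ‖ * (1 / 2) ^ n := mul_le_mul_of_nonneg_left this (by positivity)
          _ = _ := by ring
    have h3 := tsum_of_norm_bounded (hasSum_geometric_two.mul_left (2 * C * R * ‖τ‖)) h2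
    rw [h1.tsum_eq, ← hWW₀ τ hτ] at h3
    exact h3.trans (by linarith)

end BorelSolution

open MeasureTheory

/-! ### Exponentially decaying functions and their inverse Fourier transforms -/

theorem exists_one_add_pow_le_exp (N : ℕ) {ε : ℝ} (hε : 0 < ε) :
    ∃ K > (0 : ℝ), ∀ x : ℝ, 0 ≤ x → (1 + x) ^ N ≤ K * Real.exp (ε * x) := by
  refine ⟨N.factorial / ε ^ N * Real.exp ε, by positivity, fun x hx => ?_⟩
  have h1 := Real.pow_div_factorial_le_exp (ε * (1 + x)) (by positivity) N
  rw [div_le_iff₀ (by positivity), mul_pow, mul_add, mul_one, Real.exp_add] at h1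
  have : 0 < ε ^ N := by positivity
  calc (1 + x) ^ N = ε ^ N * (1 + x) ^ N / ε ^ N := by field_simp
    _ ≤ Real.exp ε * Real.exp (ε * x) * N.factorial / ε ^ N :=
        div_le_div_of_nonneg_right h1 this.le
    _ = _ := by ring

theorem integrable_one_add_abs_pow_mul_exp (N : ℕ) {c : ℝ} (hc : 0 < c) :
    Integrable fun m : ℝ => (1 + |m|) ^ N * Real.exp (-c * |m|) := by
  obtain ⟨K, hK, h⟩ := exists_one_add_pow_le_exp (N + 2) hc
  have h1 : Integrable fun m : ℝ => K * (1 + ‖m‖) ^ (-(2 : ℝ)) :=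
    (integrable_one_add_norm (by simp)).const_mul K
  refine h1.mono' (by fun_prop) (Filter.Eventually.of_forall fun m => ?_)
  have h2 := h |m| (abs_nonneg m)
  have h0 : 0 < 1 + |m| := by positivity
  rw [Real.norm_of_nonneg (by positivity), Real.norm_eq_abs, Real.rpow_neg h0.le,
    ← div_eq_mul_inv, le_div_iff₀ (by positivity)]
  have : (1 + |m|) ^ (2 : ℝ) = (1 + |m|) ^ 2 := by exact_mod_cast Real.rpow_natCast (1 + |m|) 2
  rw [this]
  calc _ = (1 + |m|) ^ (N + 2) * Real.exp (-c * |m|) := by ring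
    _ ≤ K * Real.exp (c * |m|) * Real.exp (-c * |m|) :=
        mul_le_mul_of_nonneg_right h2 (Real.exp_pos _).le
    _ = K := by rw [mul_assoc, ← Real.exp_add]; simp

/-- Continuous functions that are `O((1+|m|)^N e^{-β|m|})` for some `N`. -/
def ExpDecay (β : ℝ) (h : ℝ → ℂ) : Prop :=
  Continuous h ∧ ∃ (C : ℝ) (N : ℕ), ∀ m, ‖h m‖ ≤ C * ((1 + |m|) ^ N * Real.exp (-β * |m|))

theorem ExpDecay.exists_bound {β : ℝ} {h : ℝ → ℂ} (hh : ExpDecay β h) :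
    ∃ (C : ℝ) (N : ℕ), 0 ≤ C ∧ ∀ m, ‖h m‖ ≤ C * ((1 + |m|) ^ N * Real.exp (-β * |m|)) := by
  obtain ⟨_, C, N, H⟩ := hh
  refine ⟨|C|, N, abs_nonneg C, fun m => (H m).trans ?_⟩
  exact mul_le_mul_of_nonneg_right (le_abs_self C) (by positivity)

theorem norm_eval_I_mul_le (P : Polynomial ℂ) :
    ∃ C > (0 : ℝ), ∀ m : ℝ, ‖P.eval (Complex.I * (m : ℂ))‖ ≤ C * (1 + |m|) ^ P.natDegree := by
  refine ⟨∑ i ∈ Finset.range (P.natDegree + 1), ‖P.coeff i‖ + 1, by positivity, fun m => ?_⟩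
  have h0 : 1 ≤ 1 + |m| := by linarith [abs_nonneg m]
  rw [Polynomial.eval_eq_sum_range, add_mul, Finset.sum_mul]
  have : 0 ≤ 1 * (1 + |m|) ^ P.natDegree := by positivity
  refine le_add_of_le_of_nonneg (norm_sum_le_of_le _ fun i hi => ?_) this
  rw [norm_mul, norm_pow, norm_mul, Complex.norm_I, one_mul, Complex.norm_real, Real.norm_eq_abs]
  refine mul_le_mul_of_nonneg_left ?_ (norm_nonneg _)
  calc |m| ^ i ≤ (1 + |m|) ^ i := pow_le_pow_left₀ (abs_nonneg m) (by linarith) i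
    _ ≤ _ := pow_le_pow_right₀ h0 (Nat.lt_succ_iff.1 (Finset.mem_range.1 hi))

/-- Roots are split off one at a time. None is purely imaginary, so `|im - r|` is bounded below by
`|Re r|` and is therefore comparable with `1 + |m|`. -/
theorem exists_le_norm_eval_I_mul (n : ℕ) : ∀ P : Polynomial ℂ, P.natDegree = n →
    (∀ m : ℝ, P.eval (Complex.I * (m : ℂ)) ≠ 0) →
    ∃ c > (0 : ℝ), ∀ m : ℝ, c * (1 + |m|) ^ n ≤ ‖P.eval (Complex.I * (m : ℂ))‖ := by
  induction n with
  | zero =>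
    intro P hP h
    rw [Polynomial.eq_C_of_natDegree_eq_zero hP] at h ⊢
    simp only [Polynomial.eval_C] at h ⊢
    exact ⟨‖P.coeff 0‖, norm_pos_iff.2 (h 0), fun m => by simp⟩
  | succ n ih =>
    intro P hP h
    obtain ⟨r, hr⟩ := Complex.exists_root (f := P)
      (Polynomial.natDegree_pos_iff_degree_pos.1 (by omega))
    obtain ⟨P', rfl⟩ := Polynomial.dvd_iff_isRoot.2 hr
    have hne : P' ≠ 0 := fun h0 => by simp [h0] at hP
    have hdeg : P'.natDegree = n := by
      rw [Polynomial.natDegree_mul (Polynomial.X_sub_C_ne_zero r) hne,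
        Polynomial.natDegree_X_sub_C] at hP
      omega
    obtain ⟨c, hc, hle⟩ := ih P' hdeg fun m h0 => h m (by simp [h0])
    have hre : r.re ≠ 0 := fun h0 => h r.im <| by
      have : Complex.I * (r.im : ℂ) = r := by
        apply Complex.ext <;> simp [h0]
      rw [this]; exact hr
    have hre' : 0 < |r.re| := abs_pos.2 hre
    -- From `1 + |m| ≤ |im - r| + (1 + |r|)`, the last summand being at most `(1 + |r|)/|Re r| · |im
    -- - r|`.
    set a := 1 + (1 + ‖r‖) / |r.re|
    have ha : 0 < a := by positivity
    refine ⟨c / a, by positivity, fun m => ?_⟩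
    have h1 : 1 + |m| ≤ a * ‖Complex.I * (m : ℂ) - r‖ := by
      have i1 : |r.re| ≤ ‖Complex.I * (m : ℂ) - r‖ := by
        have := Complex.abs_re_le_norm (Complex.I * (m : ℂ) - r)
        simpa using this
      have i2 : |m| ≤ ‖Complex.I * (m : ℂ) - r‖ + ‖r‖ := by
        have := norm_add_le (Complex.I * (m : ℂ) - r) r
        simpa using this
      have i3 : 1 + ‖r‖ ≤ (1 + ‖r‖) / |r.re| * ‖Complex.I * (m : ℂ) - r‖ := by
        rw [div_mul_eq_mul_div, le_div_iff₀ hre']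
        exact mul_le_mul_of_nonneg_left i1 (by positivity)
      simp only [a]; rw [add_mul]; linarith
    rw [Polynomial.eval_mul, norm_mul, Polynomial.eval_sub, Polynomial.eval_X, Polynomial.eval_C]
    calc c / a * (1 + |m|) ^ (n + 1) = (1 + |m|) / a * (c * (1 + |m|) ^ n) := by ring
      _ ≤ ‖Complex.I * (m : ℂ) - r‖ * ‖P'.eval (Complex.I * (m : ℂ))‖ := by
        refine mul_le_mul ?_ (hle m) (by positivity) (norm_nonneg _)
        rw [div_le_iff₀ ha]; linarith

theorem ExpDecay.eval_mul {β : ℝ} {h : ℝ → ℂ} (hh : ExpDecay β h) (P : Polynomial ℂ) :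
    ExpDecay β fun m => P.eval (Complex.I * (m : ℂ)) * h m := by
  have hcont : Continuous h := hh.1
  obtain ⟨C, N, hC, H⟩ := hh.exists_bound
  obtain ⟨C', hC', H'⟩ := norm_eval_I_mul_le P
  refine ⟨(P.continuous.comp (by fun_prop)).mul hcont, C' * C, P.natDegree + N, fun m => ?_⟩
  rw [norm_mul]
  calc _ ≤ (C' * (1 + |m|) ^ P.natDegree) * (C * ((1 + |m|) ^ N * Real.exp (-β * |m|))) :=
        mul_le_mul (H' m) (H m) (norm_nonneg _) (by positivity)
    _ = _ := by ring

theorem ExpDecay.const_mul {β : ℝ} {h : ℝ → ℂ} (hh : ExpDecay β h) (c : ℂ) :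
    ExpDecay β fun m => c * h m := by
  simpa using hh.eval_mul (Polynomial.C c)

theorem ExpDecay.add {β : ℝ} {h g : ℝ → ℂ} (hh : ExpDecay β h) (hg : ExpDecay β g) :
    ExpDecay β fun m => h m + g m := by
  obtain ⟨C, N, hC, H⟩ := hh.exists_bound
  obtain ⟨C', N', hC', H'⟩ := hg.exists_bound
  refine ⟨hh.1.add hg.1, C + C', N + N', fun m => (norm_add_le _ _).trans ?_⟩
  have h0 : 1 ≤ 1 + |m| := by linarith [abs_nonneg m]
  rw [add_mul]
  refine add_le_add ((H m).trans ?_) ((H' m).trans ?_)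
  · refine mul_le_mul_of_nonneg_left (mul_le_mul_of_nonneg_right ?_ (Real.exp_pos _).le) hC
    exact pow_le_pow_right₀ h0 (by omega)
  · refine mul_le_mul_of_nonneg_left (mul_le_mul_of_nonneg_right ?_ (Real.exp_pos _).le) hC'
    exact pow_le_pow_right₀ h0 (by omega)

theorem expDecay_zero (β : ℝ) : ExpDecay β fun _ => 0 :=
  ⟨continuous_const, 0, 0, fun m => by simp⟩

theorem ExpDecay.sum {ι : Type*} (s : Finset ι) {β : ℝ} {h : ι → ℝ → ℂ}
    (hh : ∀ i ∈ s, ExpDecay β (h i)) : ExpDecay β fun m => ∑ i ∈ s, h i m := by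
  classical
  induction s using Finset.induction_on with
  | empty => simpa using expDecay_zero β
  | insert i s hi ih =>
    simp only [Finset.sum_insert hi]
    exact (hh i (Finset.mem_insert_self i s)).add
      (ih fun j hj => hh j (Finset.mem_insert_of_mem hj))

theorem norm_exp_I_mul_le {b : ℝ} {z : ℂ} (hz : |z.im| ≤ b) (m : ℝ) :
    ‖Complex.exp (Complex.I * z * (m : ℂ))‖ ≤ Real.exp (b * |m|) := by
  rw [Complex.norm_exp]
  refine Real.exp_le_exp.2 ?_
  have : (Complex.I * z * (m : ℂ)).re = -(z.im * m) := by simp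
  rw [this]
  calc -(z.im * m) ≤ |z.im * m| := neg_le_abs _
    _ = |z.im| * |m| := abs_mul _ _
    _ ≤ _ := mul_le_mul_of_nonneg_right hz (abs_nonneg m)

theorem ExpDecay.integrable_norm_mul_exp {β b : ℝ} {h : ℝ → ℂ} (hh : ExpDecay β h) (hb : b < β) :
    Integrable fun m : ℝ => ‖h m‖ * Real.exp (b * |m|) := by
  have hcont : Continuous h := hh.1
  obtain ⟨C, N, hC, H⟩ := hh.exists_bound
  have h1 := (integrable_one_add_abs_pow_mul_exp N (c := β - b) (by linarith)).const_mul C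
  refine h1.mono' (by fun_prop) (Filter.Eventually.of_forall fun m => ?_)
  rw [Real.norm_of_nonneg (by positivity)]
  calc _ ≤ C * ((1 + |m|) ^ N * Real.exp (-β * |m|)) * Real.exp (b * |m|) :=
        mul_le_mul_of_nonneg_right (H m) (Real.exp_pos _).le
    _ = C * ((1 + |m|) ^ N * (Real.exp (-β * |m|) * Real.exp (b * |m|))) := by ring
    _ = _ := by rw [← Real.exp_add]; congr 3; ring

theorem ExpDecay.integrable_mul_exp {β : ℝ} {h : ℝ → ℂ} (hh : ExpDecay β h) {z : ℂ}
    (hz : z ∈ strip β) : Integrable fun m : ℝ => h m * Complex.exp (Complex.I * z * (m : ℂ)) := by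
  have hcont : Continuous h := hh.1
  refine (hh.integrable_norm_mul_exp hz).mono' (by fun_prop)
    (Filter.Eventually.of_forall fun m => ?_)
  rw [norm_mul]
  exact mul_le_mul_of_nonneg_left (norm_exp_I_mul_le le_rfl m) (norm_nonneg _)

theorem invFourier_const_mul (c : ℂ) (h : ℝ → ℂ) (z : ℂ) :
    invFourier (fun m => c * h m) z = c * invFourier h z := by
  simp only [invFourier, mul_assoc]
  rw [integral_const_mul, mul_left_comm]

theorem invFourier_add {β : ℝ} {h g : ℝ → ℂ} (hh : ExpDecay β h) (hg : ExpDecay β g) {z : ℂ}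
    (hz : z ∈ strip β) :
    invFourier (fun m => h m + g m) z = invFourier h z + invFourier g z := by
  simp only [invFourier, add_mul]
  rw [integral_add (hh.integrable_mul_exp hz) (hg.integrable_mul_exp hz), mul_add]

theorem invFourier_zero (z : ℂ) : invFourier (fun _ => 0) z = 0 := by simp [invFourier]

theorem invFourier_sum {ι : Type*} (s : Finset ι) {β : ℝ} {h : ι → ℝ → ℂ}
    (hh : ∀ i ∈ s, ExpDecay β (h i)) {z : ℂ} (hz : z ∈ strip β) :
    invFourier (fun m => ∑ i ∈ s, h i m) z = ∑ i ∈ s, invFourier (h i) z := by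
  classical
  induction s using Finset.induction_on with
  | empty => simpa using invFourier_zero z
  | insert i s hi ih =>
    simp only [Finset.sum_insert hi]
    have h1 : ∀ j ∈ s, ExpDecay β (h j) := fun j hj => hh j (Finset.mem_insert_of_mem hj)
    rw [invFourier_add (hh i (Finset.mem_insert_self i s)) (ExpDecay.sum s h1) hz, ih h1]

theorem hasDerivAt_invFourier {β : ℝ} {h : ℝ → ℂ} (hh : ExpDecay β h) {z : ℂ} (hz : z ∈ strip β) :
    HasDerivAt (invFourier h) (invFourier (fun m => Complex.I * (m : ℂ) * h m) z) z := by
  have hcont : Continuous h := hh.1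
  have hh' : ExpDecay β fun m => Complex.I * (m : ℂ) * h m := by
    simpa using hh.eval_mul Polynomial.X
  -- A strip strictly between `z` and the boundary supplies one dominating function for all nearby
  -- points.
  obtain ⟨b, hzb, hbβ⟩ := exists_between (show |z.im| < β from hz)
  have hnhds : strip b ∈ nhds z := (isOpen_strip b).mem_nhds hzb
  have key := hasDerivAt_integral_of_dominated_loc_of_deriv_le (μ := volume) (𝕜 := ℂ)
    (F := fun w (m : ℝ) => h m * Complex.exp (Complex.I * w * (m : ℂ)))
    (F' := fun w (m : ℝ) => Complex.I * (m : ℂ) * h m * Complex.exp (Complex.I * w * (m : ℂ)))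
    (bound := fun m : ℝ => ‖Complex.I * (m : ℂ) * h m‖ * Real.exp (b * |m|)) hnhds
    (Filter.Eventually.of_forall fun w => by
      exact Continuous.aestronglyMeasurable (by fun_prop))
    (hh.integrable_mul_exp hz)
    (Continuous.aestronglyMeasurable (by fun_prop))
    (Filter.Eventually.of_forall fun m w hw => by
      rw [norm_mul]
      exact mul_le_mul_of_nonneg_left (norm_exp_I_mul_le (le_of_lt hw) m) (norm_nonneg _))
    (hh'.integrable_norm_mul_exp hbβ)
    (Filter.Eventually.of_forall fun m w _ => by
      have h1 : HasDerivAt (fun w : ℂ => Complex.I * w * (m : ℂ)) (Complex.I * (m : ℂ)) w := by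
        simpa using ((hasDerivAt_id w).const_mul Complex.I).mul_const (m : ℂ)
      have h2 := h1.cexp.const_mul (h m)
      exact h2.congr_deriv (by ring))
  exact key.2.const_mul _

theorem differentiableOn_invFourier {β : ℝ} {h : ℝ → ℂ} (hh : ExpDecay β h) :
    DifferentiableOn ℂ (invFourier h) (strip β) := fun _ hz =>
  (hasDerivAt_invFourier hh hz).differentiableAt.differentiableWithinAt

theorem iteratedDeriv_invFourier {β : ℝ} {h : ℝ → ℂ} (hh : ExpDecay β h) (j : ℕ) :
    ∀ z ∈ strip β, iteratedDeriv j (invFourier h) z =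
      invFourier (fun m => (Complex.I * (m : ℂ)) ^ j * h m) z := by
  induction j with
  | zero => intro z _; simp
  | succ j ih =>
    intro z hz
    have hj : ExpDecay β fun m => (Complex.I * (m : ℂ)) ^ j * h m := by
      simpa using hh.eval_mul (Polynomial.X ^ j)
    have h1 : iteratedDeriv j (invFourier h) =ᶠ[nhds z]
        invFourier (fun m => (Complex.I * (m : ℂ)) ^ j * h m) := by
      filter_upwards [(isOpen_strip β).mem_nhds hz] with w hw using ih w hw
    rw [iteratedDeriv_succ, h1.deriv_eq, (hasDerivAt_invFourier hj hz).deriv]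
    congr 1
    funext m
    ring

theorem diffPoly_invFourier (P : Polynomial ℂ) {β : ℝ} {h : ℝ → ℂ} (hh : ExpDecay β h) {z : ℂ}
    (hz : z ∈ strip β) : diffPoly P (invFourier h) z =
      invFourier (fun m => P.eval (Complex.I * (m : ℂ)) * h m) z := by
  have h1 : ∀ j, ExpDecay β fun m => P.coeff j * ((Complex.I * (m : ℂ)) ^ j * h m) := fun j => by
    have := hh.eval_mul (Polynomial.X ^ j)
    simp only [Polynomial.eval_pow, Polynomial.eval_X] at this
    exact this.const_mul _
  have h2 : (fun m : ℝ => P.eval (Complex.I * (m : ℂ)) * h m) = fun m : ℝ =>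
      ∑ j ∈ Finset.range (P.natDegree + 1), P.coeff j * ((Complex.I * (m : ℂ)) ^ j * h m) := by
    funext m
    rw [Polynomial.eval_eq_sum_range, Finset.sum_mul]
    exact Finset.sum_congr rfl fun j _ => by ring
  rw [h2, invFourier_sum _ (fun j _ => h1 j) hz, diffPoly]
  refine Finset.sum_congr rfl fun j _ => ?_
  rw [iteratedDeriv_invFourier hh j z hz, invFourier_const_mul]

/-- The exponential splits as `e^(izm) = e^(izy) e^(iz(m-y))`, so this is the product formula for
the integral of a convolution, applied to the functions already multiplied by it. -/
theorem invFourier_mul_invFourier {β : ℝ} {A h : ℝ → ℂ} (hA : ExpDecay β A) (hh : ExpDecay β h)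
    {z : ℂ} (hz : z ∈ strip β) : invFourier A z * invFourier h z =
      invFourier (fun m => ((1 / Real.sqrt (2 * Real.pi) : ℝ) : ℂ) * ∫ y, A (m - y) * h y) z := by
  have h1 := integral_convolution (μ := volume) (ν := volume) (ContinuousLinearMap.mul ℂ ℂ)
    (hh.integrable_mul_exp hz) (hA.integrable_mul_exp hz)
  simp only [convolution_def, ContinuousLinearMap.mul_apply'] at h1
  rw [invFourier_const_mul]
  simp only [invFourier]
  have h2 : ∀ m : ℝ, (∫ y, A (m - y) * h y) * Complex.exp (Complex.I * z * (m : ℂ)) =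
      ∫ y : ℝ, h y * Complex.exp (Complex.I * z * (y : ℂ)) *
        (A (m - y) * Complex.exp (Complex.I * z * ((m - y : ℝ) : ℂ))) := fun m => by
    rw [← integral_mul_const]
    congr 1
    funext y
    have : Complex.exp (Complex.I * z * (m : ℂ)) = Complex.exp (Complex.I * z * (y : ℂ)) *
        Complex.exp (Complex.I * z * ((m - y : ℝ) : ℂ)) := by
      rw [← Complex.exp_add]; congr 1; push_cast; ring
    rw [this]; ring
  simp only [h2]
  rw [h1]
  ring

/-! ### The weighted space -/

/-- The weight `(1+|m|)^(-μ) e^(-β|m|)`. -/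
noncomputable def fourierWeight (β μ m : ℝ) : ℝ := 1 / (1 + |m|) ^ μ * Real.exp (-β * |m|)

theorem fourierWeight_pos (β μ m : ℝ) : 0 < fourierWeight β μ m := by
  have : 0 < 1 + |m| := by positivity
  rw [fourierWeight]; positivity

theorem continuous_fourierWeight (β μ : ℝ) : Continuous (fourierWeight β μ) := by
  have h : ∀ m : ℝ, (1 + |m|) ≠ 0 := fun m => by positivity
  have h1 : Continuous fun m : ℝ => (1 + |m|) ^ μ :=
    Continuous.rpow_const (by fun_prop) fun m => Or.inl (h m)
  have h2 : ∀ m : ℝ, (1 + |m|) ^ μ ≠ 0 := fun m =>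
    (Real.rpow_pos_of_pos (by positivity) _).ne'
  exact (continuous_const.div h1 h2).mul (by fun_prop)

theorem fourierWeight_le {β μ : ℝ} (hμ : 0 ≤ μ) (m : ℝ) :
    fourierWeight β μ m ≤ Real.exp (-β * |m|) := by
  have h1 : 1 ≤ (1 + |m|) ^ μ := Real.one_le_rpow (by linarith [abs_nonneg m]) hμ
  rw [fourierWeight]
  exact mul_le_of_le_one_left (Real.exp_pos _).le (by rw [div_le_one (by linarith)]; exact h1)

theorem expDecay_of_le_weight {β μ : ℝ} (hμ : 0 ≤ μ) {h : ℝ → ℂ} (hc : Continuous h) {C : ℝ}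
    (hC : 0 ≤ C) (H : ∀ m, ‖h m‖ ≤ C * fourierWeight β μ m) : ExpDecay β h :=
  ⟨hc, C, 0, fun m => (H m).trans (mul_le_mul_of_nonneg_left
    (by simpa using fourierWeight_le hμ m) hC)⟩

theorem norm_weight_mul_le (β μ : ℝ) (g : ℝ →ᵇ ℂ) (m : ℝ) :
    ‖(fourierWeight β μ m : ℂ) * g m‖ ≤ ‖g‖ * fourierWeight β μ m := by
  rw [norm_mul, Complex.norm_real, Real.norm_of_nonneg (fourierWeight_pos β μ m).le, mul_comm]
  exact mul_le_mul_of_nonneg_right (g.norm_coe_le_norm m) (fourierWeight_pos β μ m).le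

theorem expDecay_weight_mul {β μ : ℝ} (hμ : 0 ≤ μ) (g : ℝ →ᵇ ℂ) :
    ExpDecay β fun m => (fourierWeight β μ m : ℂ) * g m := by
  have := continuous_fourierWeight β μ
  exact expDecay_of_le_weight hμ (by fun_prop) (norm_nonneg g) (norm_weight_mul_le β μ g)

/-- The inverse Fourier transform as a bounded operator into `O_b` of a smaller strip. -/
theorem exists_invFourier_operator {β β' μ : ℝ} (hβ : β' < β) (hμ : 0 ≤ μ) :
    ∃ Λ : (ℝ →ᵇ ℂ) →L[ℂ] Ob β', ∀ (g : ℝ →ᵇ ℂ) (z : strip β'),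
      (Λ g : strip β' →ᵇ ℂ) z = invFourier (fun m => (fourierWeight β μ m : ℂ) * g m) z := by
  have hsub : ∀ z : strip β', (z : ℂ) ∈ strip β := fun z => lt_trans z.2 hβ
  set c := (1 / Real.sqrt (2 * Real.pi) : ℝ)
  have hc : 0 ≤ c := by positivity
  have hint : Integrable fun m : ℝ => Real.exp (-(β - β') * |m|) := by
    simpa using integrable_one_add_abs_pow_mul_exp 0 (c := β - β') (by linarith)
  set I := ∫ m : ℝ, Real.exp (-(β - β') * |m|)
  have hbound : ∀ (g : ℝ →ᵇ ℂ) (z : strip β'),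
      ‖invFourier (fun m => (fourierWeight β μ m : ℂ) * g m) z‖ ≤ c * I * ‖g‖ := by
    intro g z
    rw [invFourier, norm_mul, Complex.norm_real, Real.norm_of_nonneg hc, mul_assoc]
    refine mul_le_mul_of_nonneg_left ?_ hc
    rw [mul_comm I, ← integral_const_mul]
    refine norm_integral_le_of_norm_le (hint.const_mul _) (Filter.Eventually.of_forall fun m => ?_)
    rw [norm_mul]
    calc _ ≤ (‖g‖ * Real.exp (-β * |m|)) * Real.exp (β' * |m|) := by
          refine mul_le_mul ?_ (norm_exp_I_mul_le (le_of_lt z.2) m) (norm_nonneg _) (by positivity)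
          exact (norm_weight_mul_le β μ g m).trans
            (mul_le_mul_of_nonneg_left (fourierWeight_le hμ m) (norm_nonneg _))
      _ = _ := by rw [mul_assoc, ← Real.exp_add]; congr 2; ring
  have hd : ∀ g : ℝ →ᵇ ℂ, DifferentiableOn ℂ
      (invFourier fun m => (fourierWeight β μ m : ℂ) * g m) (strip β') := fun g =>
    (differentiableOn_invFourier (expDecay_weight_mul hμ g)).mono fun z hz => lt_trans hz hβ
  let Λ₀ : (ℝ →ᵇ ℂ) →ₗ[ℂ] Ob β' :=
    { toFun := fun g => ⟨BoundedContinuousFunction.ofNormedAddCommGroup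
          (fun z : strip β' => invFourier (fun m => (fourierWeight β μ m : ℂ) * g m) z)
          (continuousOn_iff_continuous_domRestrict.1 (hd g).continuousOn) (c * I * ‖g‖) (hbound g),
        ⟨_, hd g, fun z => rfl⟩⟩
      map_add' := fun g h => by
        refine Subtype.ext (BoundedContinuousFunction.ext fun z => ?_)
        change invFourier _ _ = invFourier _ _ + invFourier _ _
        rw [← invFourier_add (expDecay_weight_mul hμ g) (expDecay_weight_mul hμ h) (hsub z)]
        simp only [BoundedContinuousFunction.coe_add, Pi.add_apply, mul_add]
      map_smul' := fun a g => by
        refine Subtype.ext (BoundedContinuousFunction.ext fun z => ?_)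
        change invFourier _ _ = a * invFourier _ _
        rw [← invFourier_const_mul]
        congr 1
        funext m
        simp only [BoundedContinuousFunction.coe_smul, smul_eq_mul]
        ring }
  have hI : 0 ≤ I := integral_nonneg fun m => (Real.exp_pos _).le
  refine ⟨Λ₀.mkContinuous (c * I) fun g => ?_, fun g z => rfl⟩
  exact (BoundedContinuousFunction.norm_le (by positivity)).2 (hbound g)

/-! ### Convolution operators -/

/-- The defect `e = |y| + |m-y| - |m|` in the triangle inequality gives a factor `exp(-βe)`. As `1 +
|y| ≤ (1+|m|)(1+e)`, this absorbs the polynomial in `y` and leaves `(1+|m|)^N`. Moreover one of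
`1+|m-y|`, `1+|y|` is at least `(1+|m|)/2`, so one power weight passes to `m`. The other is
integrable in `y` for `μ > 1`, whatever `N` is. -/
theorem fourierWeight_conv_le {β μ : ℝ} (hβ : 0 < β) (hμ : 0 ≤ μ) (N : ℕ) :
    ∃ K > (0 : ℝ), ∀ m y : ℝ, fourierWeight β μ (m - y) * ((1 + |y|) ^ N * fourierWeight β μ y) ≤
      K * ((1 + |m|) ^ N * fourierWeight β μ m) *
        ((1 + |m - y|) ^ (-μ) + (1 + |y|) ^ (-μ)) := by
  obtain ⟨K, hK, H⟩ := exists_one_add_pow_le_exp N hβ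
  refine ⟨K * 2 ^ μ, by positivity, fun m y => ?_⟩
  set e := |y| + |m - y| - |m|
  have he : 0 ≤ e := by
    have := abs_add_le y (m - y)
    rw [add_sub_cancel] at this
    simp only [e]; linarith
  have hy : 1 + |y| ≤ (1 + |m|) * (1 + e) := by
    have h1 : |y| ≤ e + |m| := by
      simp only [e]
      linarith [abs_nonneg (m - y)]
    nlinarith [abs_nonneg m]
  have hm0 : 0 < 1 + |m| := by positivity
  have hy0 : 0 < 1 + |y| := by positivity
  have hd0 : 0 < 1 + |m - y| := by positivity
  have h1 : (1 + |y|) ^ N * Real.exp (-β * e) ≤ K * (1 + |m|) ^ N := by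
    calc _ ≤ ((1 + |m|) * (1 + e)) ^ N * Real.exp (-β * e) :=
          mul_le_mul_of_nonneg_right (pow_le_pow_left₀ hy0.le hy N) (Real.exp_pos _).le
      _ = (1 + |m|) ^ N * ((1 + e) ^ N * Real.exp (-β * e)) := by rw [mul_pow]; ring
      _ ≤ (1 + |m|) ^ N * (K * Real.exp (β * e) * Real.exp (-β * e)) :=
          mul_le_mul_of_nonneg_left
            (mul_le_mul_of_nonneg_right (H e he) (Real.exp_pos _).le) (by positivity)
      _ = _ := by rw [mul_assoc K, ← Real.exp_add]; simp [mul_comm]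
  have h2 : (1 + |m - y|) ^ (-μ) * (1 + |y|) ^ (-μ) ≤
      2 ^ μ * (1 + |m|) ^ (-μ) * ((1 + |m - y|) ^ (-μ) + (1 + |y|) ^ (-μ)) := by
    have aux : ∀ a : ℝ, 0 < a → 1 + |m| ≤ 2 * a → a ^ (-μ) ≤ 2 ^ μ * (1 + |m|) ^ (-μ) := by
      intro a ha hle
      have h3 : (2 * a) ^ (-μ) ≤ (1 + |m|) ^ (-μ) :=
        Real.rpow_le_rpow_of_nonpos hm0 hle (by linarith)
      rw [Real.mul_rpow (by norm_num) ha.le, Real.rpow_neg (by norm_num : (0 : ℝ) ≤ 2),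
        inv_mul_le_iff₀ (by positivity)] at h3
      exact h3
    have hp1 : 0 < (1 + |m - y|) ^ (-μ) := Real.rpow_pos_of_pos hd0 _
    have hp2 : 0 < (1 + |y|) ^ (-μ) := Real.rpow_pos_of_pos hy0 _
    have hp3 : 0 < 2 ^ μ * (1 + |m|) ^ (-μ) := by positivity
    have htri : 1 + |m| ≤ (1 + |m - y|) + (1 + |y|) := by simp only [e] at he; linarith
    rcases le_total (1 + |y|) (1 + |m - y|) with h | h
    · nlinarith [mul_le_mul_of_nonneg_right (aux _ hd0 (by linarith)) hp2.le, mul_pos hp3 hp1]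
    · nlinarith [mul_le_mul_of_nonneg_left (aux _ hy0 (by linarith)) hp1.le, mul_pos hp3 hp2]
  have hexp : Real.exp (-β * |m - y|) * Real.exp (-β * |y|) =
      Real.exp (-β * |m|) * Real.exp (-β * e) := by
    rw [← Real.exp_add, ← Real.exp_add]; congr 1; simp only [e]; ring
  have hw : ∀ x, fourierWeight β μ x = (1 + |x|) ^ (-μ) * Real.exp (-β * |x|) := fun x => by
    rw [fourierWeight, Real.rpow_neg (by positivity), one_div]
  rw [hw, hw, hw]
  calc _ = ((1 + |m - y|) ^ (-μ) * (1 + |y|) ^ (-μ)) *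
        ((1 + |y|) ^ N * (Real.exp (-β * |m - y|) * Real.exp (-β * |y|))) := by ring
    _ = ((1 + |m - y|) ^ (-μ) * (1 + |y|) ^ (-μ)) *
        ((1 + |y|) ^ N * Real.exp (-β * e) * Real.exp (-β * |m|)) := by rw [hexp]; ring
    _ ≤ (2 ^ μ * (1 + |m|) ^ (-μ) * ((1 + |m - y|) ^ (-μ) + (1 + |y|) ^ (-μ))) *
        (K * (1 + |m|) ^ N * Real.exp (-β * |m|)) := by
        refine mul_le_mul h2 (mul_le_mul_of_nonneg_right h1 (Real.exp_pos _).le)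
          (by positivity) (by positivity)
    _ = _ := by ring

/-- The convolution with `A`, composed with `R(∂)` and with the inverse of `RD(∂)`, is bounded on
the weighted space. -/
theorem exists_convolution_operator {β μ : ℝ} (hβ : 0 < β) (hμ : 1 < μ) {A : ℝ → ℂ}
    (hAc : Continuous A) {C : ℝ} (hC : 0 ≤ C) (hA : ∀ m, ‖A m‖ ≤ C * fourierWeight β μ m)
    (R RD : Polynomial ℂ) (hdeg : R.natDegree ≤ RD.natDegree)
    (hRD : ∀ m : ℝ, RD.eval (Complex.I * (m : ℂ)) ≠ 0) :
    ∃ T : (ℝ →ᵇ ℂ) →L[ℂ] (ℝ →ᵇ ℂ), ∀ (g : ℝ →ᵇ ℂ) (m : ℝ),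
      RD.eval (Complex.I * (m : ℂ)) * ((fourierWeight β μ m : ℂ) * T g m) =
        ((1 / Real.sqrt (2 * Real.pi) : ℝ) : ℂ) *
          ∫ y : ℝ, A (m - y) * (R.eval (Complex.I * (y : ℂ)) * ((fourierWeight β μ y : ℂ) * g y)) := by
  have hμ0 : 0 ≤ μ := by linarith
  have hwc := continuous_fourierWeight β μ
  have hRc : Continuous fun y : ℝ => R.eval (Complex.I * (y : ℂ)) :=
    R.continuous.comp (by fun_prop)
  have hRDc : Continuous fun y : ℝ => RD.eval (Complex.I * (y : ℂ)) :=
    RD.continuous.comp (by fun_prop)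
  obtain ⟨K, hK, hconv⟩ := fourierWeight_conv_le hβ hμ0 R.natDegree
  obtain ⟨CR, hCR, hR⟩ := norm_eval_I_mul_le R
  obtain ⟨cD, hcD, hD⟩ := exists_le_norm_eval_I_mul RD.natDegree RD rfl hRD
  have hj : Integrable fun y : ℝ => (1 + |y|) ^ (-μ) := by
    simpa using integrable_one_add_norm (E := ℝ) (μ := volume) (r := μ) (by simpa using hμ)
  set I := ∫ y : ℝ, (1 + |y|) ^ (-μ)
  have hI : 0 ≤ I := integral_nonneg fun y => by positivity
  set c := (1 / Real.sqrt (2 * Real.pi) : ℝ)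
  have hc : 0 ≤ c := by positivity
  let F : (ℝ →ᵇ ℂ) → ℝ → ℝ → ℂ := fun g m y =>
    A (m - y) * (R.eval (Complex.I * (y : ℂ)) * ((fourierWeight β μ y : ℂ) * g y))
  have hFc : ∀ g m, Continuous (F g m) := fun g m => by
    have := g.continuous
    fun_prop
  have hbound : ∀ g m y, ‖F g m y‖ ≤ C * CR * ‖g‖ *
      (K * ((1 + |m|) ^ R.natDegree * fourierWeight β μ m)) *
        ((1 + |m - y|) ^ (-μ) + (1 + |y|) ^ (-μ)) := by
    intro g m y
    simp only [F]
    rw [norm_mul, norm_mul]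
    calc _ ≤ (C * fourierWeight β μ (m - y)) *
          ((CR * (1 + |y|) ^ R.natDegree) * (‖g‖ * fourierWeight β μ y)) := by
          refine mul_le_mul (hA _) ?_ (by positivity)
            (mul_nonneg hC (fourierWeight_pos β μ _).le)
          exact mul_le_mul (hR y) (norm_weight_mul_le β μ g y) (norm_nonneg _) (by positivity)
      _ = C * CR * ‖g‖ *
          (fourierWeight β μ (m - y) * ((1 + |y|) ^ R.natDegree * fourierWeight β μ y)) := by ring
      _ ≤ C * CR * ‖g‖ * _ := mul_le_mul_of_nonneg_left (hconv m y) (by positivity)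
      _ = _ := by ring
  have hjm : ∀ m : ℝ, Integrable fun y : ℝ => (1 + |m - y|) ^ (-μ) + (1 + |y|) ^ (-μ) :=
    fun m => (hj.comp_sub_left m).add hj
  have hFi : ∀ g m, Integrable (F g m) := fun g m =>
    ((hjm m).const_mul _).mono' (hFc g m).aestronglyMeasurable
      (Filter.Eventually.of_forall (hbound g m))
  have hIb : ∀ g m, ‖∫ y, F g m y‖ ≤ C * CR * ‖g‖ *
      (K * ((1 + |m|) ^ R.natDegree * fourierWeight β μ m)) * (2 * I) := by
    intro g m
    have h1 := norm_integral_le_of_norm_le ((hjm m).const_mul _)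
      (Filter.Eventually.of_forall (hbound g m))
    rw [integral_const_mul, integral_add (hj.comp_sub_left m) hj,
      integral_sub_left_eq_self (fun y : ℝ => (1 + |y|) ^ (-μ))] at h1
    rwa [two_mul]
  -- Domination uses `‖A‖ ≤ C`: the `m`-dependence sits only in `A (m - y)`, so one integrable
  -- majorant serves for all `m`.
  have hIc : ∀ g, Continuous fun m => ∫ y, F g m y := by
    intro g
    have hA' : ∀ m, ‖A m‖ ≤ C := fun m => (hA m).trans <| by
      have h1 : fourierWeight β μ m ≤ 1 := (fourierWeight_le hμ0 m).trans <| by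
        rw [Real.exp_le_one_iff]; nlinarith [abs_nonneg m]
      nlinarith
    have h2 : Integrable fun y : ℝ =>
        R.eval (Complex.I * (y : ℂ)) * ((fourierWeight β μ y : ℂ) * g y) := by
      simpa using ((expDecay_weight_mul hμ0 g).eval_mul R).integrable_mul_exp (β := β) (z := 0)
        (by simpa [strip] using hβ)
    refine continuous_of_dominated (fun m => (hFc g m).aestronglyMeasurable)
      (bound := fun y => C * ‖R.eval (Complex.I * (y : ℂ)) * ((fourierWeight β μ y : ℂ) * g y)‖)
      (fun m => Filter.Eventually.of_forall fun y => ?_) (h2.norm.const_mul _)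
      (Filter.Eventually.of_forall fun y => ?_)
    · simp only [F]
      rw [norm_mul]
      exact mul_le_mul_of_nonneg_right (hA' _) (norm_nonneg _)
    · simp only [F]; fun_prop
  have hw0 : ∀ m, (fourierWeight β μ m : ℂ) ≠ 0 := fun m =>
    Complex.ofReal_ne_zero.2 (fourierWeight_pos β μ m).ne'
  let G : (ℝ →ᵇ ℂ) → ℝ → ℂ := fun g m =>
    (c : ℂ) * (∫ y, F g m y) / (RD.eval (Complex.I * (m : ℂ)) * (fourierWeight β μ m : ℂ))
  have hGc : ∀ g, Continuous (G g) := fun g =>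
    (continuous_const.mul (hIc g)).div (hRDc.mul (by fun_prop)) fun m =>
      mul_ne_zero (hRD m) (hw0 m)
  -- The power `(1+|m|)^(deg R)` produced by the convolution is cancelled by the lower bound `cD
  -- (1+|m|)^(deg RD)` of the denominator.
  set B := c * (C * CR * K * (2 * I)) / cD
  have hB : 0 ≤ B := by positivity
  have hGb : ∀ g m, ‖G g m‖ ≤ B * ‖g‖ := by
    intro g m
    have hωm := fourierWeight_pos β μ m
    have hden : cD * (1 + |m|) ^ R.natDegree * fourierWeight β μ m ≤
        ‖RD.eval (Complex.I * (m : ℂ)) * (fourierWeight β μ m : ℂ)‖ := by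
      rw [norm_mul, Complex.norm_real, Real.norm_of_nonneg hωm.le]
      refine mul_le_mul_of_nonneg_right (le_trans ?_ (hD m)) hωm.le
      exact mul_le_mul_of_nonneg_left
        (pow_le_pow_right₀ (by linarith [abs_nonneg m]) hdeg) hcD.le
    simp only [G]
    rw [norm_div, norm_mul, Complex.norm_real, Real.norm_of_nonneg hc]
    have hm0 : 0 < 1 + |m| := by positivity
    calc _ ≤ c * (C * CR * ‖g‖ * (K * ((1 + |m|) ^ R.natDegree * fourierWeight β μ m)) * (2 * I)) /
          (cD * (1 + |m|) ^ R.natDegree * fourierWeight β μ m) :=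
          div_le_div₀ (by positivity) (mul_le_mul_of_nonneg_left (hIb g m) hc) (by positivity) hden
      _ = _ := by simp only [B]; field_simp
  let T₀ : (ℝ →ᵇ ℂ) →ₗ[ℂ] (ℝ →ᵇ ℂ) :=
    { toFun := fun g => BoundedContinuousFunction.ofNormedAddCommGroup (G g) (hGc g) _ (hGb g)
      map_add' := fun g h => BoundedContinuousFunction.ext fun m => by
        change G (g + h) m = G g m + G h m
        simp only [G]
        rw [← add_div, ← mul_add, ← integral_add (hFi g m) (hFi h m)]
        simp only [F, BoundedContinuousFunction.coe_add, Pi.add_apply, mul_add]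
      map_smul' := fun a g => BoundedContinuousFunction.ext fun m => by
        change G (a • g) m = a * G g m
        simp only [G]
        rw [mul_div_assoc', mul_left_comm, ← integral_const_mul a]
        congr 3
        funext y
        simp only [F, BoundedContinuousFunction.coe_smul, smul_eq_mul]
        ring }
  refine ⟨T₀.mkContinuous B fun g => ?_, fun g m => ?_⟩
  · exact (BoundedContinuousFunction.norm_le (by positivity)).2 (hGb g)
  · change _ * (_ * G g m) = _
    simp only [G]
    rw [← mul_assoc, mul_div_cancel₀ _ (mul_ne_zero (hRD m) (hw0 m))]

/-! ### The forcing term -/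

theorem integral_Ioi_comp_log_div (φ : ℝ → ℂ) :
    ∫ r in Set.Ioi (0 : ℝ), φ (Real.log r) / (r : ℂ) = ∫ x : ℝ, φ x := by
  have h := integral_image_eq_integral_abs_deriv_smul (s := Set.univ) (f := Real.exp)
    (f' := Real.exp) MeasurableSet.univ (fun x _ => (Real.hasDerivAt_exp x).hasDerivWithinAt)
    Real.exp_injective.injOn (fun r => φ (Real.log r) / (r : ℂ))
  rw [Set.image_univ, Real.range_exp] at h
  rw [h, Measure.restrict_univ]
  congr 1
  funext x
  rw [abs_of_pos (Real.exp_pos x), Real.log_exp, Complex.real_smul, mul_div_assoc',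
    mul_div_cancel_left₀]
  exact Complex.ofReal_ne_zero.2 (Real.exp_pos x).ne'

/-- The `q`-Laplace transform of a monomial. -/
theorem integral_pow_mul_thetaKernel {q k : ℝ} (hq : 1 < q) (hk : 0 < k) (d₁ : ℝ) (s : ℂ) (j : ℕ) :
    (piConst q k : ℂ) * ∫ x : ℝ, Complex.exp (j * ((x : ℂ) + Complex.I * (d₁ : ℂ))) *
      thetaKernel q k (s - (x : ℂ) - Complex.I * (d₁ : ℂ)) =
      (qBorelWeight q k j : ℂ) * Complex.exp s ^ j := by
  have hq0 : 0 < q := by linarith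
  have hL : 0 < Real.log q := Real.log_pos hq
  set L := Real.log q with hLdef'
  have hLdef : Real.log q = L := hLdef'.symm
  have hLc : (L : ℂ) ≠ 0 := Complex.ofReal_ne_zero.2 hL.ne'
  have hkc : (k : ℂ) ≠ 0 := Complex.ofReal_ne_zero.2 hk.ne'
  set σ : ℂ := s - Complex.I * (d₁ : ℂ)
  set b : ℂ := -((k : ℂ) / (2 * L))
  have hb : b = ((-(k / (2 * L)) : ℝ) : ℂ) := by simp only [b]; push_cast; ring
  have hbre : b.re < 0 := by
    rw [hb, Complex.ofReal_re]
    have : 0 < k / (2 * L) := by positivity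
    linarith
  have h1 : ∀ x : ℝ, Complex.exp (j * ((x : ℂ) + Complex.I * (d₁ : ℂ))) *
      thetaKernel q k (s - (x : ℂ) - Complex.I * (d₁ : ℂ)) =
      Complex.exp (b * (x : ℂ) ^ 2 + (k * σ / L - 1 / 2 + j) * (x : ℂ) +
        (b * σ ^ 2 + σ / 2 + j * (Complex.I * (d₁ : ℂ)))) := fun x => by
    rw [thetaKernel, ← Complex.exp_add]
    congr 1
    have : s - (x : ℂ) - Complex.I * (d₁ : ℂ) = σ - x := by simp only [σ]; ring
    rw [this, hLdef]
    simp only [b]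
    field_simp
    ring
  simp only [h1]
  rw [integral_cexp_quadratic hbre]
  have h2 : ((Real.pi : ℂ) / -b) ^ (1 / 2 : ℂ) = ((Real.sqrt (2 * Real.pi * L / k) : ℝ) : ℂ) := by
    have : (Real.pi : ℂ) / -b = ((2 * Real.pi * L / k : ℝ) : ℂ) := by
      simp only [b]; push_cast; field_simp
    rw [this, Real.sqrt_eq_rpow, Complex.ofReal_cpow (by positivity)]
    norm_num
  -- The maximum of the Gaussian exponent after completing the square. The angle `d₁` drops out, and
  -- the extra `L/(8k)` is what the normalisation `piConst` removes in `h4`.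
  have h3 : b * σ ^ 2 + σ / 2 + j * (Complex.I * (d₁ : ℂ)) -
      (k * σ / L - 1 / 2 + j) ^ 2 / (4 * b) =
      (((L * ((j : ℝ) * (j - 1) / (2 * k)) + L * (1 / (8 * k)) : ℝ)) : ℂ) + j * s := by
    have : s = σ + Complex.I * (d₁ : ℂ) := by simp only [σ]; ring
    rw [this]
    simp only [b]
    push_cast
    field_simp
    ring
  have h4 : piConst q k * Real.sqrt (2 * Real.pi * L / k) * Real.exp (L * (1 / (8 * k))) = 1 := by
    have e1 : Real.exp (L * (1 / (8 * k))) = q ^ (1 / (8 * k)) := by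
      rw [Real.rpow_def_of_pos hq0]
    have e2 : q ^ (-(1 / (8 * k))) = (q ^ (1 / (8 * k)))⁻¹ := Real.rpow_neg hq0.le _
    have e3 : q ^ (1 / (8 * k)) ≠ 0 := (Real.rpow_pos_of_pos hq0 _).ne'
    have e4 : Real.sqrt k ≠ 0 := (Real.sqrt_pos.2 hk).ne'
    have e5 : Real.sqrt (2 * Real.pi * L) ≠ 0 := (Real.sqrt_pos.2 (by positivity)).ne'
    rw [piConst, hLdef, e1, e2, Real.sqrt_div (by positivity)]
    field_simp
  rw [h2, h3, Complex.exp_add, ← Complex.ofReal_exp, Real.exp_add, Complex.exp_nat_mul]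
  have e6 : Real.exp (L * ((j : ℝ) * (j - 1) / (2 * k))) = qBorelWeight q k j := by
    rw [qBorelWeight, Real.rpow_def_of_pos hq0]
  rw [e6]
  calc _ = ((piConst q k * Real.sqrt (2 * Real.pi * L / k) * Real.exp (L * (1 / (8 * k))) : ℝ) : ℂ) *
        ((qBorelWeight q k j : ℂ) * Complex.exp s ^ j) := by push_cast; ring
    _ = _ := by rw [h4]; simp

/-- The integral of a non-integrable function is `0` by convention, whereas the value computed above
is nonzero. -/
theorem integrable_pow_mul_thetaKernel {q k : ℝ} (hq : 1 < q) (hk : 0 < k) (d₁ : ℝ) (s : ℂ)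
    (j : ℕ) : Integrable fun x : ℝ => Complex.exp (j * ((x : ℂ) + Complex.I * (d₁ : ℂ))) *
      thetaKernel q k (s - (x : ℂ) - Complex.I * (d₁ : ℂ)) := by
  have h := integral_pow_mul_thetaKernel hq hk d₁ s j
  refine not_not.1 fun hn => ?_
  rw [integral_undef hn, mul_zero] at h
  exact mul_ne_zero (Complex.ofReal_ne_zero.2 (qBorelWeight_pos hq k j).ne')
    (pow_ne_zero _ (Complex.exp_ne_zero s)) h.symm

theorem coeff_forcingSeries (q k : ℝ) (J : Finset ℕ) (F : ℕ → ℝ → ℂ) (p : ℕ) (z : ℂ) :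
    PowerSeries.coeff p (forcingSeries q k J F) z =
      if p ∈ J then invFourier (F p) z * (qBorelWeight q k p : ℂ) else 0 := by
  classical
  rw [forcingSeries, map_sum]
  simp only [PowerSeries.coeff_monomial]
  rw [Finset.sum_ite_eq]
  split_ifs <;> rfl

/-- For each `j` the integrand factors into a function of `m` and a function of `log r`, so no
interchange of integrals is needed; `r = e^x` then leads to the Gaussian integral. -/
theorem forcing_eq {q k β : ℝ} (hq : 1 < q) (hk : 0 < k) (d₁ : ℝ) (J : Finset ℕ) {F : ℕ → ℝ → ℂ}
    (hF : ∀ j ∈ J, ExpDecay β (F j)) (s : ℂ) {z : ℂ} (hz : z ∈ strip β) :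
    forcing q k d₁ J F s z =
      ∑ j ∈ J, PowerSeries.coeff j (forcingSeries q k J F) z * Complex.exp s ^ j := by
  let ψ : ℕ → ℝ → ℂ := fun j x => Complex.exp (j * ((x : ℂ) + Complex.I * (d₁ : ℂ))) *
      thetaKernel q k (s - (x : ℂ) - Complex.I * (d₁ : ℂ))
  have h1 : ∀ r ∈ Set.Ioi (0 : ℝ), (∫ m : ℝ,
      (∑ j ∈ J, F j m * ((r : ℂ) * Complex.exp (Complex.I * (d₁ : ℂ))) ^ j) *
        thetaKernel q k (s - (Real.log r : ℂ) - Complex.I * (d₁ : ℂ)) *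
        Complex.exp (Complex.I * z * (m : ℂ)) / (r : ℂ)) =
      (fun x => ∑ j ∈ J, (∫ m : ℝ, F j m * Complex.exp (Complex.I * z * (m : ℂ))) * ψ j x)
        (Real.log r) / (r : ℂ) := by
    intro r hr
    have hr0 : 0 < r := hr
    have e1 : ∀ j : ℕ, ((r : ℂ) * Complex.exp (Complex.I * (d₁ : ℂ))) ^ j =
        Complex.exp (j * ((Real.log r : ℂ) + Complex.I * (d₁ : ℂ))) := fun j => by
      rw [Complex.exp_nat_mul, Complex.exp_add, ← Complex.ofReal_exp, Real.exp_log hr0]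
    have e2 : ∀ m : ℝ, (∑ j ∈ J, F j m * ((r : ℂ) * Complex.exp (Complex.I * (d₁ : ℂ))) ^ j) *
        thetaKernel q k (s - (Real.log r : ℂ) - Complex.I * (d₁ : ℂ)) *
        Complex.exp (Complex.I * z * (m : ℂ)) / (r : ℂ) =
        ∑ j ∈ J, F j m * Complex.exp (Complex.I * z * (m : ℂ)) * (ψ j (Real.log r) / (r : ℂ)) := by
      intro m
      rw [Finset.sum_mul, Finset.sum_mul, Finset.sum_div]
      refine Finset.sum_congr rfl fun j _ => ?_
      rw [e1]
      simp only [ψ]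
      ring
    simp only [e2]
    rw [integral_finsetSum _ fun j hj => ((hF j hj).integrable_mul_exp hz).mul_const _,
      Finset.sum_div]
    refine Finset.sum_congr rfl fun j _ => ?_
    rw [integral_mul_const, ← mul_div_assoc]
  rw [forcing, setIntegral_congr_fun measurableSet_Ioi h1,
    integral_Ioi_comp_log_div fun x =>
      ∑ j ∈ J, (∫ m : ℝ, F j m * Complex.exp (Complex.I * z * (m : ℂ))) * ψ j x,
    integral_finsetSum _ fun j _ => (integrable_pow_mul_thetaKernel hq hk d₁ s j).const_mul _,
    Finset.mul_sum]
  refine Finset.sum_congr rfl fun j hj => ?_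
  rw [integral_const_mul, coeff_forcingSeries, if_pos hj, mul_assoc (invFourier _ _),
    ← integral_pow_mul_thetaKernel hq hk d₁ s j, invFourier]
  push_cast
  ring

/-! ### Coefficients of the formal operators -/

/-- Relative to the weights `qBorelWeight`, the `n`-th iterate is a shift by `nD` divided by
`qBorelWeight q k D ^ n`. This ratio turns `αD` into `alphaTilde`. -/
theorem coeff_leadOp_iterate {q : ℝ} (hq : 1 < q) (k : ℝ) (D : ℕ) (V : PowerSeries (ℂ → ℂ))
    (z : ℂ) (n : ℕ) : ∀ N, PowerSeries.coeff N ((leadOp q k D)^[n] V) z =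
      if n * D ≤ N then ((qBorelWeight q k N / (qBorelWeight q k (N - n * D) *
        qBorelWeight q k D ^ n) : ℝ) : ℂ) * PowerSeries.coeff (N - n * D) V z else 0 := by
  have hq0 : 0 < q := by linarith
  have hne : ∀ j, qBorelWeight q k j ≠ 0 := fun j => (qBorelWeight_pos hq k j).ne'
  induction n with
  | zero =>
    intro N
    simp [div_self (hne N)]
  | succ n ih =>
    intro N
    rw [Function.iterate_succ_apply', leadOp, PowerSeries.coeff_X_pow_mul', apply_ite
      (fun h : ℂ → ℂ => h z), dilation, PowerSeries.coeff_rescale, Pi.mul_apply, ih]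
    have hmul : (n + 1) * D = n * D + D := by ring
    by_cases h1 : D ≤ N
    · rw [if_pos h1]
      have hsub : N - D - n * D = N - (n + 1) * D := by omega
      by_cases h2 : n * D ≤ N - D
      · rw [if_pos h2, if_pos (by omega), hsub]
        have hN : qBorelWeight q k N = qBorelWeight q k (N - D) * qBorelWeight q k D *
            (q ^ ((D : ℝ) / k)) ^ (N - D) := by
          conv_lhs => rw [← Nat.sub_add_cancel h1]
          rw [qBorelWeight_add hq, ← Real.rpow_natCast (q ^ ((D : ℝ) / k)), ← Real.rpow_mul hq0.le]
          congr 2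
          ring
        rw [hN, Pi.pow_apply, ← mul_assoc]
        congr 1
        have h3 := hne D
        have h4 := hne (N - (n + 1) * D)
        rw [← Complex.ofReal_pow, ← Complex.ofReal_mul, Complex.ofReal_inj]
        field_simp
        ring
      · rw [if_neg h2, if_neg (by omega), mul_zero]
    · rw [if_neg h1, if_neg (by omega)]
      rfl

/-- Substitution `j = p - nD`: a convolution with the coefficients of a series in `τ^D`. -/
theorem sum_dilated_coeff {M : Type*} [AddCommGroup M] [Module ℂ M] {D : ℕ} (hD : 1 ≤ D)
    (a : ℕ → ℂ) (x : ℕ → M) (p : ℕ) :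
    ∑ j ∈ Finset.range (p + 1), (if D ∣ p - j then a ((p - j) / D) else 0) • x j =
      ∑ n ∈ Finset.range (p + 1), if n * D ≤ p then a n • x (p - n * D) else 0 := by
  simp only [ite_smul, zero_smul]
  rw [← Finset.sum_filter, ← Finset.sum_filter]
  symm
  refine Finset.sum_nbij' (fun n => p - n * D) (fun j => (p - j) / D) ?_ ?_ ?_ ?_ ?_
  · intro n hn
    obtain ⟨-, h2⟩ := Finset.mem_filter.1 hn
    refine Finset.mem_filter.2 ⟨Finset.mem_range.2 (by omega), ?_⟩
    rw [Nat.sub_sub_self h2]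
    exact Nat.dvd_mul_left D n
  · intro j hj
    obtain ⟨h1, h2⟩ := Finset.mem_filter.1 hj
    have h3 : (p - j) / D ≤ p - j := Nat.div_le_self _ _
    refine Finset.mem_filter.2 ⟨Finset.mem_range.2 (by omega), ?_⟩
    rw [Nat.div_mul_cancel h2]
    omega
  · intro n hn
    obtain ⟨-, h2⟩ := Finset.mem_filter.1 hn
    rw [Nat.sub_sub_self h2, Nat.mul_div_cancel _ hD]
  · intro j hj
    obtain ⟨h1, h2⟩ := Finset.mem_filter.1 hj
    have := Finset.mem_range.1 h1
    rw [Nat.div_mul_cancel h2]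
    omega
  · intro n hn
    obtain ⟨-, h2⟩ := Finset.mem_filter.1 hn
    rw [Nat.sub_sub_self h2, Nat.mul_div_cancel _ hD]

/-! ### The `q`-exponential on the sector -/

theorem hasSum_qExp_pow {q : ℝ} (hq : 1 < q) (a : ℝ) {D : ℕ} (hD : 1 ≤ D) (τ : ℂ) :
    HasSum (fun i => (if D ∣ i then ((a ^ (i / D) / qFactorial q (i / D) : ℝ) : ℂ) else 0) * τ ^ i)
      (qExp q ((a : ℂ) * τ ^ D)) := by
  have hinj : Function.Injective fun n : ℕ => D * n := fun x y h =>
    Nat.eq_of_mul_eq_mul_left hD h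
  refine (hinj.hasSum_iff ?_).1 ?_
  · intro i hi
    rw [if_neg, zero_mul]
    rintro ⟨n, rfl⟩
    exact hi ⟨n, rfl⟩
  · convert hasSum_qExp hq ((a : ℂ) * τ ^ D) using 1
    funext n
    simp only [Function.comp_apply]
    rw [if_pos (Nat.dvd_mul_right D n), Nat.mul_div_cancel_left _ hD]
    push_cast
    rw [mul_pow, pow_mul]
    ring

theorem norm_qExp_pow_coeff_le {q : ℝ} (hq : 1 < q) {a : ℝ} (ha : 0 ≤ a) (D i : ℕ) :
    ‖(if D ∣ i then ((a ^ (i / D) / qFactorial q (i / D) : ℝ) : ℂ) else 0)‖ ≤ (max 1 a) ^ i := by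
  have h1 : (1 : ℝ) ≤ max 1 a := le_max_left _ _
  split_ifs
  · have h2 := one_le_qFactorial hq (i / D)
    rw [Complex.norm_real, Real.norm_of_nonneg (by positivity)]
    calc _ ≤ a ^ (i / D) := div_le_self (by positivity) h2
      _ ≤ (max 1 a) ^ (i / D) := pow_le_pow_left₀ ha (le_max_right _ _) _
      _ ≤ _ := pow_le_pow_right₀ h1 (Nat.div_le_self _ _)
  · rw [norm_zero]; positivity

/-- The exponent is a quadratic polynomial in `log x` with vertex `log q/2 - log(q-1)`. The minimum
over the half line in the hypothesis is thus global. -/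
theorem qExpGrowth_min_le {q x : ℝ} (hq : 1 < q) :
    qExpGrowth q (Real.sqrt q / (q - 1)) ≤ qExpGrowth q x := by
  have hL : 0 < Real.log q := Real.log_pos hq
  rw [qExpGrowth, qExpGrowth, Real.log_div (Real.sqrt_pos.2 (by linarith)).ne' (by linarith),
    Real.log_sqrt (by linarith)]
  set L := Real.log q
  set M := Real.log (q - 1)
  set t := Real.log x
  have h : 0 ≤ (t + L * (-(1 / 2) + M / L)) ^ 2 / (2 * L) := by positivity
  have e : (t + L * (-(1 / 2) + M / L)) ^ 2 / (2 * L) =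
      t ^ 2 / (2 * L) + (-(1 / 2) + M / L) * t -
        ((L / 2 - M) ^ 2 / (2 * L) + (-(1 / 2) + M / L) * (L / 2 - M)) := by
    field_simp
    ring
  linarith

/-- The strict inequality at the minimum `m₀` makes `r₂` at most the fixed fraction `r₂/m₀ < 1` of
the lower bound everywhere, so subtracting it costs only a constant factor. Expanding `log(a r^D)`
gives the leading coefficient `D²/(2 log q)`. -/
theorem exists_qExp_lower_bound {q a s r₂ : ℝ} (hq : 1 < q) (ha : 0 < a) (hs : 0 < s)
    (hr₂ : 0 < r₂) {D : ℕ}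
    (hmin : ∀ x : ℝ, Real.sqrt q / (q - 1) ≤ x → r₂ < s * Real.exp (qExpGrowth q x)) :
    ∃ c > (0 : ℝ), ∃ b : ℝ, ∀ r : ℝ, 0 < r →
      c * Real.exp ((D : ℝ) ^ 2 / (2 * Real.log q) * Real.log r ^ 2 + b * Real.log r) ≤
        s * Real.exp (qExpGrowth q (a * r ^ D)) - r₂ := by
  have hL : 0 < Real.log q := Real.log_pos hq
  set m₀ := s * Real.exp (qExpGrowth q (Real.sqrt q / (q - 1)))
  have hm₀ : r₂ < m₀ := hmin _ le_rfl
  have hm₀0 : 0 < m₀ := by linarith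
  set κ := -(1 / 2) + Real.log (q - 1) / Real.log q
  set t := Real.log a
  have h1 : 0 < 1 - r₂ / m₀ := by
    rw [sub_pos, div_lt_one hm₀0]; exact hm₀
  refine ⟨(1 - r₂ / m₀) * s * Real.exp (t ^ 2 / (2 * Real.log q) + κ * t), by positivity,
    t * D / Real.log q + κ * D, fun r hr => ?_⟩
  have h2 : qExpGrowth q (a * r ^ D) = (t ^ 2 / (2 * Real.log q) + κ * t) +
      ((D : ℝ) ^ 2 / (2 * Real.log q) * Real.log r ^ 2 +
        (t * D / Real.log q + κ * D) * Real.log r) := by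
    rw [qExpGrowth, Real.log_mul ha.ne' (by positivity), Real.log_pow]
    simp only [κ, t]
    field_simp
    ring
  have h3 : m₀ ≤ s * Real.exp (qExpGrowth q (a * r ^ D)) :=
    mul_le_mul_of_nonneg_left (Real.exp_le_exp.2 (qExpGrowth_min_le hq)) hs.le
  have h4 : r₂ ≤ r₂ / m₀ * (s * Real.exp (qExpGrowth q (a * r ^ D))) := by
    calc r₂ = r₂ / m₀ * m₀ := by field_simp
      _ ≤ _ := mul_le_mul_of_nonneg_left h3 (by positivity)
  calc _ = (1 - r₂ / m₀) * (s * Real.exp (qExpGrowth q (a * r ^ D))) := by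
        rw [h2, Real.exp_add (t ^ 2 / (2 * Real.log q) + κ * t)]; ring
    _ ≤ _ := by rw [sub_mul, one_mul]; linarith

theorem ofReal_mul_mem_sector {d δ : ℝ} {τ : ℂ} (hτ : τ ∈ sector d δ) {r : ℝ} (hr : 0 < r) :
    (r : ℂ) * τ ∈ sector d δ := by
  obtain ⟨s, φ, hs, hφ, rfl⟩ := hτ
  exact ⟨r * s, φ, by positivity, hφ, by push_cast; ring⟩

/-! ### Assembling the formal solution -/

/-- `g ↦ F⁻¹(P(i·) ω g)(z)`, with `ω` the weight. -/
theorem exists_invFourier_functional {β μ : ℝ} (hμ : 0 ≤ μ) (P : Polynomial ℂ) {z : ℂ}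
    (hz : z ∈ strip β) : ∃ ℓ : (ℝ →ᵇ ℂ) →ₗ[ℂ] ℂ, ∀ g : ℝ →ᵇ ℂ, ℓ g =
      invFourier (fun m => P.eval (Complex.I * (m : ℂ)) * ((fourierWeight β μ m : ℂ) * g m)) z := by
  refine ⟨{ toFun := fun g => invFourier (fun m => P.eval (Complex.I * (m : ℂ)) *
              ((fourierWeight β μ m : ℂ) * g m)) z
            map_add' := fun g h => ?_
            map_smul' := fun a g => ?_ }, fun g => rfl⟩
  · rw [← invFourier_add ((expDecay_weight_mul hμ g).eval_mul P)
      ((expDecay_weight_mul hμ h).eval_mul P) hz]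
    simp only [BoundedContinuousFunction.coe_add, Pi.add_apply, mul_add]
  · rw [RingHom.id_apply, smul_eq_mul, ← invFourier_const_mul]
    congr 1
    funext m
    simp only [BoundedContinuousFunction.coe_smul, smul_eq_mul]
    ring

/-- The formal `q`-Laplace and inverse Fourier transform of a sequence in the weighted space. -/
noncomputable def formalLaplace (q k β μ : ℝ) (w : ℕ → ℝ →ᵇ ℂ) : PowerSeries (ℂ → ℂ) :=
  PowerSeries.mk fun p => invFourier fun m =>
    (qBorelWeight q k p : ℂ) * ((fourierWeight β μ m : ℂ) * w p m)

theorem diffPoly_coeff_formalLaplace (q k : ℝ) {β μ : ℝ} (hμ : 0 ≤ μ) (w : ℕ → ℝ →ᵇ ℂ)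
    (P : Polynomial ℂ) {z : ℂ} (hz : z ∈ strip β) (p : ℕ) :
    diffPoly P (PowerSeries.coeff p (formalLaplace q k β μ w)) z = (qBorelWeight q k p : ℂ) *
      invFourier (fun m => P.eval (Complex.I * (m : ℂ)) * ((fourierWeight β μ m : ℂ) * w p m)) z := by
  rw [formalLaplace, PowerSeries.coeff_mk,
    diffPoly_invFourier P ((expDecay_weight_mul hμ (w p)).const_mul _) hz, ← invFourier_const_mul]
  congr 1
  funext m
  ring

/-- All terms of the equation are brought to the form `qBorelWeight q k p * ℓ(·)` with one linear
functional `ℓ`, so that applying `ℓ` to the Borel recursion gives the equation at order `p`. -/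
theorem coeff_qExpOp_formalLaplace {q k : ℝ} (hq : 1 < q) {β μ : ℝ} (hμ : 0 ≤ μ) (αD : ℝ) {D : ℕ}
    (hD : 1 ≤ D) (w : ℕ → ℝ →ᵇ ℂ) (P : Polynomial ℂ) {z : ℂ} (hz : z ∈ strip β)
    {ℓ : (ℝ →ᵇ ℂ) →ₗ[ℂ] ℂ} (hℓ : ∀ g : ℝ →ᵇ ℂ, ℓ g = invFourier
      (fun m => P.eval (Complex.I * (m : ℂ)) * ((fourierWeight β μ m : ℂ) * g m)) z) (p : ℕ) :
    PowerSeries.coeff p (qExpOp q k αD D (diffPolyT P (formalLaplace q k β μ w))) z =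
      (qBorelWeight q k p : ℂ) * ℓ (∑ j ∈ Finset.range (p + 1),
        (if D ∣ p - j then ((alphaTilde q k αD D ^ ((p - j) / D) /
          qFactorial q ((p - j) / D) : ℝ) : ℂ) else 0) • w j) := by
  rw [sum_dilated_coeff hD (fun n => ((alphaTilde q k αD D ^ n / qFactorial q n : ℝ) : ℂ)) w p,
    map_sum, Finset.mul_sum, qExpOp, PowerSeries.coeff_mk, Finset.sum_apply]
  refine Finset.sum_congr rfl fun n _ => ?_
  rw [Pi.mul_apply, coeff_leadOp_iterate hq]
  split_ifs with h
  · rw [diffPolyT, PowerSeries.coeff_mk, diffPoly_coeff_formalLaplace q k hμ w P hz, ← hℓ, map_smul,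
      smul_eq_mul, ← mul_assoc, ← mul_assoc, ← mul_assoc]
    congr 1
    rw [← Complex.ofReal_mul, ← Complex.ofReal_mul, ← Complex.ofReal_mul, Complex.ofReal_inj,
      alphaTilde, div_pow]
    have h1 := (qBorelWeight_pos hq k (p - n * D)).ne'
    have h2 := (qBorelWeight_pos hq k D).ne'
    have h3 : qFactorial q n ≠ 0 := by linarith [one_le_qFactorial hq n]
    field_simp
  · rw [mul_zero, map_zero, mul_zero]

/-- The product with `a(z)` is a convolution on the Fourier side, and `hT` writes it as `P(im) ω`
times `T g`, the shape required by `ℓ`. The powers of `q` combine to `mahlerWeight`. -/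
theorem coeff_mahlerTerm_formalLaplace {q k : ℝ} (hq : 1 < q) {β μ : ℝ} (hμ : 0 ≤ μ)
    {l : ℕ × ℕ × ℕ} (R P : Polynomial ℂ) {A : ℝ → ℂ} (hA : ExpDecay β A)
    (w : ℕ → ℝ →ᵇ ℂ) {T : (ℝ →ᵇ ℂ) →L[ℂ] (ℝ →ᵇ ℂ)}
    (hT : ∀ (g : ℝ →ᵇ ℂ) (m : ℝ), P.eval (Complex.I * (m : ℂ)) *
      ((fourierWeight β μ m : ℂ) * T g m) = ((1 / Real.sqrt (2 * Real.pi) : ℝ) : ℂ) *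
        ∫ y : ℝ, A (m - y) * (R.eval (Complex.I * (y : ℂ)) * ((fourierWeight β μ y : ℂ) * g y)))
    {z : ℂ} (hz : z ∈ strip β) {ℓ : (ℝ →ᵇ ℂ) →ₗ[ℂ] ℂ} (hℓ : ∀ g : ℝ →ᵇ ℂ, ℓ g = invFourier
      (fun m => P.eval (Complex.I * (m : ℂ)) * ((fourierWeight β μ m : ℂ) * g m)) z) (p : ℕ) :
    PowerSeries.coeff p (mahlerTerm q l R A (formalLaplace q k β μ w)) z =
      (qBorelWeight q k p : ℂ) * ℓ (mahlerCoeff q k l T w p) := by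
  have hq0 : 0 < q := by linarith
  rw [mahlerTerm, PowerSeries.coeff_C_mul, Pi.mul_apply, mahler, PowerSeries.coeff_mk, mahlerCoeff]
  by_cases h1 : l.2.2 ∣ p
  · rw [if_pos h1, PowerSeries.coeff_X_pow_mul']
    by_cases h2 : l.1 ≤ p / l.2.2
    · rw [if_pos h2, if_pos ⟨h1, h2⟩, dilation, PowerSeries.coeff_rescale, Pi.mul_apply,
        Pi.pow_apply, diffPolyT, PowerSeries.coeff_mk, diffPoly_coeff_formalLaplace q k hμ w R hz]
      have h3 : (p / l.2.2 - l.1 + l.1) * l.2.2 = p := by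
        rw [Nat.sub_add_cancel h2, Nat.div_mul_cancel h1]
      set n := p / l.2.2 - l.1
      have h4 : invFourier A z * invFourier (fun m => R.eval (Complex.I * (m : ℂ)) *
          ((fourierWeight β μ m : ℂ) * w n m)) z = ℓ (T (w n)) := by
        rw [invFourier_mul_invFourier hA ((expDecay_weight_mul hμ (w n)).eval_mul R) hz, hℓ]
        congr 1
        funext m
        rw [hT]
      have h5 : qBorelWeight q k p * mahlerWeight q k l n =
          (q ^ (l.2.1 : ℝ)) ^ n * qBorelWeight q k n := by
        rw [mahlerWeight, h3, ← Real.rpow_natCast, ← Real.rpow_mul hq0.le,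
          mul_div_cancel₀ _ (qBorelWeight_pos hq k p).ne']
      rw [map_smul, smul_eq_mul, ← h4, ← mul_assoc (qBorelWeight q k p : ℂ), ← Complex.ofReal_mul,
        h5]
      push_cast
      ring
    · rw [if_neg h2, if_neg fun h => h2 h.2, map_zero, mul_zero]
      simp
  · rw [if_neg h1, if_neg fun h => h1 h.1, map_zero, mul_zero]
    simp

end QMahler

/-! ### The theorem. -/

theorem theorem1
    -- the parameters of the equation
    (q k β μ αD : ℝ) (hq : 1 < q) (hk : 0 < k) (hβ : 0 < β) (hμ : 1 < μ) (hαD : 0 < αD)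
    (dD : ℕ) (hdD : 1 ≤ dD)
    (𝒜 : Finset (ℕ × ℕ × ℕ))
    (h𝒜 : ∀ l ∈ 𝒜, 1 ≤ l.2.2 ∧ (l.2.1 : ℝ) ≤ (l.1 : ℝ) / k - 1)
    (hdD𝒜 : ∀ l ∈ 𝒜, 2 ≤ l.2.2 → Real.sqrt (k / ((l.2.2 : ℝ) ^ 2 - 1)) < (dD : ℝ))
    (J : Finset ℕ) (hJ : ∀ j ∈ J, 1 ≤ j)
    (Q RD : Polynomial ℂ) (R : ℕ × ℕ × ℕ → Polynomial ℂ)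
    (hQ : ∀ m : ℝ, Q.eval (Complex.I * (m : ℂ)) ≠ 0)
    (hRD : ∀ m : ℝ, RD.eval (Complex.I * (m : ℂ)) ≠ 0)
    (r₁ r₂ : ℝ) (hr₁ : 0 < r₁) (hr₁₂ : r₁ < r₂)
    (hr : ∀ m : ℝ,
      r₁ ≤ ‖Q.eval (Complex.I * (m : ℂ)) / RD.eval (Complex.I * (m : ℂ))‖ ∧
      ‖Q.eval (Complex.I * (m : ℂ)) / RD.eval (Complex.I * (m : ℂ))‖ ≤ r₂)
    (hdeg : ∀ l ∈ 𝒜, (R l).natDegree ≤ RD.natDegree)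
    -- the geometric configuration
    (d δ ρ θ : ℝ) (hδ : 0 < δ) (hρ : 0 < ρ) (hθ : 0 < θ) (hθ' : θ < Real.pi / 2)
    (hgeo : GeometricConfiguration q k αD dD d δ ρ θ)
    -- the constants of the lower bounds for `exp_q`, and the smallness of `Q/R_D`
    (K₀ C₀ : ℝ) (hK₀ : 0 < K₀) (hC₀ : 0 < C₀)
    (hlow : ∀ τ ∈ sector d δ, ρ ≤ ‖τ‖ →
      Real.sin θ / K₀ * Real.exp (qExpGrowth q (alphaTilde q k αD dD * ‖τ‖ ^ dD)) ≤
        ‖qExp q ((alphaTilde q k αD dD : ℂ) * τ ^ dD)‖)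
    (hlow₀ : ∀ τ ∈ Metric.closedBall (0 : ℂ) ρ,
      C₀ ≤ ‖qExp q ((alphaTilde q k αD dD : ℂ) * τ ^ dD)‖)
    (hr₂ : r₂ < C₀)
    (hr₂' : ∀ x : ℝ, Real.sqrt q / (q - 1) ≤ x →
      r₂ < Real.sin θ / K₀ * Real.exp (qExpGrowth q x)) :
    ∃ ϖc > (0 : ℝ), ∃ ϖf > (0 : ℝ),
      -- the coefficients and the forcing term
      ∀ (A : ℕ × ℕ × ℕ → ℝ → ℂ) (F : ℕ → ℝ → ℂ) (CA : ℕ × ℕ × ℕ → ℝ) (CF : ℕ → ℝ) (d₁ : ℝ),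
        (∀ l ∈ 𝒜, Continuous (A l) ∧ 0 < CA l ∧
          ∀ m : ℝ, ‖A l m‖ ≤ CA l * (1 / (1 + |m|) ^ μ) * Real.exp (-β * |m|)) →
        (∀ j ∈ J, Continuous (F j) ∧ 0 < CF j ∧
          ∀ m : ℝ, ‖F j m‖ ≤ CF j * (1 / (1 + |m|) ^ μ) * Real.exp (-β * |m|)) →
        (∀ l ∈ 𝒜, CA l ≤ ϖc) → (∀ j ∈ J, CF j ≤ ϖf) →
        -- the forcing term is a polynomial in `t`
        (∀ s : ℂ, ∀ z ∈ strip β, forcing q k d₁ J F s z =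
          ∑ j ∈ J, PowerSeries.coeff j (forcingSeries q k J F) z * Complex.exp s ^ j) ∧
        -- the formal solution and its summability
        ∃ u : PowerSeries (ℂ → ℂ),
          IsFormalSolution q k β αD dD 𝒜 J Q RD R A F u ∧
          ∀ β' : ℝ, 0 < β' → β' < β →
            ∃ v : ℕ → Ob β',
              (∀ p : ℕ, ∀ z : strip β',
                (v p : BoundedContinuousFunction (strip β') ℂ) z
                  = PowerSeries.coeff p u (z : ℂ)) ∧
              GqSummable q k d v := by
  classical
  have hμ0 : 0 ≤ μ := by linarith
  have hdD0 : (0 : ℝ) < dD := by exact_mod_cast hdD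
  have hα : 0 < alphaTilde q k αD dD := div_pos hαD (qBorelWeight_pos hq k dD)
  -- `l₀ = 0` would give `l₁ ≤ -1`.
  have h𝒜' : ∀ l ∈ 𝒜, 1 ≤ l.1 ∧ 1 ≤ l.2.2 ∧ (l.2.1 : ℝ) ≤ (l.1 : ℝ) / k - 1 := fun l hl => by
    obtain ⟨h1, h2⟩ := h𝒜 l hl
    refine ⟨Nat.one_le_iff_ne_zero.2 fun h0 => ?_, h1, h2⟩
    rw [h0] at h2
    have : (0 : ℝ) ≤ l.2.1 := Nat.cast_nonneg _
    simp at h2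
    linarith
  have hdD𝒜' : ∀ l ∈ 𝒜, 2 ≤ l.2.2 → k / ((l.2.2 : ℝ) ^ 2 - 1) < (dD : ℝ) ^ 2 :=
    fun l hl h2 => (Real.sqrt_lt' hdD0).1 (hdD𝒜 l hl h2)
  -- The construction inverts only `Φ - e(τ)`, whatever the norms of the `T l` and `f j`, so any
  -- positive thresholds serve.
  refine ⟨1, one_pos, 1, one_pos, fun A F CA CF d₁ hA hF _ _ => ?_⟩
  have hAw : ∀ l ∈ 𝒜, ∀ m, ‖A l m‖ ≤ CA l * fourierWeight β μ m := fun l hl m => by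
    rw [fourierWeight, ← mul_assoc]; exact (hA l hl).2.2 m
  have hFw : ∀ j ∈ J, ∀ m, ‖F j m‖ ≤ CF j * fourierWeight β μ m := fun j hj m => by
    rw [fourierWeight, ← mul_assoc]; exact (hF j hj).2.2 m
  have hAd : ∀ l ∈ 𝒜, ExpDecay β (A l) := fun l hl =>
    expDecay_of_le_weight hμ0 (hA l hl).1 (hA l hl).2.1.le (hAw l hl)
  have hFd : ∀ j ∈ J, ExpDecay β (F j) := fun j hj =>
    expDecay_of_le_weight hμ0 (hF j hj).1 (hF j hj).2.1.le (hFw j hj)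
  refine ⟨fun s z hz => forcing_eq hq hk d₁ J hFd s hz, ?_⟩
  have hQc : Continuous fun m : ℝ => Q.eval (Complex.I * (m : ℂ)) :=
    Q.continuous.comp (by fun_prop)
  have hRDc : Continuous fun m : ℝ => RD.eval (Complex.I * (m : ℂ)) :=
    RD.continuous.comp (by fun_prop)
  let φ : ℝ →ᵇ ℂ := BoundedContinuousFunction.ofNormedAddCommGroup
    (fun m : ℝ => Q.eval (Complex.I * (m : ℂ)) / RD.eval (Complex.I * (m : ℂ)))
    (hQc.div hRDc hRD) r₂ fun m => (hr m).2
  have hr₂0 : 0 < r₂ := hr₁.trans hr₁₂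
  let Φ : (ℝ →ᵇ ℂ) →L[ℂ] (ℝ →ᵇ ℂ) := ContinuousLinearMap.mul ℂ (ℝ →ᵇ ℂ) φ
  have hΦ : ‖Φ‖ ≤ r₂ := (ContinuousLinearMap.opNorm_mul_apply_le ℂ _ φ).trans
    ((BoundedContinuousFunction.norm_le hr₂0.le).2 fun m => (hr m).2)
  -- The operators are extended by `0` outside `𝒜`, so that the choice gives a family over all
  -- triples.
  have hTex : ∀ l : ℕ × ℕ × ℕ, ∃ T : (ℝ →ᵇ ℂ) →L[ℂ] (ℝ →ᵇ ℂ), l ∈ 𝒜 →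
      ∀ (g : ℝ →ᵇ ℂ) (m : ℝ), RD.eval (Complex.I * (m : ℂ)) *
        ((fourierWeight β μ m : ℂ) * T g m) = ((1 / Real.sqrt (2 * Real.pi) : ℝ) : ℂ) *
          ∫ y : ℝ, A l (m - y) *
            ((R l).eval (Complex.I * (y : ℂ)) * ((fourierWeight β μ y : ℂ) * g y)) := by
    intro l
    by_cases hl : l ∈ 𝒜
    · obtain ⟨T, hT⟩ := exists_convolution_operator hβ hμ (hA l hl).1 (hA l hl).2.1.le (hAw l hl)
        (R l) RD (hdeg l hl) hRD
      exact ⟨T, fun _ => hT⟩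
    · exact ⟨0, fun h => absurd h hl⟩
  choose T hT using hTex
  obtain ⟨cD, hcD, hD⟩ := exists_le_norm_eval_I_mul RD.natDegree RD rfl hRD
  have hw0 : ∀ m, (fourierWeight β μ m : ℂ) ≠ 0 := fun m =>
    Complex.ofReal_ne_zero.2 (fourierWeight_pos β μ m).ne'
  have hwc := continuous_fourierWeight β μ
  -- `f j` is `F j` divided by `R_D ω`; the value `0` outside `J` makes the inhomogeneity a
  -- polynomial in `τ`.
  have hfex : ∀ j : ℕ, ∃ f : ℝ →ᵇ ℂ, (j ∈ J → ∀ m : ℝ, RD.eval (Complex.I * (m : ℂ)) *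
      ((fourierWeight β μ m : ℂ) * f m) = F j m) ∧ (j ∉ J → f = 0) := by
    intro j
    by_cases hj : j ∈ J
    · refine ⟨BoundedContinuousFunction.ofNormedAddCommGroup (fun m : ℝ => F j m /
        (RD.eval (Complex.I * (m : ℂ)) * (fourierWeight β μ m : ℂ)))
        ((hF j hj).1.div (hRDc.mul (by fun_prop)) fun m => mul_ne_zero (hRD m) (hw0 m))
        (CF j / cD) fun m => ?_, fun _ m => ?_, fun h => absurd hj h⟩
      · have hωm := fourierWeight_pos β μ m
        have h1 : cD ≤ ‖RD.eval (Complex.I * (m : ℂ))‖ := by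
          refine le_trans ?_ (hD m)
          exact le_mul_of_one_le_right hcD.le (one_le_pow₀ (by linarith [abs_nonneg m]))
        have h2 := (hF j hj).2.1
        rw [norm_div, norm_mul, Complex.norm_real, Real.norm_of_nonneg hωm.le]
        calc _ ≤ CF j * fourierWeight β μ m / (cD * fourierWeight β μ m) :=
              div_le_div₀ (by positivity) (hFw j hj m) (by positivity)
                (mul_le_mul_of_nonneg_right h1 hωm.le)
          _ = _ := by field_simp
      · change _ * (_ * (F j m / _)) = _
        rw [← mul_assoc, mul_div_cancel₀ _ (mul_ne_zero (hRD m) (hw0 m))]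
    · exact ⟨0, fun h => absurd h hj, fun _ => rfl⟩
  choose f hfJ hf0 using hfex
  have hsin : 0 < Real.sin θ := Real.sin_pos_of_pos_of_lt_pi hθ (by linarith)
  obtain ⟨c, hc, b, hlowc⟩ := exists_qExp_lower_bound (D := dD) hq hα (div_pos hsin hK₀) hr₂0 hr₂'
  obtain ⟨w, hw₀, hrec, ρ₀, hρ₀, W, hWsum, hWd, K, hK, α, hα', hWg⟩ :=
    exists_borel_solution hq hk 𝒜 h𝒜' hdD0 hdD𝒜' J hJ f hf0 Φ T
      (hasSum_qExp_pow hq (alphaTilde q k αD dD) hdD)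
      ((differentiable_qExp hq).comp (by fun_prop))
      (by simp [qFactorial_zero]) (le_trans zero_le_one (le_max_left _ _))
      (norm_qExp_pow_coeff_le hq hα.le dD) (S := sector d δ)
      (fun τ hτ r hr0 => ofReal_mul_mem_sector hτ hr0) hρ (hΦ.trans_lt hr₂)
      (fun τ hτ => hlow₀ τ (mem_closedBall_zero_iff.2 hτ)) hc (b := b)
      (fun τ hτ hρτ => by
        have h1 := hlowc ‖τ‖ (by linarith)
        have h2 := hlow τ hτ hρτ
        linarith)
  refine ⟨formalLaplace q k β μ w, ⟨fun p => ?_, fun z hz => ?_, fun p z hz => ?_⟩, ?_⟩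
  · rw [formalLaplace, PowerSeries.coeff_mk]
    exact differentiableOn_invFourier ((expDecay_weight_mul hμ0 (w p)).const_mul _)
  · rw [formalLaplace, PowerSeries.coeff_mk, hw₀]
    simpa using invFourier_zero z
  -- The functional is built with `R_D`: it restores the factor by which the Borel equation was
  -- divided, and `R_D · (Q/R_D) = Q` accounts for the left side.
  · obtain ⟨ℓ, hℓ⟩ := exists_invFourier_functional hμ0 RD hz
    have hQℓ : PowerSeries.coeff p (diffPolyT Q (formalLaplace q k β μ w)) z =
        (qBorelWeight q k p : ℂ) * ℓ (Φ (w p)) := by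
      rw [diffPolyT, PowerSeries.coeff_mk, diffPoly_coeff_formalLaplace q k hμ0 w Q hz, hℓ]
      congr 2
      funext m
      change _ = RD.eval (Complex.I * (m : ℂ)) * ((fourierWeight β μ m : ℂ) *
        (Q.eval (Complex.I * (m : ℂ)) / RD.eval (Complex.I * (m : ℂ)) * w p m))
      have := hRD m
      field_simp
    have hfℓ : PowerSeries.coeff p (forcingSeries q k J F) z =
        (qBorelWeight q k p : ℂ) * ℓ (f p) := by
      rw [coeff_forcingSeries]
      split_ifs with hp
      · rw [hℓ, mul_comm]
        congr 2
        funext m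
        exact (hfJ p hp m).symm
      · rw [hf0 p hp, map_zero, mul_zero]
    rw [hQℓ, hrec p, map_add ℓ, map_add ℓ, map_sum ℓ _ 𝒜, map_add (PowerSeries.coeff p),
      map_add (PowerSeries.coeff p), Pi.add_apply, Pi.add_apply, map_sum (PowerSeries.coeff p),
      Finset.sum_apply, coeff_qExpOp_formalLaplace hq hμ0 αD hdD w RD hz hℓ, hfℓ, mul_add, mul_add,
      Finset.mul_sum]
    congr 2
    refine Finset.sum_congr rfl fun l hl => ?_
    exact (coeff_mahlerTerm_formalLaplace hq hμ0 (R l) RD (hAd l hl) w (hT l hl) hz hℓ p).symm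
  · intro β' _ hβ'
    obtain ⟨Λ, hΛ⟩ := exists_invFourier_operator (β' := β') hβ' hμ0
    refine ⟨fun p => (qBorelWeight q k p : ℂ) • Λ (w p), fun p z => ?_, ?_⟩
    · rw [formalLaplace, PowerSeries.coeff_mk, invFourier_const_mul, ← hΛ]
      rfl
    · refine ⟨by simp [hw₀], ρ₀, hρ₀, δ, hδ, fun ξ => Λ (W ξ), fun ξ hξ => ?_,
        -- Here `Δ = 2`, as in the majorant for `W`, and `‖Λ‖ + 1` keeps the constant positive even
        -- if `Λ = 0`.
        Λ.differentiable.comp_differentiableOn hWd, (‖Λ‖ + 1) * K, by positivity, α, hα', 2,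
        one_lt_two, fun ξ hξ => ?_⟩
      · have h1 : (fun n => Λ (ξ ^ n • w n)) = fun n =>
            (ξ ^ n / (qBorelWeight q k n : ℂ)) • (qBorelWeight q k n : ℂ) • Λ (w n) := by
          funext n
          rw [smul_smul, div_mul_cancel₀ _
            (Complex.ofReal_ne_zero.2 (qBorelWeight_pos hq k n).ne'), map_smul]
        have h2 : HasSum (fun n => Λ (ξ ^ n • w n)) (Λ (W ξ)) := (hWsum ξ hξ).mapL Λ
        rw [h1] at h2
        exact h2
      · calc ‖Λ (W ξ)‖ ≤ ‖Λ‖ * ‖W ξ‖ := Λ.le_opNorm _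
          _ ≤ (‖Λ‖ + 1) * (K * ‖ξ‖ * Real.exp (k / (2 * Real.log q) * Real.log (‖ξ‖ + 2) ^ 2 +
                α * Real.log (‖ξ‖ + 2))) :=
              mul_le_mul (by linarith) (hWg ξ hξ) (norm_nonneg _) (by positivity)
          _ = _ := by ring
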